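/- **Bounds on ATT.** Let $Y_1,Y_0$ be real-valued potential outcomes, $X\in\{0,1\}$ a treatment, $W$ a vector of covariates in $\mathbb R^K$ with arbitrary distribution, and $Y=XY_1+(1-X)Y_0$. Let $c\in[0,1]$, $p_x=P(X=x)$ and $p_{x\mid w}=P(X=x\mid W=w)$. All conditional distributions given $W=w$ are regular conditional distributions, and statements about $w\in\operatorname{supp}(W)$ are understood for almost every $w$; conditions given $X=x',W=w$ are imposed only where $p_{x'\mid w}>0$. Assume that for $x,x'\in\{0,1\}$ and $w\in\operatorname{supp}(W)$: 1. $Y_x\mid X=x',W=w$ has a continuous distribution function that is strictly increasing on its support; 2. $\operatorname{supp}(Y_x\mid X=x',W=w)=\operatorname{supp}(Y_x\mid W=w)=[\underline y_x(w),\overline y_x(w)]\cap\mathbb R$ for some $-\infty\le\underline y_x(w)<\overline y_x(w)\le\infty$; 3. $p_1>0$ and $p_{1\mid w}<1$; 4. $X$ is conditionally $c$-dependent with $Y_0$ given $W$: $|P(X=1\mid Y_0=y,W=w)-p_{1\mid w}|\le c$ for (almost) every $y\in\operatorname{supp}(Y_0\mid W=w)$. Let $Q_{Y\mid X,W}(\cdot\mid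 0,w):[0,1]\to[\underline y_0(w),\overline y_0(w)]$ be the inverse of the distribution function of $Y\mid X=0,W=w$ on its support (so its values at $0$ and $1$ are the possibly infinite endpoints of the support). For $\tau\in(0,1)$ set $$\overline Q^c_{Y_0}(\tau\mid w)=Q_{Y\mid X,W}\Big(\min\Big\{\tau+\tfrac{c}{p_{0\mid w}}\min\{\tau,1-\tau\},\tfrac{\tau}{p_{0\mid w}},1\Big\}\,\Big|\,0,w\Big),$$ $$\underline Q^c_{Y_0}(\tau\mid w)=Q_{Y\mid X,W}\Big(\max\Big\{\tau-\tfrac{c}{p_{0\mid w}}\min\{\tau,1-\tau\},\tfrac{\tau-1}{p_{0\mid w}}+1,0\Big\}\,\Big|\,0,w\Big),$$ $$\overline E_0^c(w)=\int_0^1\overline Q^c_{Y_0}(\tau\mid w)\,d\tau,\quad \underline E_0^c(w)=\int_0^1\underline Q^c_{Y_0}(\tau\mid w)\,d\tau,\quad \overline E_0^c=E\big(\overline E_0^c(W)\big),\quad \underline E_0^c=E\big(\underline E_0^c(W)\big).$$ Assume that the means $E(Y\mid X=1)$, $\overline E_0^c$ and $\underline E_0^c$ exist (possibly $\pm\infty$),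 that $E(|Y|\mid X=0)<\infty$, and that no $\infty-\infty$ occurs below: $\overline E_0^c\neq+\infty$ if $E(Y\mid X=1)=+\infty$, and $\underline E_0^c\ne-\infty$ if $E(Y\mid X=1)=-\infty$. Then $\mathrm{ATT}=E(Y_1-Y_0\mid X=1)$, if it exists (possibly as $\pm\infty$), lies in $$\left[E(Y\mid X=1)-\frac{\overline E_0^c-p_0E(Y\mid X=0)}{p_1},\; E(Y\mid X=1)-\frac{\underline E_0^c-p_0E(Y\mid X=0)}{p_1}\right].$$ Moreover the interior of this set is sharp: for every real $e$ strictly between the two endpoints there is a joint distribution of $(Y_1,Y_0,X,W)$ which satisfies assumptions 1--4 with the same $c$, yields the same distribution of $(Y,X,W)$, and for which ATT exists and equals $e$. -/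

import Mathlib

open MeasureTheory ProbabilityTheory Set

namespace ATTBounds

noncomputable section

/-! ### Latent and observed variables -/

/-- Values of `((Y_0, Y_1), X, W)`: the two potential outcomes, the binary treatment, and a
vector of `K` covariates (whose law is arbitrary). -/
abbrev Latent (K : ℕ) : Type := (Fin 2 → ℝ) × Fin 2 × (Fin K → ℝ)

/-- Values of the observed vector `(Y, X, W)`. -/
abbrev Observed (K : ℕ) : Type := ℝ × Fin 2 × (Fin K → ℝ)

/-- The potential outcome `Y_x`. -/
def pot {K : ℕ} (x : Fin 2) (o : Latent K) : ℝ := o.1 x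

/-- The treatment `X`. -/
def treat {K : ℕ} (o : Latent K) : Fin 2 := o.2.1

/-- The covariates `W`. -/
def cov {K : ℕ} (o : Latent K) : Fin K → ℝ := o.2.2

/-- The observed vector `(Y, X, W)`, where `Y = X Y_1 + (1 - X) Y_0`. -/
def observe {K : ℕ} (o : Latent K) : Observed K :=
  (((treat o : ℕ) : ℝ) * pot 1 o + (1 - ((treat o : ℕ) : ℝ)) * pot 0 o, treat o, cov o)

/-- The law of the observed vector `(Y, X, W)` when `((Y_0, Y_1), X, W)` has law `P`. -/
def observedLaw {K : ℕ} (P : Measure (Latent K)) : Measure (Observed K) := P.map observe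

instance {K : ℕ} (P : Measure (Latent K)) [IsFiniteMeasure P] :
    IsFiniteMeasure (observedLaw P) := by
  unfold observedLaw; infer_instance

/-! ### Means with values in `[-∞, ∞]` -/

/-- The mean of `f` exists, possibly as `+∞` or `-∞`: `f` is measurable up to a null set and at
most one of its positive and negative parts has infinite integral. -/
def HasMean {α : Type*} [MeasurableSpace α] (μ : Measure α) (f : α → EReal) : Prop :=
  AEMeasurable f μ ∧ ((∫⁻ a, (f a).toENNReal ∂μ) ≠ ⊤ ∨ (∫⁻ a, (-f a).toENNReal ∂μ) ≠ ⊤)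

/-- The integral of the positive part minus the integral of the negative part (`toENNReal`
sends negative numbers to `0`). It is the mean of `f` when `HasMean μ f`. -/
def mean {α : Type*} [MeasurableSpace α] (μ : Measure α) (f : α → EReal) : EReal :=
  ((∫⁻ a, (f a).toENNReal ∂μ : ENNReal) : EReal) - ((∫⁻ a, (-f a).toENNReal ∂μ : ENNReal) : EReal)

/-! ### Quantities determined by the observed law `D` of `(Y, X, W)` -/

/-- `p_x = P(X = x)`. -/
def treatProb {K : ℕ} (D : Measure (Observed K)) (x : Fin 2) : ℝ := D.real {q | q.2.1 = x}

/-- The law of `W`. -/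
def covLaw {K : ℕ} (D : Measure (Observed K)) : Measure (Fin K → ℝ) := D.map (fun q => q.2.2)

/-- The propensity score `p_{x|w} = P(X = x | W = w)`. -/
def pscore {K : ℕ} (D : Measure (Observed K)) [IsFiniteMeasure D] (x : Fin 2)
    (w : Fin K → ℝ) : ℝ :=
  (condDistrib (fun q : Observed K => q.2.1) (fun q => q.2.2) D w).real {x}

/-- The conditional law of `Y` given `X = x`, `W = w`. -/
def outcomeLaw {K : ℕ} (D : Measure (Observed K)) [IsFiniteMeasure D] (x : Fin 2)
    (w : Fin K → ℝ) : Measure ℝ :=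
  condDistrib (fun q : Observed K => q.1) (fun q => q.2) D (x, w)

/-- The joint law of `(Y, X, W)` given `X = x`. -/
def givenTreat {K : ℕ} (D : Measure (Observed K)) (x : Fin 2) : Measure (Observed K) :=
  cond D {q | q.2.1 = x}

/-- The inverse of the distribution function of `ν` on the support of `ν`, with values in
`[-∞, ∞]`: the least `y` in the support with `u ≤ F(y)`. For `0 < u < 1` this is the usual
quantile; at `u = 0` and `u = 1` it gives the (possibly infinite) ends of the support, when this
is an interval and `F` is strictly increasing on it. -/
def quantile (ν : Measure ℝ) (u : ℝ) : EReal :=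
  sInf ((fun y : ℝ => (y : EReal)) '' {y | y ∈ ν.support ∧ u ≤ cdf ν y})

/-- `min {τ + (c/p) min {τ, 1 - τ}, τ/p, 1}`. -/
def upperRank (c p τ : ℝ) : ℝ := min (min (τ + c / p * min τ (1 - τ)) (τ / p)) 1

/-- `max {τ - (c/p) min {τ, 1 - τ}, (τ - 1)/p + 1, 0}`. -/
def lowerRank (c p τ : ℝ) : ℝ := max (max (τ - c / p * min τ (1 - τ)) ((τ - 1) / p + 1)) 0

/-- The upper bound on the `τ`-quantile of `Y_x` given `W = w`. -/
def upperQ {K : ℕ} (D : Measure (Observed K)) [IsFiniteMeasure D] (c : ℝ) (x : Fin 2)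
    (w : Fin K → ℝ) (τ : ℝ) : EReal :=
  quantile (outcomeLaw D x w) (upperRank c (pscore D x w) τ)

/-- The lower bound on the `τ`-quantile of `Y_x` given `W = w`. -/
def lowerQ {K : ℕ} (D : Measure (Observed K)) [IsFiniteMeasure D] (c : ℝ) (x : Fin 2)
    (w : Fin K → ℝ) (τ : ℝ) : EReal :=
  quantile (outcomeLaw D x w) (lowerRank c (pscore D x w) τ)

/-- The upper bound on `E(Y_0 | W = w)`: the upper quantile bound integrated over `(0, 1)`. -/
def upperE0Given {K : ℕ} (D : Measure (Observed K)) [IsFiniteMeasure D] (c : ℝ)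
    (w : Fin K → ℝ) : EReal :=
  mean (volume.restrict (Ioo (0 : ℝ) 1)) (upperQ D c 0 w)

/-- The lower bound on `E(Y_0 | W = w)`: the lower quantile bound integrated over `(0, 1)`. -/
def lowerE0Given {K : ℕ} (D : Measure (Observed K)) [IsFiniteMeasure D] (c : ℝ)
    (w : Fin K → ℝ) : EReal :=
  mean (volume.restrict (Ioo (0 : ℝ) 1)) (lowerQ D c 0 w)

/-- The upper bound on `E(Y_0)`. -/
def upperE0 {K : ℕ} (D : Measure (Observed K)) [IsFiniteMeasure D] (c : ℝ) : EReal :=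
  mean (covLaw D) (upperE0Given D c)

/-- The lower bound on `E(Y_0)`. -/
def lowerE0 {K : ℕ} (D : Measure (Observed K)) [IsFiniteMeasure D] (c : ℝ) : EReal :=
  mean (covLaw D) (lowerE0Given D c)

/-- `E(Y | X = x)`. -/
def meanGiven {K : ℕ} (D : Measure (Observed K)) (x : Fin 2) : EReal :=
  mean (givenTreat D x) (fun q => (q.1 : EReal))

/-- `E(Y | X = 1) - (E₀ - p_0 E(Y | X = 0)) / p_1`. -/
def attOf {K : ℕ} (D : Measure (Observed K)) (E₀ : EReal) : EReal :=
  meanGiven D 1 - (E₀ - (treatProb D 0 : EReal) * meanGiven D 0) / (treatProb D 1 : EReal)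

/-! ### The assumptions on the law `P` of `((Y_0, Y_1), X, W)`

Conditional laws given `W = w` are regular conditional distributions. They are determined up to
null sets of `w`, so "for all `w` in the support of `W`" is read as "for almost every `w`", and
conditioning on `X = x', W = w` refers to those `(x', w)` with `P(X = x' | W = w) > 0`. -/

/-- The conditional law of `Y_x` given `W = w`. -/
def potLaw {K : ℕ} (P : Measure (Latent K)) [IsFiniteMeasure P] (x : Fin 2)
    (w : Fin K → ℝ) : Measure ℝ :=
  condDistrib (pot x) (cov : Latent K → Fin K → ℝ) P w

/-- The conditional law of `Y_x` given `X = x'`, `W = w`. -/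
def potLawGiven {K : ℕ} (P : Measure (Latent K)) [IsFiniteMeasure P] (x x' : Fin 2)
    (w : Fin K → ℝ) : Measure ℝ :=
  condDistrib (pot x) (fun o : Latent K => (treat o, cov o)) P (x', w)

/-- `P(X = 1 | Y_x = y, W = w)`. -/
def latentScore {K : ℕ} (P : Measure (Latent K)) [IsFiniteMeasure P] (x : Fin 2)
    (y : ℝ) (w : Fin K → ℝ) : ℝ :=
  (condDistrib treat (fun o : Latent K => (pot x o, cov o)) P (y, w)).real {1}

/-- `X` is conditionally `c`-dependent with `Y_x` given `W`. -/
def CondCDep {K : ℕ} (P : Measure (Latent K)) [IsFiniteMeasure P] (c : ℝ) (x : Fin 2) : Prop :=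
  ∀ᵐ w ∂covLaw (observedLaw P), ∀ᵐ y ∂potLaw P x w,
    |latentScore P x y w - pscore (observedLaw P) 1 w| ≤ c

/-- `Y_x | X = x', W = w` has a continuous distribution function that is strictly increasing on
the support. -/
def ContinuousOutcomes {K : ℕ} (P : Measure (Latent K)) [IsFiniteMeasure P] : Prop :=
  ∀ᵐ w ∂covLaw (observedLaw P), ∀ x x' : Fin 2, 0 < pscore (observedLaw P) x' w →
    Continuous (cdf (potLawGiven P x x' w)) ∧
      StrictMonoOn (cdf (potLawGiven P x x' w)) (potLawGiven P x x' w).support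

/-- The support of `Y_x | X = x', W = w` equals that of `Y_x | W = w`, and is a nondegenerate,
possibly infinite, closed interval. -/
def SupportIndependence {K : ℕ} (P : Measure (Latent K)) [IsFiniteMeasure P] : Prop :=
  ∀ᵐ w ∂covLaw (observedLaw P), ∀ x : Fin 2, ∃ a b : EReal, a < b ∧
    (potLaw P x w).support = {y : ℝ | a ≤ y ∧ (y : EReal) ≤ b} ∧
    ∀ x' : Fin 2, 0 < pscore (observedLaw P) x' w →
      (potLawGiven P x x' w).support = (potLaw P x w).support

/-- The maintained assumptions on the law of `((Y_0, Y_1), X, W)`. -/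
structure Admissible {K : ℕ} (P : Measure (Latent K)) [IsFiniteMeasure P] (c : ℝ) : Prop where
  continuous_outcomes : ContinuousOutcomes P
  support_independence : SupportIndependence P
  treated_pos : 0 < treatProb (observedLaw P) 1
  pscore_lt_one : ∀ᵐ w ∂covLaw (observedLaw P), pscore (observedLaw P) 1 w < 1
  cond_c_dep : CondCDep P c 0

/-! ### The average effect of treatment on the treated -/

/-- The law of `((Y_0, Y_1), X, W)` given `X = 1`. -/
def latentTreated {K : ℕ} (P : Measure (Latent K)) : Measure (Latent K) :=
  cond P {o | treat o = 1}

/-- `E(Y_1 - Y_0 | X = 1)` exists, possibly as `+∞` or `-∞`. -/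
def HasATT {K : ℕ} (P : Measure (Latent K)) : Prop :=
  HasMean (latentTreated P) (fun o => ((pot 1 o - pot 0 o : ℝ) : EReal))

/-- `ATT = E(Y_1 - Y_0 | X = 1)`. -/
def att {K : ℕ} (P : Measure (Latent K)) : EReal :=
  mean (latentTreated P) (fun o => ((pot 1 o - pot 0 o : ℝ) : EReal))

end

end ATTBounds

open ATTBounds

/-! Fix `w` and write `p` for P(X = 0 | W = w), `F` for the law of Y given X = 0, W = w, and `G` for
the law of Y_0 given W = w. The data determine `p` and `F`; only `G` is free. On X = 1 the variable
Y_0 has the subprobability law `G - p F` given W = w, and the integral of P(X = 1 | Y_0, W = w) -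
P(X = 1 | W = w) over a set `A` is `p G(A) - p F(A)`. Hence c-dependence says that `p F` has a
density with respect to `G` lying between `r = max (p - c) 0` and `s = min (p + c) 1` (`Dep`,
`condCDep_iff`).

Bounds. On half-lines the density bounds give `p F(y) ≤ min (s G(y)) (p - r (1 - G(y)))`, and the
right side as a function of the rank `τ = G(y)` is `p * upperRank c p τ` (`mul_upperRank`). So the
`τ`-quantile of `G` is at most that of `F` at `upperRank` (`rq_le_quantile_upperRank`), and
symmetrically from below. Integrating over `τ` and then over `w` bounds E(Y_0), and E(Y_0) = p_0 E(Y
| X = 0) + p_1 E(Y_0 | X = 1) turns this into bounds on the ATT. Infinite means need separate care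
(`bound_le_mean_sub`).

Sharpness. A value `e` of the ATT corresponds to the value `T = p_0 E(Y | X = 0) + p_1 (E(Y | X = 1)
- e)` of E(Y_0), strictly between the two bounds. Given a kernel `G` of permissible laws with finite
first moment and mean `T`, the law `P` is changed on X = 1 only: (W, Y_0) receives the law that is
left when its law on X = 0 is subtracted, and Y_1 is drawn given W independently of Y_0
(`modifiedLaw`). Continuity and support conditions survive because `F`, `G` and `G - p F` are
required to have the same null sets when both treatments are possible (`Compatible`,
`admissible_of_compatible`).

The extremal rank map may have slopes that destroy this equivalence, so it is mixed with the
identity with weight `ε`. Pushing the uniform law through the quantile function of `F` composed with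
a rank map `R` turns slopes of `p R` into density bounds (`IsRank.measure_le`, `IsRank.le_measure`),
and as `ε` tends to 0 the means converge monotonically to the bound for that `w`. The weight is
chosen measurably in `w`, and where the first moment is too large a safe kernel with integrable
first moment is used instead (`exists_chooseKernel_lt`). The law `F` is not always safe, since only
`p` times its first absolute moment is known to be integrable over `w`; where `p ≤ c` it is mixed
with its restriction to a ball (`concentrated`). This produces kernels with means above and below
`T`, and a convex combination has mean `T` (`exists_compatible_integral_eq`). The case `c = 0` is
void, since the two bounds then coincide. -/

namespace ATTBounds

noncomputable section

/-! ### Chain rule for conditional distributions -/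

section Disintegration

variable {α β γ δ : Type*} [MeasurableSpace α] [MeasurableSpace β] [MeasurableSpace γ]
  [StandardBorelSpace γ] [Nonempty γ] [MeasurableSpace δ] [StandardBorelSpace δ] [Nonempty δ]

/-- Chain rule for regular conditional distributions. -/
theorem condDistrib_prodMk_ae_eq (μ : Measure α) [IsFiniteMeasure μ] {X : α → β} {Y : α → γ}
    {Z : α → δ} (hX : Measurable X) (hY : Measurable Y) (hZ : Measurable Z) :
    condDistrib (fun a => (Y a, Z a)) X μ =ᵐ[μ.map X]
      condDistrib Y X μ ⊗ₖ
        (condDistrib Z (fun a => (Y a, X a)) μ).comap Prod.swap measurable_swap := by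
  refine condDistrib_ae_eq_of_measure_eq_compProd X (by fun_prop) ?_
  have h1 : HasCondDistrib Z (fun a => (Y a, X a)) (condDistrib Z (fun a => (Y a, X a)) μ) μ :=
    ⟨by fun_prop, (compProd_map_condDistrib hZ.aemeasurable).symm⟩
  have h2 := (h1.measurableEquiv_comp_right MeasurableEquiv.prodComm).map_eq
  rw [← Measure.compProd_assoc', compProd_map_condDistrib hY.aemeasurable]
  have h3 : (μ.map fun a => (X a, Y a)) ⊗ₘ
      (condDistrib Z (fun a => (Y a, X a)) μ).comap Prod.swap measurable_swap =
      μ.map fun a => ((X a, Y a), Z a) := h2.symm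
  rw [h3, Measure.map_map (by fun_prop) (by fun_prop)]
  rfl

/-- Chain rule for regular conditional distributions, evaluated on rectangles. -/
theorem condDistrib_prodMk_apply_prod (μ : Measure α) [IsFiniteMeasure μ] {X : α → β} {Y : α → γ}
    {Z : α → δ} (hX : Measurable X) (hY : Measurable Y) (hZ : Measurable Z) :
    ∀ᵐ w ∂μ.map X, ∀ s t, MeasurableSet s → MeasurableSet t →
      condDistrib (fun a => (Y a, Z a)) X μ w (s ×ˢ t) =
        ∫⁻ y in s, condDistrib Z (fun a => (Y a, X a)) μ (y, w) t ∂condDistrib Y X μ w := by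
  filter_upwards [condDistrib_prodMk_ae_eq μ hX hY hZ] with w hw s t hs ht
  rw [hw, Kernel.compProd_apply_prod hs ht]
  rfl

end Disintegration

/-! ### Conditional laws expressed through the law of all latent variables given W -/

section Slices

variable {K : ℕ}

@[fun_prop]
theorem measurable_pot (x : Fin 2) : Measurable (pot x : Latent K → ℝ) := by
  unfold pot; fun_prop

@[fun_prop]
theorem measurable_treat : Measurable (treat : Latent K → Fin 2) := by
  unfold treat; fun_prop

@[fun_prop]
theorem measurable_cov : Measurable (cov : Latent K → Fin K → ℝ) := by
  unfold cov; fun_prop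

@[fun_prop]
theorem measurable_observe : Measurable (observe : Latent K → Observed K) := by
  unfold observe
  have : Measurable (fun i : Fin 2 => ((i : ℕ) : ℝ)) := measurable_of_finite _
  have h2 : Measurable (fun o : Latent K => ((treat o : ℕ) : ℝ)) := this.comp measurable_treat
  fun_prop

theorem observe_eq (o : Latent K) : observe o = (pot (treat o) o, treat o, cov o) := by
  unfold observe
  have h : ∀ t : Fin 2, t = 0 ∨ t = 1 := by decide
  rcases h (treat o) with h | h <;> simp [h]

theorem covLaw_observedLaw (P : Measure (Latent K)) : covLaw (observedLaw P) = P.map cov := by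
  unfold covLaw observedLaw
  rw [Measure.map_map (by fun_prop) (by fun_prop)]
  rfl

instance (P : Measure (Latent K)) [IsProbabilityMeasure P] :
    IsProbabilityMeasure (observedLaw P) :=
  Measure.isProbabilityMeasure_map measurable_observe.aemeasurable

instance (D : Measure (Observed K)) [IsProbabilityMeasure D] : IsProbabilityMeasure (covLaw D) :=
  Measure.isProbabilityMeasure_map (by fun_prop)

/-- The conditional law of `((Y_0, Y_1), X, W)` given `W = w`. -/
def slice (P : Measure (Latent K)) [IsFiniteMeasure P] : Kernel (Fin K → ℝ) (Latent K) :=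
  condDistrib id cov P

instance (P : Measure (Latent K)) [IsFiniteMeasure P] : IsMarkovKernel (slice P) := by
  unfold slice; infer_instance

variable (P : Measure (Latent K)) [IsFiniteMeasure P]

theorem condDistrib_cov_ae_eq {β : Type*} [MeasurableSpace β] [StandardBorelSpace β] [Nonempty β]
    {f : Latent K → β} (hf : Measurable f) :
    condDistrib f cov P =ᵐ[covLaw (observedLaw P)] (slice P).map f := by
  rw [covLaw_observedLaw]
  exact condDistrib_comp (μ := P) cov (Y := id) aemeasurable_id hf

theorem lintegral_slice {f : Latent K → ENNReal} (hf : Measurable f) :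
    ∫⁻ w, ∫⁻ o, f o ∂slice P w ∂covLaw (observedLaw P) = ∫⁻ o, f o ∂P := by
  have h := condDistrib_comp_map (μ := P) (X := cov) (Y := id) measurable_cov.aemeasurable
    aemeasurable_id
  rw [Measure.map_id] at h
  rw [covLaw_observedLaw]
  conv_rhs => rw [← h]
  rw [Measure.lintegral_bind (Kernel.aemeasurable _) hf.aemeasurable]
  rfl

theorem potLaw_ae_eq_slice (x : Fin 2) :
    ∀ᵐ w ∂covLaw (observedLaw P), potLaw P x w = (slice P w).map (pot x) := by
  filter_upwards [condDistrib_cov_ae_eq P (measurable_pot x)] with w hw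
  rw [potLaw, hw, Kernel.map_apply _ (measurable_pot x)]

theorem pscore_ae_eq_slice (x : Fin 2) :
    ∀ᵐ w ∂covLaw (observedLaw P),
      pscore (observedLaw P) x w = (slice P w).real {o | treat o = x} := by
  have h := condDistrib_map (Y := fun q : Observed K => q.2.1) (X := fun q => q.2.2)
    (ν := P) (f := observe) (by fun_prop) (by fun_prop) (by fun_prop)
  have hc := covLaw_observedLaw P
  filter_upwards [hc ▸ h, condDistrib_cov_ae_eq P measurable_treat] with w hw hw'
  change (condDistrib _ _ (P.map observe) w).real {x} = _
  rw [hw]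
  change (condDistrib treat cov P w).real {x} = _
  rw [hw', Kernel.map_apply _ measurable_treat, map_measureReal_apply (by fun_prop)
    (MeasurableSet.singleton x)]
  rfl

/-- The chain rule for (X, Z) given W on the rectangles `{x'} ×ˢ A`. The product form needs no case
distinction where the propensity score vanishes, and one null set of `w` serves all `A`. -/
theorem condDistrib_treat_ae_eq_slice {Z : Latent K → ℝ} (hZ : Measurable Z) :
    ∀ᵐ w ∂covLaw (observedLaw P), ∀ x' : Fin 2, ∀ A, MeasurableSet A →
      pscore (observedLaw P) x' w *
        (condDistrib Z (fun o : Latent K => (treat o, cov o)) P (x', w)).real A =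
        (slice P w).real ({o | treat o = x'} ∩ Z ⁻¹' A) := by
  have hc := covLaw_observedLaw P
  have h1 := condDistrib_prodMk_apply_prod P measurable_cov measurable_treat hZ
  rw [← hc] at h1
  filter_upwards [h1, condDistrib_cov_ae_eq P (f := fun o => (treat o, Z o)) (by fun_prop),
    condDistrib_cov_ae_eq P measurable_treat, pscore_ae_eq_slice P 0, pscore_ae_eq_slice P 1]
    with w hw1 hw2 hw3 hp0 hp1 x' A hA
  have hp : pscore (observedLaw P) x' w = (slice P w).real {o | treat o = x'} := by
    have h : ∀ t : Fin 2, t = 0 ∨ t = 1 := by decide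
    rcases h x' with rfl | rfl <;> assumption
  have h := hw1 {x'} A (MeasurableSet.singleton x') hA
  rw [hw2, Kernel.map_apply _ (by fun_prop), Measure.map_apply (by fun_prop)
    ((MeasurableSet.singleton x').prod hA), hw3, Kernel.map_apply _ measurable_treat,
    lintegral_singleton, Measure.map_apply (by fun_prop) (MeasurableSet.singleton x')] at h
  rw [hp, measureReal_def, measureReal_def, measureReal_def, mul_comm, ← ENNReal.toReal_mul]
  congr 1
  exact h.symm

theorem potLawGiven_ae_eq_slice (x : Fin 2) :
    ∀ᵐ w ∂covLaw (observedLaw P), ∀ x' : Fin 2, ∀ A, MeasurableSet A →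
      pscore (observedLaw P) x' w * (potLawGiven P x x' w).real A =
        (slice P w).real ({o | treat o = x'} ∩ pot x ⁻¹' A) :=
  condDistrib_treat_ae_eq_slice P (measurable_pot x)

/-- The law of (X, W) gives the point `x` over `w` the weight P(X = x | W = w), so a null set of
pairs meets the pairs of positive weight only over a null set of `w`. -/
theorem treat_cov_ae {p : Fin 2 × (Fin K → ℝ) → Prop}
    (h : ∀ᵐ z ∂P.map (fun o : Latent K => (treat o, cov o)), p z) :
    ∀ᵐ w ∂covLaw (observedLaw P), ∀ x, 0 < pscore (observedLaw P) x w → p (x, w) := by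
  have h1 : ∀ᵐ o ∂P, p (treat o, cov o) := ae_of_ae_map (by fun_prop) h
  obtain ⟨s, hsub, hs, hs0⟩ := exists_measurable_superset_of_null (ae_iff.1 h)
  have h0 : ∫⁻ o, s.indicator (fun _ => (1 : ENNReal)) (treat o, cov o) ∂P = 0 := by
    rw [← lintegral_map (f := s.indicator fun _ => 1) (measurable_const.indicator hs)
      (g := fun o : Latent K => (treat o, cov o)) (by fun_prop), lintegral_indicator_const hs, hs0, mul_zero]
  have hm : Measurable fun o : Latent K => s.indicator (fun _ => (1 : ENNReal)) (treat o, cov o) :=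
    (measurable_const.indicator hs).comp
      (measurable_treat.prodMk measurable_cov)
  rw [← lintegral_slice P hm, lintegral_eq_zero_iff
    (hm.lintegral_kernel (κ := slice P))] at h0
  -- Given W = w the latent vector lies in the fibre over `w`, so (X, W) can be read as (X, w)
  -- there.
  have hcov : ∀ᵐ w ∂covLaw (observedLaw P), ∀ᵐ o ∂slice P w, cov o = w := by
    have h2 := condDistrib_comp_self (μ := P) cov (f := id) measurable_id
    have h3 := condDistrib_cov_ae_eq P measurable_cov
    rw [← covLaw_observedLaw] at h2
    filter_upwards [h2, h3] with w h2 h3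
    have h4 : (slice P w).map cov = Measure.dirac w := by
      rw [← Kernel.map_apply _ measurable_cov, ← h3]
      exact h2
    have h5 : ∀ᵐ v ∂(slice P w).map cov, v = w := by
      rw [h4]
      simp [ae_dirac_eq]
    exact ae_of_ae_map (by fun_prop) h5
  filter_upwards [h0, hcov, pscore_ae_eq_slice P 0, pscore_ae_eq_slice P 1] with w hw hcw hp0 hp1
    x hx
  have hp : pscore (observedLaw P) x w = (slice P w).real {o | treat o = x} := by
    have h : ∀ t : Fin 2, t = 0 ∨ t = 1 := by decide
    rcases h x with rfl | rfl <;> assumption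
  rw [hp] at hx
  by_contra hn
  have hmem : (x, w) ∈ s := hsub hn
  simp only [Pi.zero_apply] at hw
  rw [lintegral_eq_zero_iff hm] at hw
  have : ∀ᵐ o ∂slice P w, treat o ≠ x := by
    filter_upwards [hw, hcw] with o ho hco hox
    rw [hox, hco] at ho
    simp [hmem] at ho
  have h6 : slice P w {o | treat o = x} = 0 := by
    rw [ae_iff] at this
    simpa using this
  rw [measureReal_def, h6] at hx
  simp at hx

/-- On X = x the observed Y is Y_x, so both laws come from the same slice; the positive weight can
be cancelled. -/
theorem outcomeLaw_ae_eq (x : Fin 2) :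
    ∀ᵐ w ∂covLaw (observedLaw P), 0 < pscore (observedLaw P) x w →
      outcomeLaw (observedLaw P) x w = potLawGiven P x x w := by
  have h := condDistrib_map (Y := fun q : Observed K => q.1) (X := fun q => q.2)
    (ν := P) (f := observe) (by fun_prop) (by fun_prop) (by fun_prop)
  have h' := treat_cov_ae P h
  filter_upwards [h', condDistrib_treat_ae_eq_slice P (Z := fun o => (observe o).1)
    (by fun_prop), potLawGiven_ae_eq_slice P x] with w h1 h2 h3 hx
  unfold outcomeLaw observedLaw
  rw [h1 x hx]
  have : IsFiniteMeasure (potLawGiven P x x w) := by unfold potLawGiven; infer_instance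
  refine Measure.ext fun A hA => ?_
  have e2 := h2 x A hA
  have e3 := h3 x A hA
  have hset : ({o : Latent K | treat o = x} ∩ (fun o => (observe o).1) ⁻¹' A) =
      {o | treat o = x} ∩ pot x ⁻¹' A := by
    ext o
    simp only [mem_inter_iff, mem_ofPred_eq, mem_preimage, observe_eq]
    exact and_congr_right fun h => by rw [h]
  rw [hset, ← e3] at e2
  have e4 := mul_left_cancel₀ hx.ne' e2
  exact (measureReal_eq_measureReal_iff (measure_ne_top _ _) (measure_ne_top _ _)).1 e4

theorem latentScore_ae_eq_slice (x : Fin 2) :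
    ∀ᵐ w ∂covLaw (observedLaw P), ∀ A, MeasurableSet A →
      ∫ y in A, latentScore P x y w ∂potLaw P x w =
        (slice P w).real ({o | treat o = 1} ∩ pot x ⁻¹' A) := by
  have h1 := condDistrib_prodMk_apply_prod P measurable_cov (measurable_pot x) measurable_treat
  rw [← covLaw_observedLaw] at h1
  filter_upwards [h1, condDistrib_cov_ae_eq P (f := fun o => (pot x o, treat o)) (by fun_prop)]
    with w hw1 hw2 A hA
  have h := hw1 A {1} hA (MeasurableSet.singleton 1)
  rw [hw2, Kernel.map_apply _ (by fun_prop), Measure.map_apply (by fun_prop)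
    (hA.prod (MeasurableSet.singleton 1))] at h
  have hset : (fun o : Latent K => (pot x o, treat o)) ⁻¹' (A ×ˢ {1}) =
      {o | treat o = 1} ∩ pot x ⁻¹' A := by
    ext o; simp [and_comm]
  rw [hset] at h
  unfold latentScore potLaw
  simp_rw [measureReal_def]
  rw [h, integral_toReal]
  · have := Kernel.measurable_coe (condDistrib treat (fun o : Latent K => (pot x o, cov o)) P)
      (MeasurableSet.singleton (1 : Fin 2))
    exact (this.comp measurable_prodMk_right).aemeasurable
  · exact Filter.Eventually.of_forall fun y => measure_lt_top _ _

end Slices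

/-! ### Real and extended quantile functions -/

section Quantiles

/-- The real quantile function of `ν` on `(0, 1)`, extended by `0`. -/
def rq (ν : Measure ℝ) (u : ℝ) : ℝ := by
  classical exact if u ∈ Ioo (0 : ℝ) 1 then sInf {y | u ≤ cdf ν y} else 0

variable {ν : Measure ℝ}

/-- The Galois connection between quantile and distribution function. Right continuity of `cdf`
makes the infimum attained. -/
theorem rq_le_iff {u : ℝ} (hu : u ∈ Ioo (0 : ℝ) 1) (y : ℝ) : rq ν u ≤ y ↔ u ≤ cdf ν y := by
  have hne : {y | u ≤ cdf ν y}.Nonempty := by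
    obtain ⟨y, hy⟩ := ((tendsto_cdf_atTop ν).eventually_const_lt hu.2).exists
    exact ⟨y, hy.le⟩
  obtain ⟨b, hb⟩ := ((tendsto_cdf_atBot ν).eventually_lt_const hu.1).exists
  have hbdd : BddBelow {y | u ≤ cdf ν y} := by
    refine ⟨b, fun y hy => ?_⟩
    by_contra hlt
    exact absurd ((monotone_cdf ν) (not_le.1 hlt).le) (not_le.2 (hb.trans_le hy))
  rw [rq, if_pos hu]
  constructor
  · intro h
    have hr : Filter.Tendsto (cdf ν) (nhdsWithin y (Ioi y)) (nhds (cdf ν y)) :=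
      ((cdf ν).right_continuous y).mono_left (nhdsWithin_mono _ Ioi_subset_Ici_self)
    refine ge_of_tendsto hr ?_
    filter_upwards [self_mem_nhdsWithin] with z hz
    obtain ⟨t, ht, htz⟩ := (csInf_lt_iff hbdd hne).1 (lt_of_le_of_lt h hz)
    exact le_trans ht ((monotone_cdf ν) htz.le)
  · exact fun h => csInf_le hbdd h

theorem le_cdf_rq {u : ℝ} (hu : u ∈ Ioo (0 : ℝ) 1) : u ≤ cdf ν (rq ν u) :=
  (rq_le_iff hu _).1 le_rfl

theorem measurable_rq {Ω : Type*} [MeasurableSpace Ω] (κ : Kernel Ω ℝ) [IsMarkovKernel κ] :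
    Measurable fun z : Ω × ℝ => rq (κ z.1) z.2 := by
  refine measurable_of_Iic fun y => ?_
  have hset : (fun z : Ω × ℝ => rq (κ z.1) z.2) ⁻¹' Iic y =
      ({z | z.2 ∈ Ioo (0 : ℝ) 1} ∩ {z | z.2 ≤ (κ z.1).real (Iic y)}) ∪
        ({z | z.2 ∈ Ioo (0 : ℝ) 1}ᶜ ∩ {_z | 0 ≤ y}) := by
    ext z
    simp only [mem_preimage, mem_Iic, mem_union, mem_inter_iff, mem_ofPred_eq, mem_compl_iff]
    by_cases hz : z.2 ∈ Ioo (0 : ℝ) 1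
    · rw [rq_le_iff hz, cdf_eq_real]
      simp [hz]
    · rw [rq, if_neg hz]
      simp [hz]
  rw [hset]
  have h1 : MeasurableSet {z : Ω × ℝ | z.2 ∈ Ioo (0 : ℝ) 1} := measurable_snd measurableSet_Ioo
  have h2 : Measurable fun z : Ω × ℝ => (κ z.1).real (Iic y) :=
    ((Kernel.measurable_coe κ measurableSet_Iic).comp measurable_fst).ennreal_toReal
  exact (h1.inter (measurableSet_le measurable_snd h2)).union
    (h1.compl.inter (MeasurableSet.const _))

theorem measurable_rq_right [IsProbabilityMeasure ν] : Measurable (rq ν) :=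
  (measurable_rq (Kernel.const Unit ν)).comp (measurable_prodMk_left (x := ()))

/-- The uniform distribution on `(0, 1)`. -/
abbrev unif : Measure ℝ := volume.restrict (Ioo (0 : ℝ) 1)

instance : IsProbabilityMeasure unif := ⟨by simp [unif]⟩

theorem unif_Iic {t : ℝ} (h1 : t ≤ 1) : unif (Iic t) = ENNReal.ofReal t := by
  rw [Measure.restrict_apply measurableSet_Iic]
  refine le_antisymm ?_ ?_
  · have hsub : Iic t ∩ Ioo 0 1 ⊆ Ioc 0 t := fun x hx => ⟨hx.2.1, hx.1⟩
    simpa using measure_mono (μ := volume) hsub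
  · have hsub : Ioo 0 t ⊆ Iic t ∩ Ioo 0 1 := fun x hx => ⟨hx.2.le, hx.1, hx.2.trans_le h1⟩
    simpa using measure_mono (μ := volume) hsub

theorem ae_unif_mem : ∀ᵐ τ ∂unif, τ ∈ Ioo (0 : ℝ) 1 := ae_restrict_mem measurableSet_Ioo

/-- The quantile transform of the uniform distribution. -/
theorem map_rq [IsProbabilityMeasure ν] : unif.map (rq ν) = ν := by
  have : IsProbabilityMeasure (unif.map (rq ν)) :=
    Measure.isProbabilityMeasure_map measurable_rq_right.aemeasurable
  refine Measure.ext_of_Iic _ _ fun y => ?_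
  rw [Measure.map_apply measurable_rq_right measurableSet_Iic, ← ofReal_cdf ν y,
    ← unif_Iic (cdf_le_one ν y)]
  refine measure_congr ?_
  filter_upwards [ae_unif_mem] with τ hτ
  exact propext (rq_le_iff hτ y)

/-- A gap in the mass around the quantile would make `cdf` constant just to its left, so a smaller
point would already reach the level `u`. -/
theorem rq_mem_support [IsProbabilityMeasure ν] {u : ℝ} (hu : u ∈ Ioo (0 : ℝ) 1) :
    rq ν u ∈ ν.support := by
  by_contra h
  obtain ⟨U, hU, hU0⟩ := Measure.notMem_support_iff_exists.1 h
  obtain ⟨a, b, hab, hsub⟩ := mem_nhds_iff_exists_Ioo_subset.1 hU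
  set y := (a + rq ν u) / 2
  have hy1 : a < y := by simp only [y]; linarith [hab.1]
  have hy2 : y < rq ν u := by simp only [y]; linarith [hab.1]
  have h0 : ν (Ioc y (rq ν u)) = 0 :=
    measure_mono_null (fun z hz => hsub ⟨hy1.trans hz.1, hz.2.trans_lt hab.2⟩) hU0
  have hc : cdf ν (rq ν u) ≤ cdf ν y := by
    have h1 := (cdf ν).measure_Ioc y (rq ν u)
    rw [measure_cdf, h0] at h1
    have := ENNReal.ofReal_eq_zero.1 h1.symm
    linarith
  exact absurd ((rq_le_iff hu y).2 ((le_cdf_rq hu).trans hc)) (not_le.2 hy2)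

theorem quantile_eq_rq [IsProbabilityMeasure ν] {u : ℝ} (hu : u ∈ Ioo (0 : ℝ) 1) :
    quantile ν u = rq ν u := by
  refine le_antisymm (sInf_le ⟨_, ⟨rq_mem_support hu, le_cdf_rq hu⟩, rfl⟩) (le_sInf ?_)
  rintro _ ⟨y, ⟨-, hy⟩, rfl⟩
  exact EReal.coe_le_coe_iff.2 ((rq_le_iff hu y).2 hy)

theorem quantile_mono : Monotone (quantile ν) := fun _ _ h =>
  sInf_le_sInf (image_mono fun _ hy => ⟨hy.1, h.trans hy.2⟩)

theorem measure_Ioi_eq_zero [IsProbabilityMeasure ν] {y : ℝ} (h : 1 ≤ cdf ν y) :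
    ν (Ioi y) = 0 := by
  have h1 : ν.real (Iic y) = 1 := by
    rw [← cdf_eq_real]; exact le_antisymm (cdf_le_one ν y) h
  rw [← compl_Iic]
  rw [prob_compl_eq_zero_iff measurableSet_Iic]
  rw [measureReal_def] at h1
  rwa [ENNReal.toReal_eq_one_iff] at h1

/-- Left continuity of the quantile function. -/
theorem exists_lt_quantile [IsProbabilityMeasure ν] {u x : ℝ} (hu0 : 0 < u) (hu1 : u ≤ 1)
    (hx : (x : EReal) < quantile ν u) : ∃ v ∈ Ioo 0 u, (x : EReal) < quantile ν v := by
  -- Otherwise the largest support point `b ≤ x` has the same distribution function value as `x`,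
  -- since no mass lies in `(b, x]`; then the quantile at `u` is at most `b ≤ x`.
  have hlt : cdf ν x < u := by
    by_contra hge
    rw [not_lt] at hge
    have hpos : 0 < ν (Iic x) := by
      rw [← ofReal_cdf, ENNReal.ofReal_pos]; linarith
    obtain ⟨z, hzx, hzs⟩ := Measure.nonempty_inter_support_of_pos hpos
    have hclosed : IsClosed (Iic x ∩ ν.support) := isClosed_Iic.inter Measure.isClosed_support
    have hbdd : BddAbove (Iic x ∩ ν.support) := ⟨x, fun _ h => h.1⟩
    have hb := hclosed.csSup_mem ⟨z, hzx, hzs⟩ hbdd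
    set b := sSup (Iic x ∩ ν.support)
    have h0 : ν (Ioc b x) = 0 := by
      have hsub : Ioc b x ⊆ ν.supportᶜ := fun t ht hts =>
        absurd (le_csSup hbdd ⟨ht.2, hts⟩) (not_le.2 ht.1)
      exact measure_mono_null hsub Measure.measure_compl_support
    have hc : cdf ν x ≤ cdf ν b := by
      have h1 := (cdf ν).measure_Ioc b x
      rw [measure_cdf, h0] at h1
      have := ENNReal.ofReal_eq_zero.1 h1.symm
      linarith
    have h2 : quantile ν u ≤ b := sInf_le ⟨b, ⟨hb.2, hge.trans hc⟩, rfl⟩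
    exact absurd (hx.trans_le h2) (not_lt.2 (EReal.coe_le_coe_iff.2 hb.1))
  have hnn := cdf_nonneg ν x
  have hv : (cdf ν x + u) / 2 ∈ Ioo (0 : ℝ) 1 := ⟨by linarith, by linarith⟩
  refine ⟨(cdf ν x + u) / 2, ⟨hv.1, by linarith⟩, ?_⟩
  rw [quantile_eq_rq hv, EReal.coe_lt_coe_iff, ← not_le, rq_le_iff hv]
  linarith

/-- Right continuity of the quantile function, when the support is an interval. -/
theorem exists_quantile_lt [IsProbabilityMeasure ν] {u x : ℝ} (hu0 : 0 ≤ u) (hu1 : u < 1)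
    (hsupp : ν.support.OrdConnected) (hmono : StrictMonoOn (cdf ν) ν.support)
    (hx : quantile ν u < (x : EReal)) : ∃ v ∈ Ioo u 1, quantile ν v < (x : EReal) := by
  obtain ⟨_, ⟨y, ⟨hys, hyu⟩, rfl⟩, hyx⟩ := sInf_lt_iff.1 hx
  have hyx' : y < x := EReal.coe_lt_coe_iff.1 hyx
  have hy1 : y < (y + x) / 2 := by linarith
  -- If the midpoint still had level at most `u < 1`, mass would lie beyond it, so it would belong
  -- to the interval support, where `cdf` strictly exceeds its value at `y`, which is at least `u`.
  have hlt : u < cdf ν ((y + x) / 2) := by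
    by_contra hge
    rw [not_lt] at hge
    have hpos : 0 < ν (Ioi ((y + x) / 2)) := by
      rw [← compl_Iic, prob_compl_eq_one_sub measurableSet_Iic, ← ofReal_cdf, tsub_pos_iff_lt,
        ENNReal.ofReal_lt_one]
      linarith
    obtain ⟨z, hz, hzs⟩ := Measure.nonempty_inter_support_of_pos hpos
    have hmem : (y + x) / 2 ∈ ν.support := hsupp.out hys hzs ⟨hy1.le, (mem_Ioi.1 hz).le⟩
    linarith [hmono hys hmem hy1]
  have hle := cdf_le_one ν ((y + x) / 2)
  have hv : (u + cdf ν ((y + x) / 2)) / 2 ∈ Ioo (0 : ℝ) 1 := ⟨by linarith, by linarith⟩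
  refine ⟨_, ⟨by linarith, hv.2⟩, ?_⟩
  rw [quantile_eq_rq hv, EReal.coe_lt_coe_iff]
  refine ((rq_le_iff hv ((y + x) / 2)).2 (by linarith)).trans_lt (by linarith)

end Quantiles

/-! ### The extremal rank maps -/

section Ranks

variable {c p τ : ℝ}

/-- Reflection of the unit interval exchanges the two bounds, so facts about `lowerRank` are read
off from `upperRank`. -/
theorem lowerRank_eq (c p τ : ℝ) : lowerRank c p τ = 1 - upperRank c p (1 - τ) := by
  unfold lowerRank upperRank
  rw [sub_sub_cancel, min_comm (1 - τ) τ, sub_eq_add_neg 1 (min _ _), ← max_neg_neg, ← max_neg_neg,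
    ← max_add_add_left, ← max_add_add_left]
  congr 1
  · congr 1 <;> ring
  · ring

/-- After multiplication by `p` the rank is the minimum of two lines: one through the origin with
the largest permitted density as slope, the other through `(1, p)` with the smallest. All uses of
`upperRank` as a density constraint go through this form. -/
theorem mul_upperRank (hp : 0 < p) (hτ0 : 0 ≤ τ) (hτ1 : τ ≤ 1) (hc : 0 ≤ c) :
    p * upperRank c p τ = min (min (p + c) 1 * τ) (p - max (p - c) 0 * (1 - τ)) := by
  have h1 : min (p + c) 1 * τ = min (p * τ + c * τ) τ := by
    rw [min_mul_of_nonneg _ _ hτ0, add_mul, one_mul]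
  have h2 : p - max (p - c) 0 * (1 - τ) = min (p * τ + c * (1 - τ)) p := by
    rw [max_mul_of_nonneg _ _ (by linarith), sub_eq_add_neg, ← min_neg_neg, ← min_add_add_left]
    congr 1 <;> ring
  have h3 : p * upperRank c p τ =
      min (min (min (p * τ + c * τ) (p * τ + c * (1 - τ))) τ) p := by
    unfold upperRank
    rw [mul_min_of_nonneg _ _ hp.le, mul_min_of_nonneg _ _ hp.le, mul_add, ← mul_assoc,
      mul_div_cancel₀ _ hp.ne', mul_div_cancel₀ _ hp.ne', mul_one, mul_min_of_nonneg _ _ hc,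
      min_add_add_left]
  rw [h1, h2, h3]
  simp only [min_assoc, min_comm, min_left_comm]

end Ranks

/-! ### Strictly increasing perturbations of the rank maps -/

section Ranks

variable {c p ε τ : ℝ}

/-- The map `(1 - ε) upperRank + ε id`, extended to an increasing function on the line. -/
def mixUpperRank (c p ε τ : ℝ) : ℝ :=
  (1 - ε) * (min (min (p + c) 1 * τ) (p - max (p - c) 0 * (1 - τ)) / p) + ε * τ

/-- The map `(1 - ε) lowerRank + ε id`, extended to an increasing function on the line. -/
def mixLowerRank (c p ε τ : ℝ) : ℝ := 1 - mixUpperRank c p ε (1 - τ)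

theorem mixUpperRank_eq (hp : 0 < p) (hτ0 : 0 ≤ τ) (hτ1 : τ ≤ 1) (hc : 0 ≤ c) :
    mixUpperRank c p ε τ = (1 - ε) * upperRank c p τ + ε * τ := by
  rw [mixUpperRank, ← mul_upperRank hp hτ0 hτ1 hc, mul_div_cancel_left₀ _ hp.ne']

theorem mixLowerRank_eq (hp : 0 < p) (hτ0 : 0 ≤ τ) (hτ1 : τ ≤ 1) (hc : 0 ≤ c) :
    mixLowerRank c p ε τ = (1 - ε) * lowerRank c p τ + ε * τ := by
  rw [mixLowerRank, mixUpperRank_eq hp (by linarith) (by linarith) hc, lowerRank_eq]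
  ring

theorem measurable_mixUpperRank :
    Measurable fun z : ℝ × ℝ × ℝ => mixUpperRank c z.1 z.2.1 z.2.2 := by
  unfold mixUpperRank; fun_prop

theorem measurable_mixLowerRank :
    Measurable fun z : ℝ × ℝ × ℝ => mixLowerRank c z.1 z.2.1 z.2.2 :=
  (measurable_mixUpperRank.comp (f := fun z : ℝ × ℝ × ℝ => (z.1, z.2.1, 1 - z.2.2))
    (by fun_prop)).const_sub 1

/-- An increasing rank transformation with `R 0 = 0`, `R 1 = 1` and slopes of `p R` between
`a` and `b`. -/
structure IsRank (p a b : ℝ) (R : ℝ → ℝ) : Prop where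
  zero : R 0 = 0
  one : R 1 = 1
  le_sub : ∀ x y, x ≤ y → a * (y - x) ≤ p * (R y - R x)
  sub_le : ∀ x y, x ≤ y → p * (R y - R x) ≤ b * (y - x)

/-- A minimum of lines of slopes `r ≤ s` has all its difference quotients in `[r, s]`; mixing with
the identity moves both slope bounds towards `p`. -/
theorem isRank_mixUpperRank (hp0 : 0 < p) (hp1 : p ≤ 1) (hc : 0 ≤ c)
    (hε1 : ε ≤ 1) :
    IsRank p ((1 - ε) * max (p - c) 0 + ε * p) ((1 - ε) * min (p + c) 1 + ε * p)
      (mixUpperRank c p ε) := by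
  have hs : p ≤ min (p + c) 1 := le_min (by linarith) hp1
  have hr : max (p - c) 0 ≤ p := max_le (by linarith) hp0.le
  have hr0 : 0 ≤ max (p - c) 0 := le_max_right _ _
  have key : ∀ x y, p * (mixUpperRank c p ε y - mixUpperRank c p ε x) = (1 - ε) *
      (min (min (p + c) 1 * y) (p - max (p - c) 0 * (1 - y)) -
        min (min (p + c) 1 * x) (p - max (p - c) 0 * (1 - x))) + ε * p * (y - x) := by
    intro x y
    unfold mixUpperRank
    field_simp
    ring
  generalize min (p + c) 1 = s at *
  generalize max (p - c) 0 = r at *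
  have h1 : ∀ x y, x ≤ y → r * (y - x) ≤
      min (s * y) (p - r * (1 - y)) - min (s * x) (p - r * (1 - x)) := by
    intro x y hxy
    rw [le_sub_iff_add_le]
    refine le_min ?_ ?_
    · nlinarith [min_le_left (s * x) (p - r * (1 - x))]
    · nlinarith [min_le_right (s * x) (p - r * (1 - x))]
  have h2 : ∀ x y, x ≤ y →
      min (s * y) (p - r * (1 - y)) - min (s * x) (p - r * (1 - x)) ≤ s * (y - x) := by
    intro x y hxy
    rw [sub_le_iff_le_add, ← min_add_add_left]
    refine le_min ?_ ?_
    · nlinarith [min_le_left (s * y) (p - r * (1 - y))]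
    · nlinarith [min_le_right (s * y) (p - r * (1 - y))]
  refine ⟨?_, ?_, fun x y hxy => ?_, fun x y hxy => ?_⟩
  · have : ∀ s r : ℝ, r ≤ p → min (s * 0) (p - r * (1 - 0)) = 0 := by
      intro s r h; rw [mul_zero]; exact min_eq_left (by linarith)
    rw [mixUpperRank, this _ _ (max_le (by linarith) hp0.le)]
    ring
  · have : ∀ s r : ℝ, p ≤ s → min (s * 1) (p - r * (1 - 1)) = p := by
      intro s r h; rw [sub_self, mul_zero, sub_zero, mul_one]; exact min_eq_right h
    rw [mixUpperRank, this _ _ (le_min (by linarith) hp1), div_self hp0.ne']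
    ring
  · rw [key]; nlinarith [h1 x y hxy]
  · rw [key]; nlinarith [h2 x y hxy]

theorem IsRank.reflect {a b : ℝ} {R : ℝ → ℝ} (h : IsRank p a b R) :
    IsRank p a b (fun x => 1 - R (1 - x)) := by
  refine ⟨?_, ?_, fun x y hxy => ?_, fun x y hxy => ?_⟩
  · simp [h.one]
  · simp [h.zero]
  · have := h.le_sub (1 - y) (1 - x) (by linarith)
    linarith
  · have := h.sub_le (1 - y) (1 - x) (by linarith)
    linarith

theorem upperRank_mem (hp0 : 0 < p) (hp1 : p ≤ 1) (hc : 0 ≤ c) (hτ : τ ∈ Ioo (0 : ℝ) 1) :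
    τ ≤ upperRank c p τ ∧ 0 < upperRank c p τ ∧ upperRank c p τ ≤ 1 := by
  have h1 : upperRank c p τ ≤ 1 := min_le_right _ _
  have h2 : τ ≤ upperRank c p τ := by
    refine le_min (le_min ?_ ?_) hτ.2.le
    · have : 0 ≤ c / p * min τ (1 - τ) :=
        mul_nonneg (div_nonneg hc hp0.le) (le_min hτ.1.le (by linarith [hτ.2]))
      linarith
    · rw [le_div_iff₀ hp0]; nlinarith [hτ.1]
  exact ⟨h2, hτ.1.trans_le h2, h1⟩

theorem lowerRank_mem (hp0 : 0 < p) (hp1 : p ≤ 1) (hc : 0 ≤ c) (hτ : τ ∈ Ioo (0 : ℝ) 1) :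
    lowerRank c p τ ≤ τ ∧ 0 ≤ lowerRank c p τ ∧ lowerRank c p τ < 1 := by
  have := upperRank_mem hp0 hp1 hc (τ := 1 - τ) ⟨by linarith [hτ.2], by linarith [hτ.1]⟩
  rw [lowerRank_eq]
  exact ⟨by linarith, by linarith, by linarith⟩

namespace IsRank

variable {a b : ℝ} {R : ℝ → ℝ}

theorem strictMono (h : IsRank p a b R) (hp : 0 < p) (ha : 0 < a) : StrictMono R := by
  intro x y hxy
  have h1 := h.le_sub x y hxy.le
  have h2 : 0 < a * (y - x) := mul_pos ha (by linarith)
  have h3 : 0 < p * (R y - R x) := h2.trans_le h1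
  linarith [(mul_pos_iff_of_pos_left hp).1 h3]

theorem mem_Ioo_iff (h : IsRank p a b R) (hp : 0 < p) (ha : 0 < a) (x : ℝ) :
    R x ∈ Ioo (0 : ℝ) 1 ↔ x ∈ Ioo (0 : ℝ) 1 := by
  have hm := h.strictMono hp ha
  have h0 := hm.lt_iff_lt (a := 0) (b := x)
  have h1 := hm.lt_iff_lt (a := x) (b := 1)
  rw [h.zero] at h0
  rw [h.one] at h1
  simp only [mem_Ioo, h0, h1]

theorem lipschitzWith (h : IsRank p a b R) (hp : 0 < p) (ha : 0 < a) :
    LipschitzWith (b / p).toNNReal R := by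
  have hb : 0 < b := by
    have h1 := (h.le_sub 0 1 zero_le_one).trans (h.sub_le 0 1 zero_le_one)
    linarith
  refine LipschitzWith.of_le_add_mul _ fun x y => ?_
  rw [Real.coe_toNNReal _ (div_nonneg hb.le hp.le), Real.dist_eq]
  rcases le_total x y with hxy | hxy
  · have := (h.strictMono hp ha).monotone hxy
    have : 0 ≤ b / p * |x - y| := mul_nonneg (div_nonneg hb.le hp.le) (abs_nonneg _)
    linarith
  · rw [abs_of_nonneg (by linarith)]
    have h1 := h.sub_le y x hxy
    have h2 : R x - R y ≤ b / p * (x - y) := by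
      rw [div_mul_eq_mul_div, le_div_iff₀ hp]; linarith
    linarith

theorem antilipschitzWith (h : IsRank p a b R) (hp : 0 < p) (ha : 0 < a) :
    AntilipschitzWith (p / a).toNNReal R := by
  refine AntilipschitzWith.of_le_mul_dist fun x y => ?_
  rw [Real.coe_toNNReal _ (div_nonneg hp.le ha.le)]
  have key : ∀ x y, x ≤ y → dist x y ≤ p / a * dist (R x) (R y) := by
    intro x y hxy
    have hR := (h.strictMono hp ha).monotone hxy
    rw [dist_comm, dist_comm (R x), Real.dist_eq, Real.dist_eq, abs_of_nonneg (by linarith),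
      abs_of_nonneg (by linarith), div_mul_eq_mul_div, le_div_iff₀ ha]
    linarith [h.le_sub x y hxy]
  rcases le_total x y with hxy | hxy
  · exact key x y hxy
  · rw [dist_comm, dist_comm (R x)]; exact key y x hxy

theorem surjective (h : IsRank p a b R) (hp : 0 < p) (ha : 0 < a) : Function.Surjective R := by
  have hlow : ∀ x, 0 ≤ x → a / p * x ≤ R x := by
    intro x hx
    have := h.le_sub 0 x hx
    rw [h.zero] at this
    rw [div_mul_eq_mul_div, div_le_iff₀ hp]; linarith
  have hup : ∀ x, x ≤ 0 → R x ≤ a / p * x := by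
    intro x hx
    have := h.le_sub x 0 hx
    rw [h.zero] at this
    rw [div_mul_eq_mul_div, le_div_iff₀ hp]; linarith
  refine (h.lipschitzWith hp ha).continuous.surjective ?_ ?_
  · refine Filter.tendsto_atTop_mono' _ ?_
      (Filter.tendsto_id.const_mul_atTop (div_pos ha hp))
    filter_upwards [Filter.eventually_ge_atTop 0] with x hx using hlow x hx
  · refine Filter.tendsto_atBot_mono' _ ?_
      (Filter.tendsto_id.const_mul_atBot (div_pos ha hp))
    filter_upwards [Filter.eventually_le_atBot 0] with x hx using hup x hx

theorem measurable (h : IsRank p a b R) (hp : 0 < p) (ha : 0 < a) : Measurable R :=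
  (h.lipschitzWith hp ha).continuous.measurable

/-- Lebesgue measure is one-dimensional Hausdorff measure, so a `b / p`-Lipschitz map enlarges it at
most by that factor. `map_le` is the same with the antilipschitz constant. -/
theorem unif_le (h : IsRank p a b R) (hp : 0 < p) (ha : 0 < a) {A : Set ℝ}
    (hA : MeasurableSet A) :
    unif A ≤ ENNReal.ofReal (b / p) * unif.map R A := by
  -- `R` is onto the line and preserves membership in `(0, 1)` both ways, which is why it is defined
  -- on the whole line.
  have hset : A ∩ Ioo 0 1 = R '' (R ⁻¹' A ∩ Ioo 0 1) := by
    have : R ⁻¹' A ∩ Ioo 0 1 = R ⁻¹' (A ∩ Ioo 0 1) := by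
      ext x
      exact and_congr_right fun _ => (h.mem_Ioo_iff hp ha x).symm
    rw [this, image_preimage_eq _ (h.surjective hp ha)]
  rw [Measure.map_apply (h.measurable hp ha) hA, Measure.restrict_apply hA,
    Measure.restrict_apply (h.measurable hp ha hA), hset]
  have := (h.lipschitzWith hp ha).hausdorffMeasure_image_le zero_le_one (R ⁻¹' A ∩ Ioo 0 1)
  simpa [hausdorffMeasure_real, ENNReal.ofReal] using this

theorem map_le (h : IsRank p a b R) (hp : 0 < p) (ha : 0 < a) {A : Set ℝ}
    (hA : MeasurableSet A) :
    unif.map R A ≤ ENNReal.ofReal (p / a) * unif A := by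
  have hset : A ∩ Ioo 0 1 = R '' (R ⁻¹' A ∩ Ioo 0 1) := by
    have : R ⁻¹' A ∩ Ioo 0 1 = R ⁻¹' (A ∩ Ioo 0 1) := by
      ext x
      exact and_congr_right fun _ => (h.mem_Ioo_iff hp ha x).symm
    rw [this, image_preimage_eq _ (h.surjective hp ha)]
  rw [Measure.map_apply (h.measurable hp ha) hA, Measure.restrict_apply hA,
    Measure.restrict_apply (h.measurable hp ha hA), hset]
  have := (h.antilipschitzWith hp ha).le_hausdorffMeasure_image zero_le_one (R ⁻¹' A ∩ Ioo 0 1)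
  simpa [hausdorffMeasure_real, ENNReal.ofReal] using this

end IsRank

end Ranks

/-! ### Laws obtained from a rank map -/

section Transform

variable {p a b : ℝ} {R : ℝ → ℝ} {F : Measure ℝ} [IsProbabilityMeasure F]

/-- The law of the quantile function of `F` at the rank `R U`, with `U` uniform. -/
def rankLaw (F : Measure ℝ) (R : ℝ → ℝ) : Measure ℝ := unif.map fun τ => rq F (R τ)

theorem rankLaw_eq (hR : Measurable R) : rankLaw F R = (unif.map R).map (rq F) := by
  rw [Measure.map_map measurable_rq_right hR]; rfl

theorem isProbabilityMeasure_rankLaw (hR : Measurable R) : IsProbabilityMeasure (rankLaw F R) :=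
  Measure.isProbabilityMeasure_map (measurable_rq_right.comp hR).aemeasurable

/-- Both `F` and `rankLaw F R` are images under the same quantile function, of the uniform law and
of its image by `R`; a comparison of those two laws on preimages passes to the images. -/
theorem IsRank.measure_le (h : IsRank p a b R) (hp : 0 < p) (ha : 0 < a) {A : Set ℝ}
    (hA : MeasurableSet A) : p * F.real A ≤ b * (rankLaw F R).real A := by
  have hR := h.measurable hp ha
  have := isProbabilityMeasure_rankLaw (F := F) hR
  have hb : 0 < b := by
    have h1 := (h.le_sub 0 1 zero_le_one).trans (h.sub_le 0 1 zero_le_one)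
    linarith
  have h1 := h.unif_le hp ha (measurable_rq_right (ν := F) hA)
  rw [← Measure.map_apply measurable_rq_right hA, ← Measure.map_apply measurable_rq_right hA,
    map_rq, ← rankLaw_eq hR] at h1
  have h2 := ENNReal.toReal_mono (by finiteness) h1
  rw [ENNReal.toReal_mul, ENNReal.toReal_ofReal (by positivity)] at h2
  change F.real A ≤ b / p * (rankLaw F R).real A at h2
  rw [div_mul_eq_mul_div, le_div_iff₀ hp] at h2
  linarith

theorem IsRank.le_measure (h : IsRank p a b R) (hp : 0 < p) (ha : 0 < a) {A : Set ℝ}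
    (hA : MeasurableSet A) : a * (rankLaw F R).real A ≤ p * F.real A := by
  have hR := h.measurable hp ha
  have := isProbabilityMeasure_rankLaw (F := F) hR
  have h1 := h.map_le hp ha (measurable_rq_right (ν := F) hA)
  rw [← Measure.map_apply measurable_rq_right hA, ← Measure.map_apply measurable_rq_right hA,
    map_rq, ← rankLaw_eq hR] at h1
  have h2 := ENNReal.toReal_mono (by finiteness) h1
  rw [ENNReal.toReal_mul, ENNReal.toReal_ofReal (by positivity)] at h2
  change (rankLaw F R).real A ≤ p / a * F.real A at h2
  rw [div_mul_eq_mul_div, le_div_iff₀ ha] at h2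
  linarith

end Transform

/-! ### Extended means -/

section Means

variable {α β : Type*} [MeasurableSpace α] [MeasurableSpace β] {μ : Measure α}

/-- Existence of the means is not needed: the two integrals move in opposite directions, and
subtraction in `EReal` is monotone with `⊤ - ⊤ = ⊥`. -/
theorem mean_mono {f g : α → EReal} (h : ∀ᵐ a ∂μ, f a ≤ g a) : mean μ f ≤ mean μ g := by
  refine EReal.sub_le_sub ?_ ?_
  · refine EReal.coe_ennreal_le_coe_ennreal_iff.2 (lintegral_mono_ae ?_)
    filter_upwards [h] with a ha using EReal.toENNReal_le_toENNReal ha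
  · refine EReal.coe_ennreal_le_coe_ennreal_iff.2 (lintegral_mono_ae ?_)
    filter_upwards [h] with a ha
    exact EReal.toENNReal_le_toENNReal (EReal.neg_le_neg_iff.2 ha)

theorem mean_congr {f g : α → EReal} (h : ∀ᵐ a ∂μ, f a = g a) : mean μ f = mean μ g :=
  le_antisymm (mean_mono (h.mono fun _ h => h.le)) (mean_mono (h.mono fun _ h => h.ge))

theorem toENNReal_neg_coe (x : ℝ) : (-(x : EReal)).toENNReal = ENNReal.ofReal (-x) := rfl

theorem mean_map {g : α → β} (hg : Measurable g) {f : β → EReal} (hf : Measurable f) :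
    mean (μ.map g) f = mean μ fun a => f (g a) := by
  unfold mean
  rw [lintegral_map hf.ereal_toENNReal hg]
  congr 2
  exact lintegral_map hf.neg.ereal_toENNReal hg

theorem lintegral_ofReal_ne_top {f : α → ℝ} (hf : Integrable f μ) :
    ∫⁻ a, ENNReal.ofReal (f a) ∂μ ≠ ⊤ := by
  refine ne_top_of_le_ne_top hf.hasFiniteIntegral.ne (lintegral_mono fun a => ?_)
  rw [← ofReal_norm]
  exact ENNReal.ofReal_le_ofReal (le_abs_self _)

theorem mean_coe {f : α → ℝ} (hf : Integrable f μ) :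
    mean μ (fun a => (f a : EReal)) = ((∫ a, f a ∂μ : ℝ) : EReal) := by
  have h1 := lintegral_ofReal_ne_top hf
  have h2 : ∫⁻ a, ENNReal.ofReal (-f a) ∂μ ≠ ⊤ := lintegral_ofReal_ne_top hf.neg
  rw [integral_eq_lintegral_pos_part_sub_lintegral_neg_part hf, EReal.coe_sub,
    EReal.coe_ennreal_toReal h1, EReal.coe_ennreal_toReal h2]
  rfl

theorem hasMean_coe {f : α → ℝ} (hf : Integrable f μ) : HasMean μ fun a => (f a : EReal) :=
  ⟨hf.aemeasurable.coe_real_ereal, Or.inl (lintegral_ofReal_ne_top hf)⟩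

theorem mean_neg {f : α → EReal} (h : (∫⁻ a, (f a).toENNReal ∂μ) ≠ ⊤ ∨
    (∫⁻ a, (-f a).toENNReal ∂μ) ≠ ⊤) : mean μ (fun a => -f a) = -mean μ f := by
  unfold mean
  rw [EReal.neg_sub]
  · simp only [neg_neg]
    rw [add_comm, sub_eq_add_neg]
  · exact Or.inl (EReal.coe_ennreal_ne_bot _)
  · rcases h with h | h
    · exact Or.inl (by simpa using h)
    · exact Or.inr (by simpa using h)

theorem HasMean.neg {f : α → EReal} (h : HasMean μ f) : HasMean μ fun a => -f a :=
  ⟨h.1.neg, by simpa only [neg_neg] using h.2.symm⟩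

/-- Monotone convergence for the positive parts and, from a finite start, for the decreasing
negative parts. Finiteness of the latter keeps the subtraction continuous at the limit. -/
theorem tendsto_mean_of_monotone {f : ℕ → α → EReal} {g : α → EReal}
    (hf : ∀ n, AEMeasurable (f n) μ) (hmono : ∀ᵐ a ∂μ, Monotone fun n => f n a)
    (hlim : ∀ᵐ a ∂μ, Filter.Tendsto (fun n => f n a) Filter.atTop (nhds (g a)))
    (h0 : ∫⁻ a, (-f 0 a).toENNReal ∂μ ≠ ⊤) :
    Filter.Tendsto (fun n => mean μ (f n)) Filter.atTop (nhds (mean μ g)) := by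
  have h1 : Filter.Tendsto (fun n => ∫⁻ a, (f n a).toENNReal ∂μ) Filter.atTop
      (nhds (∫⁻ a, (g a).toENNReal ∂μ)) := by
    refine lintegral_tendsto_of_tendsto_of_monotone (fun n => (hf n).ereal_toENNReal) ?_ ?_
    · filter_upwards [hmono] with a ha n m hnm using EReal.toENNReal_le_toENNReal (ha hnm)
    · filter_upwards [hlim] with a ha
      exact (EReal.continuous_toENNReal.tendsto _).comp ha
  have h2 : Filter.Tendsto (fun n => ∫⁻ a, (-f n a).toENNReal ∂μ) Filter.atTop
      (nhds (∫⁻ a, (-g a).toENNReal ∂μ)) := by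
    refine lintegral_tendsto_of_tendsto_of_antitone (fun n => (hf n).neg.ereal_toENNReal) ?_ h0 ?_
    · filter_upwards [hmono] with a ha n m hnm
      exact EReal.toENNReal_le_toENNReal (EReal.neg_le_neg_iff.2 (ha hnm))
    · filter_upwards [hlim] with a ha
      exact ((EReal.continuous_toENNReal.comp continuous_neg).tendsto _).comp ha
  have h3 : ∫⁻ a, (-g a).toENNReal ∂μ ≠ ⊤ := by
    refine ne_top_of_le_ne_top h0 (lintegral_mono_ae ?_)
    filter_upwards [hmono, hlim] with a ha hl
    exact EReal.toENNReal_le_toENNReal (EReal.neg_le_neg_iff.2 (ha.ge_of_tendsto hl 0))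
  unfold mean
  simp_rw [sub_eq_add_neg]
  have h1' := (continuous_coe_ennreal_ereal.tendsto _).comp h1
  have h2' := ((continuous_neg.comp continuous_coe_ennreal_ereal).tendsto _).comp h2
  exact (EReal.continuousAt_add (p := (_, _)) (Or.inr (by simpa using h3))
    (Or.inl (EReal.coe_ennreal_ne_bot _))).tendsto.comp (h1'.prodMk_nhds h2')

end Means

/-! ### Quantile bounds from the density constraint -/

section Domination

variable {p c : ℝ} {F G : Measure ℝ}

/-- `p F ≤ G` and `|p G - p F| ≤ c G` on every measurable set. -/
def Dep (p c : ℝ) (F G : Measure ℝ) : Prop :=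
  ∀ A, MeasurableSet A → p * F.real A ≤ G.real A ∧ |p * G.real A - p * F.real A| ≤ c * G.real A

theorem Dep.le {A : Set ℝ} (h : Dep p c F G) (hA : MeasurableSet A) :
    p * F.real A ≤ min (p + c) 1 * G.real A := by
  obtain ⟨h1, h2⟩ := h A hA
  rw [abs_le] at h2
  rw [min_mul_of_nonneg _ _ measureReal_nonneg]
  exact le_min (by linarith) (by linarith)

theorem Dep.ge {A : Set ℝ} (h : Dep p c F G) (hp : 0 ≤ p) (hA : MeasurableSet A) :
    max (p - c) 0 * G.real A ≤ p * F.real A := by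
  obtain ⟨-, h2⟩ := h A hA
  rw [abs_le] at h2
  rw [max_mul_of_nonneg _ _ measureReal_nonneg]
  exact max_le (by linarith) (by rw [zero_mul]; exact mul_nonneg hp measureReal_nonneg)

variable [IsProbabilityMeasure F]

/-- The lower rank is at most `τ`, so the positive part is dominated by that of the quantile
function of `F`, whose law is `F`. -/
theorem lintegral_lower_ne_top (hp0 : 0 < p) (hp1 : p ≤ 1) (hc : 0 ≤ c)
    (hF : Integrable (fun y => y) F) :
    ∫⁻ τ, (quantile F (lowerRank c p τ)).toENNReal ∂unif ≠ ⊤ := by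
  have h1 := lintegral_ofReal_ne_top hF
  rw [← map_rq (ν := F), lintegral_map (by fun_prop) measurable_rq_right] at h1
  refine ne_top_of_le_ne_top h1 (lintegral_mono_ae ?_)
  filter_upwards [ae_unif_mem] with τ hτ
  rw [← EReal.real_coe_toENNReal, ← quantile_eq_rq hτ]
  exact EReal.toENNReal_le_toENNReal (quantile_mono (lowerRank_mem hp0 hp1 hc hτ).1)

variable [IsProbabilityMeasure G]

theorem real_Ioi (ν : Measure ℝ) [IsProbabilityMeasure ν] (y : ℝ) :
    ν.real (Ioi y) = 1 - cdf ν y := by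
  rw [← compl_Iic, probReal_compl_eq_one_sub measurableSet_Iic, cdf_eq_real]

/-- Suppose `F(y)` reaches the upper rank while `G(y) < τ`. The line of slope `s` is excluded by `p
F(y) ≤ s G(y) < s τ`. The other line forces `r = 0` and hence `F(y) = 1`, which is settled by the
equality of supports. -/
theorem rq_le_quantile_upperRank (hp0 : 0 < p) (hc : 0 ≤ c) (h : Dep p c F G)
    (hsupp : F.support = G.support) {τ : ℝ} (hτ : τ ∈ Ioo (0 : ℝ) 1) :
    (rq G τ : EReal) ≤ quantile F (upperRank c p τ) := by
  refine le_sInf ?_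
  rintro _ ⟨y, ⟨-, hy⟩, rfl⟩
  rw [EReal.coe_le_coe_iff, rq_le_iff hτ]
  by_contra hlt
  rw [not_le] at hlt
  have h1 := h.le (measurableSet_Iic (a := y))
  have h2 := h.ge hp0.le (measurableSet_Ioi (a := y))
  rw [← cdf_eq_real, ← cdf_eq_real] at h1
  rw [real_Ioi, real_Ioi] at h2
  have h3 := mul_le_mul_of_nonneg_left hy hp0.le
  rw [mul_upperRank hp0 hτ.1.le hτ.2.le hc] at h3
  have hs : 0 < min (p + c) 1 := lt_min (by linarith) one_pos
  have hr : 0 ≤ max (p - c) 0 := le_max_right _ _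
  have hF : 1 ≤ cdf F y := by
    rcases min_le_iff.1 h3 with h4 | h4
    · nlinarith
    · have h5 : max (p - c) 0 * (τ - cdf G y) ≤ 0 := by linarith
      have h6 : max (p - c) 0 = 0 := by
        rcases hr.eq_or_lt with h | h
        · exact h.symm
        · nlinarith
      rw [h6] at h4
      nlinarith
  -- `F` has no mass beyond `y`, so neither has `G`, whose support is the same. This contradicts
  -- `G(y) < τ < 1`.
  have hF0 := measure_Ioi_eq_zero hF
  have h7 := Measure.subset_compl_support_of_isOpen isOpen_Ioi hF0
  rw [hsupp] at h7
  have hG0 : G (Ioi y) = 0 := measure_mono_null h7 Measure.measure_compl_support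
  have h8 := real_Ioi G y
  rw [measureReal_def, hG0] at h8
  simp only [ENNReal.toReal_zero] at h8
  linarith [hτ.2]

/-- The quantile of `G` is itself a competitor in the infimum: it lies in the common support, and
the density bounds on the two half-lines at it show that `F` has reached the lower rank there. -/
theorem quantile_lowerRank_le_rq (hp0 : 0 < p) (hc : 0 ≤ c) (h : Dep p c F G)
    (hsupp : F.support = G.support) {τ : ℝ} (hτ : τ ∈ Ioo (0 : ℝ) 1) :
    quantile F (lowerRank c p τ) ≤ rq G τ := by
  refine sInf_le ⟨_, ⟨hsupp ▸ rq_mem_support hτ, ?_⟩, rfl⟩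
  have hG := le_cdf_rq (ν := G) hτ
  have h1 := h.ge hp0.le (measurableSet_Iic (a := rq G τ))
  have h2 := h.le (measurableSet_Ioi (a := rq G τ))
  rw [← cdf_eq_real, ← cdf_eq_real] at h1
  rw [real_Ioi, real_Ioi] at h2
  have h3 := mul_upperRank (c := c) (τ := 1 - τ) hp0 (by linarith [hτ.2]) (by linarith [hτ.1]) hc
  have hs : 0 < min (p + c) 1 := lt_min (by linarith) one_pos
  have hr : 0 ≤ max (p - c) 0 := le_max_right _ _
  rw [lowerRank_eq]
  have h4 : p * (1 - cdf F (rq G τ)) ≤ p * upperRank c p (1 - τ) := by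
    rw [h3, sub_sub_cancel]
    refine le_min ?_ ?_
    · nlinarith
    · nlinarith
  linarith [le_of_mul_le_mul_left h4 hp0]

theorem mean_le_upper (hp0 : 0 < p) (hc : 0 ≤ c) (h : Dep p c F G)
    (hsupp : F.support = G.support) :
    mean G (fun y => (y : EReal)) ≤ mean unif fun τ => quantile F (upperRank c p τ) := by
  rw [← map_rq (ν := G), mean_map measurable_rq_right measurable_coe_real_ereal]
  refine mean_mono ?_
  filter_upwards [ae_unif_mem] with τ hτ using rq_le_quantile_upperRank hp0 hc h hsupp hτ

theorem lower_le_mean (hp0 : 0 < p) (hc : 0 ≤ c) (h : Dep p c F G)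
    (hsupp : F.support = G.support) :
    mean unif (fun τ => quantile F (lowerRank c p τ)) ≤ mean G (fun y => (y : EReal)) := by
  rw [← map_rq (ν := G), mean_map measurable_rq_right measurable_coe_real_ereal]
  refine mean_mono ?_
  filter_upwards [ae_unif_mem] with τ hτ using quantile_lowerRank_le_rq hp0 hc h hsupp hτ

end Domination

/-! ### Integration over slices -/

section SliceIntegrals

variable {K : ℕ} (P : Measure (Latent K)) [IsFiniteMeasure P]

instance (D : Measure (Observed K)) [IsFiniteMeasure D] : IsFiniteMeasure (covLaw D) := by
  unfold covLaw; infer_instance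

theorem covLaw_compProd_slice :
    covLaw (observedLaw P) ⊗ₘ slice P = P.map fun o => (cov o, o) := by
  rw [covLaw_observedLaw]
  exact compProd_map_condDistrib (μ := P) (X := cov) (Y := id) aemeasurable_id

variable {P} {f : Latent K → ℝ}

theorem integrable_compProd_slice (hf : Integrable f P) :
    Integrable (fun z : (Fin K → ℝ) × Latent K => f z.2)
      (covLaw (observedLaw P) ⊗ₘ slice P) := by
  rw [covLaw_compProd_slice]
  have hm : AEMeasurable (fun o : Latent K => (cov o, o)) P := by fun_prop
  rw [integrable_map_measure _ hm]
  · exact hf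
  · refine AEStronglyMeasurable.comp_measurable (f := Prod.snd) ?_ measurable_snd
    rw [Measure.map_map measurable_snd (by fun_prop)]
    change AEStronglyMeasurable f (P.map id)
    rw [Measure.map_id]
    exact hf.1

theorem ae_integrable_slice (hf : Integrable f P) :
    ∀ᵐ w ∂covLaw (observedLaw P), Integrable f (slice P w) :=
  (integrable_compProd_slice hf).ae_of_compProd

theorem integrable_integral_slice (hf : Integrable f P) :
    Integrable (fun w => ∫ o, f o ∂slice P w) (covLaw (observedLaw P)) :=
  MeasureTheory.Integrable.integral_compProd (κ := Kernel.const Unit (covLaw (observedLaw P)))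
    (η := Kernel.prodMkLeft Unit (slice P)) (a := ()) (integrable_compProd_slice hf)

theorem integral_slice (hf : Integrable f P) :
    ∫ w, ∫ o, f o ∂slice P w ∂covLaw (observedLaw P) = ∫ o, f o ∂P := by
  rw [← Measure.integral_compProd (f := fun z : (Fin K → ℝ) × Latent K => f z.2)
    (integrable_compProd_slice hf), covLaw_compProd_slice, integral_map (by fun_prop)]
  have := (integrable_compProd_slice hf).1
  rwa [covLaw_compProd_slice] at this

theorem integrable_of_lintegral_ne_top {α : Type*} [MeasurableSpace α] {μ : Measure α}
    {g : α → ℝ} (hg : AEMeasurable g μ) (h1 : ∫⁻ a, ENNReal.ofReal (g a) ∂μ ≠ ⊤)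
    (h2 : ∫⁻ a, ENNReal.ofReal (-g a) ∂μ ≠ ⊤) : Integrable g μ := by
  refine ⟨hg.aestronglyMeasurable, ?_⟩
  have : ∀ a, ‖g a‖ₑ = ENNReal.ofReal (g a) + ENNReal.ofReal (-g a) := by
    intro a
    rw [← ofReal_norm, Real.norm_eq_abs]
    rcases le_total 0 (g a) with h | h
    · rw [abs_of_nonneg h, ENNReal.ofReal_of_nonpos (p := -g a) (by linarith), add_zero]
    · rw [abs_of_nonpos h, ENNReal.ofReal_of_nonpos h, zero_add]
  rw [HasFiniteIntegral]
  simp_rw [this]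
  rw [lintegral_add_left' (hg.ennreal_ofReal)]
  exact ENNReal.add_lt_top.2 ⟨h1.lt_top, h2.lt_top⟩

end SliceIntegrals

/-! ### From bounds given W to bounds on the treated mean -/

section AttBound

theorem lintegral_pos_le_of_mean_le {α : Type*} [MeasurableSpace α] {κ : Measure α} {A : α → ℝ}
    {u : EReal} (h : mean κ (fun a => (A a : EReal)) ≤ u)
    (hN : ∫⁻ a, ENNReal.ofReal (-A a) ∂κ ≠ ⊤) :
    ∫⁻ a, ENNReal.ofReal (A a) ∂κ ≤ u.toENNReal + ∫⁻ a, ENNReal.ofReal (-A a) ∂κ := by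
  have h1 : ((∫⁻ a, ENNReal.ofReal (A a) ∂κ : ENNReal) : EReal) -
      ((∫⁻ a, ENNReal.ofReal (-A a) ∂κ : ENNReal) : EReal) ≤ u := h
  rw [EReal.sub_le_iff_le_add (Or.inl (EReal.coe_ennreal_ne_bot _))
    (Or.inl (by simpa using hN))] at h1
  rw [← EReal.coe_ennreal_le_coe_ennreal_iff, EReal.coe_ennreal_add]
  refine h1.trans (add_le_add ?_ le_rfl)
  rw [EReal.coe_toENNReal_eq_max]
  exact le_max_right _ _

/-- If the mean of `A₀` is at most `u`, then the positive part of `A₁` on `S` is controlled by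
`u` and `A₁ - A₀`. -/
theorem lintegral_pos_le {α : Type*} [MeasurableSpace α] {κ : Measure α} {S : Set α}
    (hS : MeasurableSet S) {A₀ A₁ : α → ℝ} (h0 : Measurable A₀) (h1 : Measurable A₁) {u : EReal}
    (h : mean κ (fun a => (A₀ a : EReal)) ≤ u) :
    ∫⁻ a in S, ENNReal.ofReal (A₁ a) ∂κ ≤ (∫⁻ a in S, ENNReal.ofReal (-A₁ a) ∂κ +
      ∫⁻ a in S, ENNReal.ofReal (A₁ a - A₀ a) ∂κ) + (u.toENNReal + ∫⁻ a in Sᶜ, ‖A₀ a‖ₑ ∂κ) := by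
  by_cases hT1 : ∫⁻ a in S, ENNReal.ofReal (-A₁ a) ∂κ = ⊤
  · simp [hT1]
  by_cases hT2 : ∫⁻ a in S, ENNReal.ofReal (A₁ a - A₀ a) ∂κ = ⊤
  · simp [hT2]
  by_cases hT3 : ∫⁻ a in Sᶜ, ‖A₀ a‖ₑ ∂κ = ⊤
  · simp [hT3]
  have hNS : ∫⁻ a in S, ENNReal.ofReal (-A₀ a) ∂κ ≠ ⊤ := by
    refine ne_top_of_le_ne_top (ENNReal.add_ne_top.2 ⟨hT1, hT2⟩) ?_
    rw [← lintegral_add_left (by fun_prop)]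
    refine lintegral_mono fun a => ?_
    refine le_trans (ENNReal.ofReal_le_ofReal ?_) ENNReal.ofReal_add_le
    linarith
  have hNC : ∫⁻ a in Sᶜ, ENNReal.ofReal (-A₀ a) ∂κ ≤ ∫⁻ a in Sᶜ, ‖A₀ a‖ₑ ∂κ := by
    refine lintegral_mono fun a => ?_
    rw [← ofReal_norm]
    exact ENNReal.ofReal_le_ofReal (neg_le_abs _)
  have hsplit := lintegral_add_compl (μ := κ) (fun a => ENNReal.ofReal (-A₀ a)) hS
  have hN : ∫⁻ a, ENNReal.ofReal (-A₀ a) ∂κ ≠ ⊤ := by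
    rw [← hsplit]
    exact ENNReal.add_ne_top.2 ⟨hNS, ne_top_of_le_ne_top hT3 hNC⟩
  have hmain := lintegral_pos_le_of_mean_le h hN
  rw [← hsplit] at hmain
  -- Pointwise this is `A₁ - A₀ ≤ (A₁ - A₀)⁺` written with positive and negative parts, each moved
  -- to the side where it appears with a plus sign. The integral of the negative part of `A₀` over
  -- `S` is finite and cancels at the end.
  have hpt : ∫⁻ a in S, ENNReal.ofReal (A₁ a) ∂κ + ∫⁻ a in S, ENNReal.ofReal (-A₀ a) ∂κ ≤
      (∫⁻ a in S, ENNReal.ofReal (-A₁ a) ∂κ + ∫⁻ a in S, ENNReal.ofReal (A₁ a - A₀ a) ∂κ) +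
        ∫⁻ a in S, ENNReal.ofReal (A₀ a) ∂κ := by
    rw [← lintegral_add_left (by fun_prop), ← lintegral_add_left (by fun_prop),
      ← lintegral_add_left (by fun_prop)]
    refine lintegral_mono fun a => ?_
    simp only [ENNReal.ofReal]
    rw [← ENNReal.coe_add, ← ENNReal.coe_add, ← ENNReal.coe_add, ENNReal.coe_le_coe,
      ← NNReal.coe_le_coe]
    simp only [NNReal.coe_add, Real.coe_toNNReal']
    rcases max_cases (A₁ a) 0 with h | h <;> rcases max_cases (-A₀ a) 0 with h' | h' <;>
      rcases max_cases (-A₁ a) 0 with h2 | h2 <;> rcases max_cases (A₁ a - A₀ a) 0 with h3 | h3 <;>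
      rcases max_cases (A₀ a) 0 with h4 | h4 <;> linarith
  refine (ENNReal.add_le_add_iff_right hNS).1 (hpt.trans ?_)
  calc _ ≤ (∫⁻ a in S, ENNReal.ofReal (-A₁ a) ∂κ +
          ∫⁻ a in S, ENNReal.ofReal (A₁ a - A₀ a) ∂κ) +
        (u.toENNReal + (∫⁻ a in S, ENNReal.ofReal (-A₀ a) ∂κ + ∫⁻ a in Sᶜ, ‖A₀ a‖ₑ ∂κ)) := by
        gcongr
        exact (setLIntegral_le_lintegral _ _).trans (hmain.trans (by gcongr))
    _ = _ := by ring

theorem lintegral_cond_ne_top_iff {α : Type*} [MeasurableSpace α] {P : Measure α}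
    [IsFiniteMeasure P] {S : Set α} (hS : P S ≠ 0) {f : α → ENNReal} :
    ∫⁻ a, f a ∂(cond P S) ≠ ⊤ ↔ ∫⁻ a in S, f a ∂P ≠ ⊤ := by
  rw [ProbabilityTheory.cond, lintegral_smul_measure, smul_eq_mul]
  constructor
  · intro h h'
    exact h (by rw [h', ENNReal.mul_top (by simp)])
  · exact fun h => ENNReal.mul_ne_top (by simpa using hS) h

theorem integrable_cond_iff {α : Type*} [MeasurableSpace α] {P : Measure α}
    [IsFiniteMeasure P] {S : Set α} (hS : P S ≠ 0) {f : α → ℝ} :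
    Integrable f (cond P S) ↔ IntegrableOn f S P := by
  rw [ProbabilityTheory.cond, integrable_smul_measure (by simp) (by simpa using hS), IntegrableOn]

theorem integral_cond {α : Type*} [MeasurableSpace α] {P : Measure α}
    {S : Set α} {f : α → ℝ} :
    ∫ a, f a ∂(cond P S) = (∫ a in S, f a ∂P) / P.real S := by
  rw [ProbabilityTheory.cond, integral_smul_measure, ENNReal.toReal_inv, smul_eq_mul, measureReal_def,
    div_eq_inv_mul]

variable {K : ℕ} {P : Measure (Latent K)} [IsProbabilityMeasure P]

theorem measurableSet_treat (x : Fin 2) : MeasurableSet {o : Latent K | treat o = x} :=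
  measurable_treat (MeasurableSet.singleton x)

theorem compl_treat_one : {o : Latent K | treat o = 1}ᶜ = {o | treat o = 0} := by
  ext o
  have h : ∀ t : Fin 2, t ≠ 1 ↔ t = 0 := by decide
  exact h (treat o)

/-- A bound on the conditional means of `A₀` given `W` gives a bound on the mean of `A₁ - A₀`
among the treated. -/
theorem bound_le_mean_sub {A₀ A₁ : Latent K → ℝ} (hA0 : Measurable A₀) (hA1 : Measurable A₁)
    {u : (Fin K → ℝ) → EReal} (hu : HasMean (covLaw (observedLaw P)) u)
    (hle : ∀ᵐ w ∂covLaw (observedLaw P), mean (slice P w) (fun o => (A₀ o : EReal)) ≤ u w)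
    (h0 : IntegrableOn A₀ {o | treat o = 0} P) (hp : P {o | treat o = 1} ≠ 0)
    (hatt : HasMean (latentTreated P) fun o => ((A₁ o - A₀ o : ℝ) : EReal)) :
    mean (latentTreated P) (fun o => (A₁ o : EReal)) -
        (mean (covLaw (observedLaw P)) u - ((∫ o in {o | treat o = 0}, A₀ o ∂P : ℝ) : EReal)) /
          ((P.real {o | treat o = 1} : ℝ) : EReal) ≤
      mean (latentTreated P) fun o => ((A₁ o - A₀ o : ℝ) : EReal) := by
  set μ := covLaw (observedLaw P)
  set S := {o : Latent K | treat o = 1}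
  have hSm : MeasurableSet S := measurableSet_treat 1
  have hSc : Sᶜ = {o | treat o = 0} := compl_treat_one
  have hp0 : 0 < P.real S := by
    rw [measureReal_def]; exact ENNReal.toReal_pos hp (measure_ne_top _ _)
  have hp0' : (0 : EReal) < ((P.real S : ℝ) : EReal) := EReal.coe_pos.2 hp0
  -- the trivial cases
  by_cases hUtop : ∫⁻ w, (u w).toENNReal ∂μ = ⊤
  · have hN : ∫⁻ w, (-u w).toENNReal ∂μ ≠ ⊤ := hu.2.resolve_left (not_not.2 hUtop)
    have hU : mean μ u = ⊤ := by
      unfold mean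
      rw [hUtop, EReal.coe_ennreal_top, EReal.top_sub (by simpa using hN)]
    rw [hU, EReal.top_sub_coe, EReal.top_div_of_pos_ne_top hp0' (EReal.coe_ne_top _),
      sub_eq_add_neg, EReal.neg_top, EReal.add_bot]
    exact bot_le
  by_cases hAtop : ∫⁻ o, ENNReal.ofReal (A₁ o - A₀ o) ∂latentTreated P = ⊤
  · have hN : ∫⁻ o, ENNReal.ofReal (-(A₁ o - A₀ o)) ∂latentTreated P ≠ ⊤ :=
      hatt.2.resolve_left (not_not.2 hAtop)
    have hA : mean (latentTreated P) (fun o => ((A₁ o - A₀ o : ℝ) : EReal)) = ⊤ := by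
      have : mean (latentTreated P) (fun o => ((A₁ o - A₀ o : ℝ) : EReal)) =
        ((∫⁻ o, ENNReal.ofReal (A₁ o - A₀ o) ∂latentTreated P : ENNReal) : EReal) -
        ((∫⁻ o, ENNReal.ofReal (-(A₁ o - A₀ o)) ∂latentTreated P : ENNReal) : EReal) := rfl
      rw [this, hAtop, EReal.coe_ennreal_top, EReal.top_sub (by simpa using hN)]
    rw [hA]
    exact le_top
  by_cases hM : ∫⁻ o, ENNReal.ofReal (-A₁ o) ∂latentTreated P = ⊤
  · have : mean (latentTreated P) (fun o => (A₁ o : EReal)) = ⊥ := by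
      have : mean (latentTreated P) (fun o => (A₁ o : EReal)) =
        ((∫⁻ o, ENNReal.ofReal (A₁ o) ∂latentTreated P : ENNReal) : EReal) -
        ((∫⁻ o, ENNReal.ofReal (-A₁ o) ∂latentTreated P : ENNReal) : EReal) := rfl
      rw [this, hM, EReal.coe_ennreal_top, sub_eq_add_neg, EReal.neg_top, EReal.add_bot]
    rw [this, sub_eq_add_neg, EReal.bot_add]
    exact bot_le
  rw [← ne_eq, latentTreated, lintegral_cond_ne_top_iff hp] at hAtop hM
  have h0' : ∫⁻ o in Sᶜ, ‖A₀ o‖ₑ ∂P ≠ ⊤ := by rw [hSc]; exact h0.2.ne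
  -- `A₁` is integrable among the treated
  have hJ : ∫⁻ o in S, ENNReal.ofReal (A₁ o) ∂P ≠ ⊤ := by
    have hsl : ∀ T : Set (Latent K), MeasurableSet T → ∀ f : Latent K → ENNReal, Measurable f →
        ∫⁻ w, ∫⁻ o in T, f o ∂slice P w ∂μ = ∫⁻ o in T, f o ∂P := by
      intro T hT f hf
      simp_rw [← lintegral_indicator hT]
      exact lintegral_slice P (hf.indicator hT)
    have hme : ∀ T : Set (Latent K), MeasurableSet T → ∀ f : Latent K → ENNReal, Measurable f →
        Measurable fun w => ∫⁻ o in T, f o ∂slice P w := by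
      intro T hT f hf
      simp_rw [← lintegral_indicator hT]
      exact (hf.indicator hT).lintegral_kernel
    have hint : ∫⁻ w, ∫⁻ o in S, ENNReal.ofReal (A₁ o) ∂slice P w ∂μ ≤
        ∫⁻ w, ((∫⁻ o in S, ENNReal.ofReal (-A₁ o) ∂slice P w +
          ∫⁻ o in S, ENNReal.ofReal (A₁ o - A₀ o) ∂slice P w) +
          ((u w).toENNReal + ∫⁻ o in Sᶜ, ‖A₀ o‖ₑ ∂slice P w)) ∂μ := by
      refine lintegral_mono_ae ?_
      filter_upwards [hle] with w hw using lintegral_pos_le hSm hA0 hA1 hw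
    have hm1 := hme S hSm (fun o => ENNReal.ofReal (-A₁ o)) (by fun_prop)
    have hm2 := hme S hSm (fun o => ENNReal.ofReal (A₁ o - A₀ o)) (by fun_prop)
    have hm3 := hme Sᶜ hSm.compl (fun o => ‖A₀ o‖ₑ) (by fun_prop)
    rw [lintegral_add_left (by exact hm1.add hm2), lintegral_add_left hm1,
      lintegral_add_right _ hm3, hsl S hSm _ (by fun_prop),
      hsl S hSm _ (by fun_prop), hsl S hSm _ (by fun_prop),
      hsl Sᶜ hSm.compl _ (by fun_prop)] at hint
    refine ne_top_of_le_ne_top ?_ hint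
    exact ENNReal.add_ne_top.2 ⟨ENNReal.add_ne_top.2 ⟨hM, hAtop⟩,
      ENNReal.add_ne_top.2 ⟨hUtop, h0'⟩⟩
  have hI1 : IntegrableOn A₁ S P :=
    integrable_of_lintegral_ne_top hA1.aemeasurable hJ hM
  -- `A₀` is integrable
  have hneg : ∫⁻ o, ENNReal.ofReal (-A₀ o) ∂P ≠ ⊤ := by
    rw [← lintegral_add_compl _ hSm]
    refine ENNReal.add_ne_top.2 ⟨?_, ?_⟩
    · refine ne_top_of_le_ne_top (ENNReal.add_ne_top.2 ⟨hM, hAtop⟩) ?_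
      rw [← lintegral_add_left (by fun_prop)]
      refine lintegral_mono fun a => ?_
      refine le_trans (ENNReal.ofReal_le_ofReal ?_) ENNReal.ofReal_add_le
      linarith
    · rw [hSc]; exact lintegral_ofReal_ne_top h0.neg
  have hnegw : ∀ᵐ w ∂μ, ∫⁻ o, ENNReal.ofReal (-A₀ o) ∂slice P w ≠ ⊤ := by
    rw [← lintegral_slice P (by fun_prop)] at hneg
    filter_upwards [ae_lt_top ((by fun_prop : Measurable fun o => ENNReal.ofReal
      (-A₀ o)).lintegral_kernel) hneg] with w hw using hw.ne
  -- Within almost every slice the mean is at most `u w` and the negative part is integrable, so the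
  -- positive part is at most the positive part of `u w` plus the negative part.
  have hpos : ∫⁻ o, ENNReal.ofReal (A₀ o) ∂P ≠ ⊤ := by
    rw [← lintegral_slice P (by fun_prop)] at hneg ⊢
    have : ∫⁻ w, ∫⁻ o, ENNReal.ofReal (A₀ o) ∂slice P w ∂μ ≤
        ∫⁻ w, ((u w).toENNReal + ∫⁻ o, ENNReal.ofReal (-A₀ o) ∂slice P w) ∂μ := by
      refine lintegral_mono_ae ?_
      filter_upwards [hle, hnegw] with w hw hw' using lintegral_pos_le_of_mean_le hw hw'
    rw [lintegral_add_right _ (by fun_prop : Measurable fun o => ENNReal.ofReal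
      (-A₀ o)).lintegral_kernel] at this
    exact ne_top_of_le_ne_top (ENNReal.add_ne_top.2 ⟨hUtop, hneg⟩) this
  have hI0 : Integrable A₀ P := integrable_of_lintegral_ne_top hA0.aemeasurable hpos hneg
  -- With `A₀` integrable, the tower property applies and the slicewise inequality integrates to
  -- real means.
  have hU : ((∫ o, A₀ o ∂P : ℝ) : EReal) ≤ mean μ u := by
    rw [← integral_slice hI0, ← mean_coe (integrable_integral_slice hI0)]
    refine mean_mono ?_
    filter_upwards [hle, ae_integrable_slice hI0] with w hw hwi
    rwa [mean_coe hwi] at hw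
  have hUt : mean μ u ≠ ⊤ := by
    intro h
    unfold mean at h
    rw [sub_eq_add_neg] at h
    have h2 : ((∫⁻ w, (u w).toENNReal ∂μ : ENNReal) : EReal) +
      -((∫⁻ w, (-u w).toENNReal ∂μ : ENNReal) : EReal) ≠ ⊤ :=
      EReal.add_ne_top (by simpa using hUtop) (by simp)
    exact h2 h
  obtain ⟨U, hU'⟩ : ∃ U : ℝ, mean μ u = U :=
    ⟨(mean μ u).toReal, (EReal.coe_toReal hUt (ne_bot_of_le_ne_bot (EReal.coe_ne_bot _) hU)).symm⟩
  rw [hU', EReal.coe_le_coe_iff] at hU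
  have hI1c : Integrable A₁ (latentTreated P) := (integrable_cond_iff hp).2 hI1
  have hI0c : Integrable A₀ (latentTreated P) := (integrable_cond_iff hp).2 hI0.integrableOn
  have hsub := mean_coe (hI1c.sub hI0c)
  simp only [Pi.sub_apply] at hsub
  rw [hU', mean_coe hI1c, hsub, ← EReal.coe_sub, ← EReal.coe_div,
    ← EReal.coe_sub, EReal.coe_le_coe_iff, integral_sub hI1c hI0c]
  unfold latentTreated
  rw [integral_cond, integral_cond]
  refine sub_le_sub_left ?_ _
  refine div_le_div_of_nonneg_right ?_ hp0.le
  rw [← integral_add_compl hSm hI0, hSc] at hU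
  linarith

end AttBound

/-! ### Observed quantities and c-dependence in terms of slices -/

section Observed

variable {K : ℕ}

theorem pscore_add (D : Measure (Observed K)) [IsFiniteMeasure D] (w : Fin K → ℝ) :
    pscore D 0 w + pscore D 1 w = 1 := by
  unfold pscore
  set ν := condDistrib (fun q : Observed K => q.2.1) (fun q => q.2.2) D w
  have h := probReal_compl_eq_one_sub (μ := ν) (MeasurableSet.singleton (0 : Fin 2))
  have hs : ({0}ᶜ : Set (Fin 2)) = {1} := by
    ext t
    have h : ∀ t : Fin 2, t ≠ 0 ↔ t = 1 := by decide
    simp [h]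
  rw [hs] at h
  linarith

theorem pscore_nonneg (D : Measure (Observed K)) [IsFiniteMeasure D] (x : Fin 2)
    (w : Fin K → ℝ) : 0 ≤ pscore D x w := measureReal_nonneg

theorem measurable_pscore (D : Measure (Observed K)) [IsFiniteMeasure D] (x : Fin 2) :
    Measurable (pscore D x) :=
  (Kernel.measurable_coe _ (MeasurableSet.singleton x)).ennreal_toReal

instance (D : Measure (Observed K)) [IsFiniteMeasure D] (x : Fin 2) (w : Fin K → ℝ) :
    IsProbabilityMeasure (outcomeLaw D x w) := by unfold outcomeLaw; infer_instance

instance (P : Measure (Latent K)) [IsFiniteMeasure P] (x : Fin 2) (w : Fin K → ℝ) :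
    IsProbabilityMeasure (potLaw P x w) := by unfold potLaw; infer_instance

instance (P : Measure (Latent K)) [IsFiniteMeasure P] (x x' : Fin 2) (w : Fin K → ℝ) :
    IsProbabilityMeasure (potLawGiven P x x' w) := by unfold potLawGiven; infer_instance

theorem givenTreat_observedLaw (P : Measure (Latent K)) (x : Fin 2) :
    givenTreat (observedLaw P) x = (ProbabilityTheory.cond P {o | treat o = x}).map observe := by
  have hm : MeasurableSet {q : Observed K | q.2.1 = x} :=
    (measurable_fst.comp measurable_snd) (MeasurableSet.singleton x)
  unfold givenTreat observedLaw ProbabilityTheory.cond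
  rw [Measure.restrict_map measurable_observe hm, Measure.map_apply measurable_observe hm,
    Measure.map_smul]
  rfl

theorem treatProb_observedLaw (P : Measure (Latent K)) (x : Fin 2) :
    treatProb (observedLaw P) x = P.real {o | treat o = x} := by
  have hm : MeasurableSet {q : Observed K | q.2.1 = x} :=
    (measurable_fst.comp measurable_snd) (MeasurableSet.singleton x)
  unfold treatProb observedLaw
  rw [map_measureReal_apply measurable_observe hm]
  rfl

theorem ae_cond_observe_eq (P : Measure (Latent K)) (x : Fin 2) :
    ∀ᵐ o ∂ProbabilityTheory.cond P {o | treat o = x}, (observe o).1 = pot x o := by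
  refine Measure.ae_smul_measure ?_ _
  filter_upwards [ae_restrict_mem (measurableSet_treat x)] with o ho
  rw [observe_eq]
  change pot (treat o) o = _
  rw [show treat o = x from ho]

theorem meanGiven_observedLaw (P : Measure (Latent K)) (x : Fin 2) :
    meanGiven (observedLaw P) x =
      mean (ProbabilityTheory.cond P {o | treat o = x}) fun o => (pot x o : EReal) := by
  rw [meanGiven, givenTreat_observedLaw, mean_map measurable_observe (by fun_prop)]
  refine mean_congr ?_
  filter_upwards [ae_cond_observe_eq P x] with o ho
  rw [ho]

variable (P : Measure (Latent K)) [IsProbabilityMeasure P]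

theorem measure_treat_zero_ne_zero
    (h : ∀ᵐ w ∂covLaw (observedLaw P), 0 < pscore (observedLaw P) 0 w) :
    P {o | treat o = 0} ≠ 0 := by
  intro h0
  have h1 := lintegral_slice P (f := {o : Latent K | treat o = 0}.indicator 1)
    (measurable_one.indicator (measurableSet_treat 0))
  rw [lintegral_indicator_one (measurableSet_treat 0), h0] at h1
  simp_rw [lintegral_indicator_one (measurableSet_treat (K := K) 0)] at h1
  rw [lintegral_eq_zero_iff (Kernel.measurable_coe _ (measurableSet_treat 0))] at h1
  have h2 : ∀ᵐ w ∂covLaw (observedLaw P), False := by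
    filter_upwards [h, h1, pscore_ae_eq_slice P 0] with w hw hw1 hw2
    rw [hw2, measureReal_def, hw1] at hw
    simp at hw
  obtain ⟨_, hw⟩ := h2.exists
  exact hw

theorem integrableOn_pot {x : Fin 2} (hx : P {o | treat o = x} ≠ 0)
    (h : Integrable (fun q : Observed K => q.1) (givenTreat (observedLaw P) x)) :
    IntegrableOn (pot x) {o | treat o = x} P := by
  rw [givenTreat_observedLaw, integrable_map_measure (by fun_prop) (by fun_prop)] at h
  rw [← integrable_cond_iff hx]
  exact h.congr (ae_cond_observe_eq P x)

theorem attOf_observedLaw (h0 : P {o | treat o = 0} ≠ 0)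
    (hY0 : IntegrableOn (pot 0) {o | treat o = 0} P) (E : EReal) :
    attOf (observedLaw P) E = mean (latentTreated P) (fun o => (pot 1 o : EReal)) -
      (E - ((∫ o in {o | treat o = 0}, pot 0 o ∂P : ℝ) : EReal)) /
        ((P.real {o | treat o = 1} : ℝ) : EReal) := by
  have hp0 : P.real {o : Latent K | treat o = 0} ≠ 0 := by
    rw [measureReal_def, ENNReal.toReal_ne_zero]
    exact ⟨h0, measure_ne_top _ _⟩
  rw [attOf, meanGiven_observedLaw, meanGiven_observedLaw, treatProb_observedLaw,
    treatProb_observedLaw, mean_coe ((integrable_cond_iff h0).2 hY0), integral_cond,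
    ← EReal.coe_mul, mul_div_cancel₀ _ hp0]
  rfl

/-- The law of `Y_x` on `X = x` given `W = w`. -/
theorem map_restrict_slice (x : Fin 2) :
    ∀ᵐ w ∂covLaw (observedLaw P), 0 < pscore (observedLaw P) x w →
      ((slice P w).restrict {o | treat o = x}).map (pot x) =
        ENNReal.ofReal (pscore (observedLaw P) x w) • outcomeLaw (observedLaw P) x w := by
  filter_upwards [outcomeLaw_ae_eq P x, potLawGiven_ae_eq_slice P x] with w h1 h2 hx
  refine Measure.ext fun A hA => ?_
  have h3 := h2 x A hA
  rw [Measure.map_apply (measurable_pot x) hA, Measure.restrict_apply (measurable_pot x hA),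
    inter_comm, h1 hx, Measure.smul_apply, smul_eq_mul]
  rw [measureReal_def, measureReal_def] at h3
  rw [← ENNReal.ofReal_toReal (measure_ne_top (slice P w) _), ← h3,
    ENNReal.ofReal_mul hx.le, ENNReal.ofReal_toReal (measure_ne_top _ _)]

theorem integrable_outcomeLaw {x : Fin 2} (h : IntegrableOn (pot x) {o | treat o = x} P) :
    ∀ᵐ w ∂covLaw (observedLaw P), 0 < pscore (observedLaw P) x w →
      Integrable (fun y => y) (outcomeLaw (observedLaw P) x w) := by
  have h1 := h.integrable_indicator (measurableSet_treat x)
  filter_upwards [ae_integrable_slice h1, map_restrict_slice P x] with w hw hm hx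
  rw [integrable_indicator_iff (measurableSet_treat x)] at hw
  have h2 : Integrable (fun y => y) (((slice P w).restrict {o | treat o = x}).map (pot x)) := by
    rw [integrable_map_measure (by fun_prop) (by fun_prop)]
    exact hw
  rw [hm hx, integrable_smul_measure (by simpa using hx) (by simp)] at h2
  exact h2

/-- The event that Y_0 lies in `A` is split by treatment status; its untreated part is observed. The
treated law of Y_0 is therefore fixed by `potLaw` and the data. -/
theorem slice_real_split :
    ∀ᵐ w ∂covLaw (observedLaw P), 0 < pscore (observedLaw P) 0 w → ∀ A, MeasurableSet A →
      (slice P w).real ({o | treat o = 1} ∩ pot 0 ⁻¹' A) =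
        (potLaw P 0 w).real A -
          pscore (observedLaw P) 0 w * (outcomeLaw (observedLaw P) 0 w).real A := by
  filter_upwards [outcomeLaw_ae_eq P 0, potLawGiven_ae_eq_slice P 0, potLaw_ae_eq_slice P 0]
    with w h1 h2 h3 hx A hA
  rw [h1 hx, h2 0 A hA, h3, map_measureReal_apply (measurable_pot 0) hA]
  have h4 := measureReal_inter_add_sdiff (μ := slice P w) (s := pot 0 ⁻¹' A)
    (measurableSet_treat 0)
  have hs : pot 0 ⁻¹' A \ {o : Latent K | treat o = 0} = {o | treat o = 1} ∩ pot 0 ⁻¹' A := by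
    ext o
    have h : ∀ t : Fin 2, t ≠ 0 ↔ t = 1 := by decide
    simp only [mem_sdiff, mem_preimage, mem_ofPred_eq, mem_inter_iff, h]
    exact and_comm
  rw [hs, inter_comm] at h4
  linarith

theorem measurable_latentScore (x : Fin 2) (w : Fin K → ℝ) :
    Measurable fun y => latentScore P x y w := by
  have := Kernel.measurable_coe (condDistrib treat (fun o : Latent K => (pot x o, cov o)) P)
    (MeasurableSet.singleton (1 : Fin 2))
  exact (this.comp measurable_prodMk_right).ennreal_toReal

theorem integrable_latentScore (x : Fin 2) (w : Fin K → ℝ) (ν : Measure ℝ) [IsFiniteMeasure ν] :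
    Integrable (fun y => latentScore P x y w) ν := by
  refine Integrable.of_bound (measurable_latentScore P x w).aestronglyMeasurable 1 ?_
  refine Filter.Eventually.of_forall fun y => ?_
  rw [Real.norm_eq_abs, abs_of_nonneg (by unfold latentScore; exact measureReal_nonneg)]
  unfold latentScore
  exact measureReal_le_one

/-- The centred latent score integrates over `A` to `p G(A) - p F(A)`, and bounding a function
almost everywhere is the same as bounding its integrals over all measurable sets. The part `p F ≤ G`
of `Dep` is automatic, the difference being the treated mass. -/
theorem condCDep_iff {c : ℝ}
    (h0 : ∀ᵐ w ∂covLaw (observedLaw P), 0 < pscore (observedLaw P) 0 w) :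
    CondCDep P c 0 ↔ ∀ᵐ w ∂covLaw (observedLaw P),
      Dep (pscore (observedLaw P) 0 w) c (outcomeLaw (observedLaw P) 0 w) (potLaw P 0 w) := by
  refine Filter.eventually_congr ?_
  filter_upwards [h0, slice_real_split P, latentScore_ae_eq_slice P 0] with w hp hsp hsc
  have hadd := pscore_add (observedLaw P) w
  set p := pscore (observedLaw P) 0 w
  set G := potLaw P 0 w
  have hI := integrable_latentScore P 0 w G
  have hA : ∀ A, MeasurableSet A →
      ∫ y in A, (latentScore P 0 y w - pscore (observedLaw P) 1 w) ∂G =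
        p * G.real A - p * (outcomeLaw (observedLaw P) 0 w).real A := by
    intro A hA
    rw [integral_sub hI.integrableOn (integrable_const _), hsc A hA, hsp hp A hA,
      setIntegral_const, smul_eq_mul]
    have : pscore (observedLaw P) 1 w = 1 - p := by linarith
    rw [this]
    ring
  constructor
  · intro h A hAm
    refine ⟨?_, ?_⟩
    · have := hsp hp A hAm
      have h2 : 0 ≤ (slice P w).real ({o | treat o = 1} ∩ pot 0 ⁻¹' A) := measureReal_nonneg
      linarith
    · rw [← hA A hAm, ← Real.norm_eq_abs]
      refine (norm_integral_le_of_norm_le (integrable_const c) (ae_restrict_of_ae h)).trans ?_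
      rw [setIntegral_const, smul_eq_mul, mul_comm]
  · intro h
    have hI' : Integrable (fun y => latentScore P 0 y w - pscore (observedLaw P) 1 w) G :=
      hI.sub (integrable_const _)
    have h1 := ae_le_of_forall_setIntegral_le hI' (integrable_const c) fun A hAm _ => by
      rw [hA A hAm, setIntegral_const, smul_eq_mul, mul_comm _ c]
      exact (le_abs_self _).trans (h A hAm).2
    have h2 := ae_le_of_forall_setIntegral_le (integrable_const (-c)) hI' fun A hAm _ => by
      rw [hA A hAm, setIntegral_const, smul_eq_mul, mul_comm _ (-c), neg_mul]
      exact (abs_le.1 (h A hAm).2).1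
    filter_upwards [h1, h2] with y hy1 hy2 using abs_le.2 ⟨hy2, hy1⟩

/-- The regularity of the conditional law `F` of `Y` given `X = 0`, `W = w`, where `p` is the
probability of `X = 0` given `W = w`. -/
structure Regular (p : ℝ) (F : Measure ℝ) : Prop where
  pos : 0 < p
  le_one : p ≤ 1
  continuous : Continuous (cdf F)
  strictMonoOn : StrictMonoOn (cdf F) F.support
  ordConnected : F.support.OrdConnected
  integrable : Integrable (fun y => y) F

theorem pscore_zero_pos {c : ℝ} (hP : Admissible P c) :
    ∀ᵐ w ∂covLaw (observedLaw P), 0 < pscore (observedLaw P) 0 w := by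
  filter_upwards [hP.pscore_lt_one] with w hw
  linarith [pscore_add (observedLaw P) w]

theorem regular_outcomeLaw {c : ℝ} (hP : Admissible P c)
    (hY0 : IntegrableOn (pot 0) {o | treat o = 0} P) :
    ∀ᵐ w ∂covLaw (observedLaw P),
      Regular (pscore (observedLaw P) 0 w) (outcomeLaw (observedLaw P) 0 w) ∧
        (outcomeLaw (observedLaw P) 0 w).support = (potLaw P 0 w).support := by
  filter_upwards [pscore_zero_pos P hP, hP.continuous_outcomes, hP.support_independence,
    outcomeLaw_ae_eq P 0, integrable_outcomeLaw P hY0] with w hp hc hs ho hi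
  obtain ⟨h1, h2⟩ := hc 0 0 hp
  obtain ⟨a, b, -, hsG, hsF⟩ := hs 0
  have hsF0 := hsF 0 hp
  rw [← ho hp] at h1 h2 hsF0
  refine ⟨⟨hp, ?_, h1, h2, ?_, hi hp⟩, hsF0⟩
  · linarith [pscore_add (observedLaw P) w, pscore_nonneg (observedLaw P) 1 w]
  · rw [hsF0, hsG]
    refine ⟨fun x hx y hy z hz => ⟨hx.1.trans ?_, le_trans ?_ hy.2⟩⟩
    · exact EReal.coe_le_coe_iff.2 hz.1
    · exact EReal.coe_le_coe_iff.2 hz.2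

end Observed

/-! ### Validity of the bounds -/

section Bounds

/-- Only an inequality in general: if both parts have infinite integral, both means are `⊤ - ⊤ = ⊥`.
-/
theorem mean_neg_le {α : Type*} [MeasurableSpace α] {μ : Measure α} {f : α → EReal} :
    mean μ (fun a => -f a) ≤ -mean μ f := by
  by_cases h : (∫⁻ a, (f a).toENNReal ∂μ) ≠ ⊤ ∨ (∫⁻ a, (-f a).toENNReal ∂μ) ≠ ⊤
  · exact (mean_neg h).le
  · push Not at h
    unfold mean
    simp [h.1, h.2]

/-- Lets the upper endpoint be treated as a lower endpoint for the negated outcomes. The two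
hypotheses exclude the indeterminate cases, in which `EReal` subtraction does not commute with
negation. -/
theorem sub_sub_div_eq_neg {m L : EReal} {r p : ℝ} (hp : 0 < p) (htop : m = ⊤ → L ≠ ⊤)
    (hbot : m = ⊥ → L ≠ ⊥) :
    m - (L - (r : EReal)) / (p : EReal) = -(-m - (-L - ((-r : ℝ) : EReal)) / (p : EReal)) := by
  have hp' : (0 : EReal) < (p : EReal) := EReal.coe_pos.2 hp
  induction L with
  | bot =>
    have hm : m ≠ ⊥ := fun h => hbot h rfl
    rw [EReal.neg_bot, EReal.top_sub_coe, EReal.top_div_of_pos_ne_top hp' (EReal.coe_ne_top _),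
      sub_eq_add_neg ⊥, EReal.bot_add, EReal.bot_div_of_pos_ne_top hp' (EReal.coe_ne_top _),
      sub_eq_add_neg, sub_eq_add_neg, EReal.neg_bot, EReal.neg_top, EReal.add_bot, EReal.neg_bot,
      EReal.add_top_of_ne_bot hm]
  | top =>
    have hm : m ≠ ⊤ := fun h => htop h rfl
    rw [EReal.neg_top, EReal.top_sub_coe, EReal.top_div_of_pos_ne_top hp' (EReal.coe_ne_top _),
      sub_eq_add_neg ⊥, EReal.bot_add, EReal.bot_div_of_pos_ne_top hp' (EReal.coe_ne_top _),
      sub_eq_add_neg, sub_eq_add_neg, EReal.neg_bot, EReal.neg_top, EReal.add_bot,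
      EReal.add_top_of_ne_bot (by simpa using hm), EReal.neg_top]
  | coe L =>
    rw [← EReal.coe_neg, ← EReal.coe_sub, ← EReal.coe_sub, ← EReal.coe_div, ← EReal.coe_div]
    induction m with
    | bot => rfl
    | top => rfl
    | coe m =>
      rw [← EReal.coe_neg, ← EReal.coe_sub, ← EReal.coe_sub, ← EReal.coe_neg]
      congr 1
      ring

variable {K : ℕ} {P : Measure (Latent K)} [IsProbabilityMeasure P] {c : ℝ}

theorem mean_slice_le (hc0 : 0 ≤ c) (hP : Admissible P c)
    (hY0 : IntegrableOn (pot 0) {o | treat o = 0} P) :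
    ∀ᵐ w ∂covLaw (observedLaw P),
      lowerE0Given (observedLaw P) c w ≤ mean (slice P w) (fun o => (pot 0 o : EReal)) ∧
      mean (slice P w) (fun o => (pot 0 o : EReal)) ≤ upperE0Given (observedLaw P) c w := by
  filter_upwards [regular_outcomeLaw P hP hY0, potLaw_ae_eq_slice P 0,
    (condCDep_iff P (pscore_zero_pos P hP)).1 hP.cond_c_dep] with w hw hs hd
  have h1 : mean (slice P w) (fun o => (pot 0 o : EReal)) =
      mean (potLaw P 0 w) fun y => (y : EReal) := by
    rw [hs, mean_map (measurable_pot 0) (by fun_prop)]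
  rw [h1]
  exact ⟨lower_le_mean hw.1.pos hc0 hd hw.2, mean_le_upper hw.1.pos hc0 hd hw.2⟩

theorem lowerE0_le_upperE0 (hc0 : 0 ≤ c) (hP : Admissible P c)
    (hY0 : IntegrableOn (pot 0) {o | treat o = 0} P) :
    lowerE0 (observedLaw P) c ≤ upperE0 (observedLaw P) c := by
  refine mean_mono ?_
  filter_upwards [mean_slice_le hc0 hP hY0] with w hw using hw.1.trans hw.2

theorem att_mem_Icc (hc0 : 0 ≤ c) (hP : Admissible P c)
    (hY0 : IntegrableOn (pot 0) {o | treat o = 0} P)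
    (h1 : P {o | treat o = 1} ≠ 0) (h0 : P {o | treat o = 0} ≠ 0)
    (hY1 : HasMean (latentTreated P) fun o => (pot 1 o : EReal))
    (hlow : HasMean (covLaw (observedLaw P)) (lowerE0Given (observedLaw P) c))
    (hup : HasMean (covLaw (observedLaw P)) (upperE0Given (observedLaw P) c))
    (htop : mean (latentTreated P) (fun o => (pot 1 o : EReal)) = ⊤ →
      upperE0 (observedLaw P) c ≠ ⊤)
    (hbot : mean (latentTreated P) (fun o => (pot 1 o : EReal)) = ⊥ →
      lowerE0 (observedLaw P) c ≠ ⊥)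
    (hatt : HasATT P) :
    att P ∈ Icc (attOf (observedLaw P) (upperE0 (observedLaw P) c))
      (attOf (observedLaw P) (lowerE0 (observedLaw P) c)) := by
  have hsl := mean_slice_le hc0 hP hY0
  have hp : 0 < P.real {o : Latent K | treat o = 1} :=
    ENNReal.toReal_pos h1 (measure_ne_top _ _)
  rw [attOf_observedLaw P h0 hY0, attOf_observedLaw P h0 hY0]
  constructor
  · exact bound_le_mean_sub (measurable_pot 0) (measurable_pot 1) hup (hsl.mono fun w hw => hw.2)
      hY0 h1 hatt
  -- The upper endpoint is the lower one for -Y_0 and -Y_1. If the treated mean is `⊤`, the upper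
  -- bound on E(Y_0) is not `⊤` by assumption, hence neither is the smaller lower bound.
  · have hLU := lowerE0_le_upperE0 hc0 hP hY0
    rw [sub_sub_div_eq_neg hp (fun h hL => htop h (top_le_iff.1 (hL ▸ hLU))) hbot,
      EReal.le_neg]
    have hm0 : Measurable fun o : Latent K => -pot 0 o := (measurable_pot 0).neg
    have hm1 : Measurable fun o : Latent K => -pot 1 o := (measurable_pot 1).neg
    have heq : (fun o : Latent K => ((-pot 1 o - -pot 0 o : ℝ) : EReal)) =
        fun o => -((pot 1 o - pot 0 o : ℝ) : EReal) := by
      funext o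
      rw [← EReal.coe_neg]
      congr 1
      ring
    have hkey := bound_le_mean_sub hm0 hm1 hlow.neg ?_ hY0.neg h1 (by rw [heq]; exact hatt.neg)
    · rw [heq, mean_neg hatt.2, mean_neg hlow.2, integral_neg] at hkey
      have h3 := mean_neg hY1.2
      simp only [EReal.coe_neg] at hkey
      rw [h3] at hkey
      rw [EReal.coe_neg]
      exact hkey
    · filter_upwards [hsl] with w hw
      simp only [EReal.coe_neg]
      exact mean_neg_le.trans (EReal.neg_le_neg_iff.2 hw.1)

end Bounds

/-! ### Measurable selection with control of first moments -/

section Selection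

/-- An infinite negative part makes `mean` equal to `⊥`, whatever the positive part. -/
theorem lintegral_neg_ne_top_of_lt_mean {Ω : Type*} [MeasurableSpace Ω] {μ : Measure Ω}
    {u : Ω → EReal} {T : ℝ} (hT : (T : EReal) < mean μ u) :
    ∫⁻ w, (-u w).toENNReal ∂μ ≠ ⊤ := by
  intro h
  unfold mean at hT
  rw [h, EReal.coe_ennreal_top, sub_eq_add_neg, EReal.neg_top, EReal.add_bot] at hT
  exact not_lt_bot hT

theorem exists_measurable_nat {Ω : Type*} [MeasurableSpace Ω] {μ : Measure Ω}
    {v : ℕ → Ω → ℝ} (hv : ∀ n, Measurable (v n)) {ψ : Ω → ℝ}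
    (hψ : Measurable ψ) (h : ∀ᵐ w ∂μ, ∃ n, ψ w < v n w) :
    ∃ n : Ω → ℕ, Measurable n ∧ ∀ᵐ w ∂μ, ψ w < v (n w) w := by
  classical
  -- The second alternative makes the search for the least index succeed also on the exceptional
  -- null set.
  have hp : ∀ w, ∃ n, ψ w < v n w ∨ ∀ m, v m w ≤ ψ w := by
    intro w
    by_cases hw : ∃ n, ψ w < v n w
    · exact hw.imp fun n h => Or.inl h
    · push Not at hw
      exact ⟨0, Or.inr hw⟩
  refine ⟨fun w => Nat.find (hp w), measurable_find hp fun k => ?_, ?_⟩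
  · refine (measurableSet_lt hψ (hv k)).union ?_
    exact MeasurableSet.congr (MeasurableSet.iInter fun m => measurableSet_le (hv m) hψ)
      (by ext w; rw [mem_iInter]; exact Iff.rfl)
  · filter_upwards [h] with w ⟨n, hn⟩
    exact (Nat.find_spec (hp w)).resolve_right fun h => absurd (h n) (not_le.2 hn)

variable {Ω : Type*} [MeasurableSpace Ω] {μ : Measure Ω} [IsProbabilityMeasure μ]

/-- `u` is truncated from above at a large `m`, which keeps the mean above `T` by monotone
convergence; subtracting half of the remaining slack makes the inequality with `u` strict. -/
theorem exists_integrable_lt_of_measurable {u : Ω → EReal} (hu : Measurable u) {T : ℝ}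
    (hT : (T : EReal) < mean μ u) :
    ∃ ψ : Ω → ℝ, Measurable ψ ∧ Integrable ψ μ ∧ (∀ᵐ w ∂μ, (ψ w : EReal) < u w) ∧
      T < ∫ w, ψ w ∂μ := by
  have hN := lintegral_neg_ne_top_of_lt_mean hT
  have hcoe : Filter.Tendsto (fun m : ℕ => ((m : ℝ) : EReal)) Filter.atTop (nhds ⊤) :=
    EReal.tendsto_coe_nhds_top_iff.2 tendsto_natCast_atTop_atTop
  have hneg : ∀ (m : ℕ) w, (-min (u w) ((m : ℝ) : EReal)).toENNReal ≤ (-u w).toENNReal := by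
    intro m w
    rcases min_choice (u w) ((m : ℝ) : EReal) with h | h <;> rw [h]
    rw [EReal.toENNReal_of_nonpos]
    · exact bot_le
    · rw [← EReal.coe_neg]
      exact_mod_cast neg_nonpos.2 (Nat.cast_nonneg m)
  have hlim : Filter.Tendsto (fun m : ℕ => mean μ fun w => min (u w) ((m : ℝ) : EReal))
      Filter.atTop (nhds (mean μ u)) := by
    refine tendsto_mean_of_monotone (fun m => (hu.min measurable_const).aemeasurable) ?_ ?_ ?_
    · refine Filter.Eventually.of_forall fun w n m hnm => min_le_min le_rfl ?_
      exact EReal.coe_le_coe_iff.2 (by exact_mod_cast hnm)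
    · refine Filter.Eventually.of_forall fun w => ?_
      have := (tendsto_const_nhds (x := u w)).min hcoe
      rwa [min_eq_left le_top] at this
    · exact ne_top_of_le_ne_top hN (lintegral_mono fun w => hneg 0 w)
  obtain ⟨m, hm⟩ := (hlim.eventually_const_lt hT).exists
  have hbot : ∀ᵐ w ∂μ, u w ≠ ⊥ := by
    filter_upwards [ae_lt_top hu.neg.ereal_toENNReal hN] with w hw h
    simp only [Pi.neg_apply, h] at hw
    simp at hw
  set ψ : Ω → ℝ := fun w => (min (u w) ((m : ℝ) : EReal)).toReal with hψ
  have hψm : Measurable ψ := (hu.min measurable_const).ereal_toReal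
  have hcoeψ : ∀ᵐ w ∂μ, (ψ w : EReal) = min (u w) ((m : ℝ) : EReal) := by
    filter_upwards [hbot] with w hw
    refine EReal.coe_toReal ?_ ?_
    · exact ne_top_of_le_ne_top (EReal.coe_ne_top _) (min_le_right _ _)
    · rcases min_choice (u w) ((m : ℝ) : EReal) with h | h <;> rw [h]
      · exact hw
      · exact EReal.coe_ne_bot _
  have hψi : Integrable ψ μ := by
    refine integrable_of_lintegral_ne_top hψm.aemeasurable ?_ ?_
    · have : ∫⁻ _, ENNReal.ofReal (m : ℝ) ∂μ ≠ ⊤ := by simp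
      refine ne_top_of_le_ne_top this (lintegral_mono_ae ?_)
      filter_upwards [hcoeψ] with w hw
      refine ENNReal.ofReal_le_ofReal (EReal.coe_le_coe_iff.1 ?_)
      rw [hw]
      exact min_le_right _ _
    · refine ne_top_of_le_ne_top hN (lintegral_mono_ae ?_)
      filter_upwards [hcoeψ] with w hw
      rw [← toENNReal_neg_coe, hw]
      exact hneg m w
  rw [← mean_congr hcoeψ, mean_coe hψi, EReal.coe_lt_coe_iff] at hm
  set δ := (∫ w, ψ w ∂μ - T) / 2 with hδ
  have hδ0 : 0 < δ := by rw [hδ]; linarith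
  refine ⟨fun w => ψ w - δ, hψm.sub_const _, hψi.sub (integrable_const _), ?_, ?_⟩
  · filter_upwards [hcoeψ] with w hw
    refine lt_of_lt_of_le (EReal.coe_lt_coe_iff.2 (sub_lt_self (ψ w) hδ0)) ?_
    rw [hw]
    exact min_le_left _ _
  · rw [integral_sub hψi (integrable_const _), integral_const, probReal_univ, one_smul, hδ]
    linarith

/-- A function whose mean exceeds `T` exceeds an integrable function whose mean exceeds `T`. -/
theorem exists_integrable_lt {u : Ω → EReal} (hu : AEMeasurable u μ) {T : ℝ}
    (hT : (T : EReal) < mean μ u) :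
    ∃ ψ : Ω → ℝ, Measurable ψ ∧ Integrable ψ μ ∧ (∀ᵐ w ∂μ, (ψ w : EReal) < u w) ∧
      T < ∫ w, ψ w ∂μ := by
  rw [mean_congr hu.ae_eq_mk] at hT
  obtain ⟨ψ, h1, h2, h3, h4⟩ := exists_integrable_lt_of_measurable hu.measurable_mk hT
  refine ⟨ψ, h1, h2, ?_, h4⟩
  filter_upwards [h3, hu.ae_eq_mk] with w hw hw'
  rwa [hw']

/-- The kernel `w ↦ G (n w) w`. -/
def chooseKernel (G : ℕ → Kernel Ω ℝ) {n : Ω → ℕ} (hn : Measurable n) : Kernel Ω ℝ where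
  toFun w := G (n w) w
  measurable' := (measurable_from_prod_countable_right
    (f := fun z : ℕ × Ω => G z.1 z.2) fun k => (G k).measurable).comp (hn.prodMk measurable_id)

theorem chooseKernel_apply (G : ℕ → Kernel Ω ℝ) {n : Ω → ℕ} (hn : Measurable n) (w : Ω) :
    chooseKernel G hn w = G (n w) w := rfl

instance (G : ℕ → Kernel Ω ℝ) [∀ k, IsMarkovKernel (G k)] {n : Ω → ℕ} (hn : Measurable n) :
    IsMarkovKernel (chooseKernel G hn) :=
  ⟨fun w => by rw [chooseKernel_apply]; infer_instance⟩

/-- A measurable choice among the kernels `G n` has finite first absolute moment and makes the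
mean of `f` exceed `T`, when `u` is a lower bound for the supremum of the conditional means. -/
theorem exists_chooseKernel_lt (G : ℕ → Kernel Ω ℝ) [∀ k, IsMarkovKernel (G k)] {f : ℝ → ℝ}
    (hf : Measurable f) (hfn : ∀ y, ‖f y‖ₑ = ‖y‖ₑ)
    (hsafe : ∫⁻ w, ∫⁻ y, ‖y‖ₑ ∂G 0 w ∂μ ≠ ⊤)
    (hint : ∀ᵐ w ∂μ, ∀ n, ∫⁻ y, ‖y‖ₑ ∂G n w ≠ ⊤) {u : Ω → EReal} (hu : AEMeasurable u μ)
    (hG : ∀ᵐ w ∂μ, ∀ x : ℝ, (x : EReal) < u w → ∃ n, x < ∫ y, f y ∂G n w) {T : ℝ}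
    (hT : (T : EReal) < mean μ u) :
    ∃ (n : Ω → ℕ) (hn : Measurable n), ∫⁻ w, ∫⁻ y, ‖y‖ₑ ∂chooseKernel G hn w ∂μ ≠ ⊤ ∧
      T < ∫ w, ∫ y, f y ∂chooseKernel G hn w ∂μ := by
  classical
  obtain ⟨ψ, hψm, hψi, hψu, hψT⟩ := exists_integrable_lt hu hT
  have hvm : ∀ (H : Kernel Ω ℝ) [IsMarkovKernel H], Measurable fun w => ∫ y, f y ∂H w :=
    fun H _ => (hf.stronglyMeasurable.integral_kernel (κ := H)).measurable
  obtain ⟨n₁, hn₁, hlt⟩ := exists_measurable_nat (μ := μ) (fun n => hvm (G n)) hψm (by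
    filter_upwards [hψu, hG] with w h1 h2 using h2 _ h1)
  have habs : ∀ (H : Kernel Ω ℝ), Measurable fun w => ∫⁻ y, ‖y‖ₑ ∂H w :=
    fun H => Measurable.lintegral_kernel (κ := H) (by fun_prop)
  set a := fun w => ∫⁻ y, ‖y‖ₑ ∂chooseKernel G hn₁ w with ha
  have ham : Measurable a := habs _
  -- The index `n₁` beats `ψ` but may give a first moment that is not integrable over `w`. It is
  -- kept only where that moment is at most `k`; elsewhere the kernel `G 0` takes over.
  set n : ℕ → Ω → ℕ := fun k w => if a w ≤ (k : ENNReal) then n₁ w else 0 with hn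
  have hnm : ∀ k, Measurable (n k) := fun k =>
    Measurable.ite (measurableSet_le ham measurable_const) hn₁ measurable_const
  have hbound : ∀ k w, ∫⁻ y, ‖y‖ₑ ∂chooseKernel G (hnm k) w ≤ k + ∫⁻ y, ‖y‖ₑ ∂G 0 w := by
    intro k w
    rw [chooseKernel_apply]
    by_cases h : a w ≤ (k : ENNReal)
    · rw [show n k w = n₁ w from if_pos h]
      exact h.trans (self_le_add_right _ _)
    · rw [show n k w = 0 from if_neg h]
      exact le_add_self
  have hfin : ∀ k, ∫⁻ w, ∫⁻ y, ‖y‖ₑ ∂chooseKernel G (hnm k) w ∂μ ≠ ⊤ := by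
    intro k
    refine ne_top_of_le_ne_top ?_ (lintegral_mono (hbound k))
    rw [lintegral_add_left measurable_const]
    simpa using hsafe
  have hintegrable : ∀ (H : Kernel Ω ℝ) [IsMarkovKernel H], ∫⁻ w, ∫⁻ y, ‖y‖ₑ ∂H w ∂μ ≠ ⊤ →
      Integrable (fun w => ∫ y, f y ∂H w) μ := by
    intro H _ hH
    refine ⟨(hvm H).aestronglyMeasurable, lt_of_le_of_lt (lintegral_mono fun w => ?_) hH.lt_top⟩
    refine (enorm_integral_le_lintegral_enorm _).trans (le_of_eq ?_)
    simp_rw [hfn]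
  have h0i := hintegrable (G 0) hsafe
  -- A lower bound for the conditional means of the truncated choice. It is dominated independently
  -- of `k` and converges to `ψ`, so its integral exceeds `T` for large `k`.
  set φ : ℕ → Ω → ℝ := fun k w => if a w ≤ (k : ENNReal) then ψ w else ∫ y, f y ∂G 0 w with hφ
  have hφm : ∀ k, Measurable (φ k) := fun k =>
    Measurable.ite (measurableSet_le ham measurable_const) hψm (hvm (G 0))
  have hφb : ∀ k w, ‖φ k w‖ ≤ ‖ψ w‖ + ‖∫ y, f y ∂G 0 w‖ := by
    intro k w
    simp only [hφ]
    split_ifs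
    · exact le_add_of_nonneg_right (norm_nonneg _)
    · exact le_add_of_nonneg_left (norm_nonneg _)
  have hdom := hψi.norm.add h0i.norm
  have hlim : Filter.Tendsto (fun k => ∫ w, φ k w ∂μ) Filter.atTop (nhds (∫ w, ψ w ∂μ)) := by
    refine tendsto_integral_of_dominated_convergence _ (fun k => (hφm k).aestronglyMeasurable)
      hdom (fun k => Filter.Eventually.of_forall (hφb k)) ?_
    filter_upwards [hint] with w hw
    obtain ⟨k₀, hk₀⟩ := exists_nat_gt (a w).toNNReal
    have hak : a w ≤ k₀ := by
      have haw : a w ≠ ⊤ := hw (n₁ w)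
      rw [← ENNReal.coe_toNNReal haw]
      exact_mod_cast hk₀.le
    refine tendsto_const_nhds.congr' ?_
    filter_upwards [Filter.eventually_ge_atTop k₀] with k hk
    have : a w ≤ k := hak.trans (by exact_mod_cast hk)
    simp only [hφ, if_pos this]
  obtain ⟨k, hk⟩ := (hlim.eventually_const_lt hψT).exists
  refine ⟨n k, hnm k, hfin k, hk.trans_le ?_⟩
  refine integral_mono_ae (hdom.mono' (hφm k).aestronglyMeasurable
    (Filter.Eventually.of_forall (hφb k))) (hintegrable _ (hfin k)) ?_
  filter_upwards [hlt] with w hw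
  simp only [hφ, chooseKernel_apply]
  by_cases h : a w ≤ (k : ENNReal)
  · rw [if_pos h, show n k w = n₁ w from if_pos h]
    exact hw.le
  · rw [if_neg h, show n k w = 0 from if_neg h]

end Selection

/-! ### Permissible laws of the untreated outcome -/

section Compatible

variable {p c : ℝ} {F G : Measure ℝ}

/-- `G` is a possible law of `Y_0` given `W = w` when `F` is the law of `Y_0` given `X = 0`,
`W = w`, and `p` is the probability of `X = 0` given `W = w`. -/
structure Compatible (p c : ℝ) (F G : Measure ℝ) : Prop where
  dep : Dep p c F G
  ac : G ≪ F
  lt : p < 1 → ∃ b < 1, ∀ A, MeasurableSet A → p * F.real A ≤ b * G.real A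

theorem le_smul_of_real_le [IsFiniteMeasure F] [IsFiniteMeasure G] {a b : ℝ} (ha : 0 < a)
    (hb : 0 ≤ b) (h : ∀ A, MeasurableSet A → a * G.real A ≤ b * F.real A) :
    G ≤ ENNReal.ofReal (b / a) • F := by
  refine Measure.le_iff.2 fun A hA => ?_
  rw [Measure.smul_apply, smul_eq_mul, ← ofReal_measureReal (μ := G) (s := A),
    ← ofReal_measureReal (μ := F) (s := A), ← ENNReal.ofReal_mul (by positivity)]
  refine ENNReal.ofReal_le_ofReal ?_
  rw [div_mul_eq_mul_div, le_div_iff₀ ha]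
  linarith [h A hA]

theorem compatible_self [IsProbabilityMeasure F] (hp1 : p ≤ 1) (hc : 0 ≤ c) :
    Compatible p c F F where
  dep A _ := by
    refine ⟨?_, ?_⟩
    · nlinarith [measureReal_nonneg (μ := F) (s := A)]
    · rw [sub_self, abs_zero]; exact mul_nonneg hc measureReal_nonneg
  ac := Measure.AbsolutelyContinuous.rfl
  lt h := ⟨p, h, fun _ _ => le_rfl⟩

theorem Compatible.ac' [IsProbabilityMeasure F] [IsProbabilityMeasure G] (h : Compatible p c F G)
    (hp : 0 < p) : F ≪ G := by
  refine Measure.AbsolutelyContinuous.mk fun A hA h0 => ?_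
  have h1 := (h.dep A hA).1
  rw [measureReal_def G, h0, ENNReal.toReal_zero] at h1
  have h2 : F.real A = 0 := by
    refine le_antisymm ?_ measureReal_nonneg
    by_contra hn
    linarith [mul_pos hp (not_le.1 hn)]
  exact (measureReal_eq_zero_iff (measure_ne_top _ _)).1 h2

/-- All constraints are affine in `G`; for the last one the larger of the two constants `b` serves
both laws. -/
theorem Compatible.mix {G' : Measure ℝ} [IsProbabilityMeasure G] [IsProbabilityMeasure G']
    (h : Compatible p c F G) (h' : Compatible p c F G') {t : ℝ} (ht0 : 0 ≤ t) (ht1 : t ≤ 1) :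
    Compatible p c F (ENNReal.ofReal t • G + ENNReal.ofReal (1 - t) • G') := by
  have hr : ∀ A, (ENNReal.ofReal t • G + ENNReal.ofReal (1 - t) • G').real A =
      t * G.real A + (1 - t) * G'.real A := by
    intro A
    have := G.smul_finite (c := ENNReal.ofReal t) ENNReal.ofReal_ne_top
    have := G'.smul_finite (c := ENNReal.ofReal (1 - t)) ENNReal.ofReal_ne_top
    rw [measureReal_add_apply, measureReal_ennreal_smul_apply, measureReal_ennreal_smul_apply,
      ENNReal.toReal_ofReal ht0, ENNReal.toReal_ofReal (by linarith)]
  have ht1' : 0 ≤ 1 - t := by linarith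
  refine ⟨fun A hA => ?_, ?_, fun hp => ?_⟩
  · rw [hr]
    obtain ⟨h1, h2⟩ := h.dep A hA
    obtain ⟨h3, h4⟩ := h'.dep A hA
    rw [abs_le] at h2 h4 ⊢
    refine ⟨by nlinarith, by nlinarith, by nlinarith⟩
  · refine Measure.AbsolutelyContinuous.mk fun A _ h0 => ?_
    simp [h.ac h0, h'.ac h0]
  · obtain ⟨b, hb, h1⟩ := h.lt hp
    obtain ⟨b', hb', h2⟩ := h'.lt hp
    refine ⟨max b b', max_lt hb hb', fun A hA => ?_⟩
    rw [hr]
    have h3 : p * F.real A ≤ max b b' * G.real A :=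
      (h1 A hA).trans (mul_le_mul_of_nonneg_right (le_max_left _ _) measureReal_nonneg)
    have h4 : p * F.real A ≤ max b b' * G'.real A :=
      (h2 A hA).trans (mul_le_mul_of_nonneg_right (le_max_right _ _) measureReal_nonneg)
    nlinarith

variable {a b ε : ℝ} {R : ℝ → ℝ} [IsProbabilityMeasure F]

theorem compatible_rankLaw (h : IsRank p a b R) (hp : 0 < p) (ha : 0 < a) (hac : p - c ≤ a)
    (hbc : b ≤ p + c) (hb1 : b ≤ 1) (hb : p < 1 → b < 1) : Compatible p c F (rankLaw F R) := by
  have := isProbabilityMeasure_rankLaw (F := F) (h.measurable hp ha)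
  refine ⟨fun A hA => ?_, ?_, fun hp1 => ⟨b, hb hp1, fun A hA => h.measure_le hp ha hA⟩⟩
  · have h1 := h.measure_le (F := F) hp ha hA
    have h2 := h.le_measure (F := F) hp ha hA
    have h3 : 0 ≤ (rankLaw F R).real A := measureReal_nonneg
    rw [abs_le]
    refine ⟨by nlinarith, by nlinarith, by nlinarith⟩
  · have h1 := le_smul_of_real_le ha hp.le fun A hA => h.le_measure (F := F) hp ha hA
    exact (Measure.absolutelyContinuous_of_le h1).trans
      (Measure.smul_absolutelyContinuous)

/-- `rankLaw F R` is at most `p / a` times `F`, so it inherits the first moment. This concerns a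
single law; integrability over `w` is arranged in `exists_chooseKernel_lt`. -/
theorem IsRank.lintegral_rankLaw_ne_top (h : IsRank p a b R) (hp : 0 < p) (ha : 0 < a)
    (hF : Integrable (fun y => y) F) : ∫⁻ y, ‖y‖ₑ ∂rankLaw F R ≠ ⊤ := by
  have := isProbabilityMeasure_rankLaw (F := F) (h.measurable hp ha)
  have h1 := le_smul_of_real_le ha hp.le fun A hA => h.le_measure (F := F) hp ha hA
  refine ne_top_of_le_ne_top ?_ (lintegral_mono' h1 le_rfl)
  rw [lintegral_smul_measure]
  exact ENNReal.mul_ne_top ENNReal.ofReal_ne_top hF.2.ne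

/-- The identity contributes slope `p` with positive weight: this lifts the smallest slope above 0
and, if `p < 1`, brings the largest below 1, without leaving the range permitted by c-dependence. -/
theorem mix_slopes (hp0 : 0 < p) (hp1 : p ≤ 1) (hc : 0 ≤ c) (hε0 : 0 < ε) (hε1 : ε ≤ 1) :
    0 < (1 - ε) * max (p - c) 0 + ε * p ∧ p - c ≤ (1 - ε) * max (p - c) 0 + ε * p ∧
    (1 - ε) * min (p + c) 1 + ε * p ≤ p + c ∧ (1 - ε) * min (p + c) 1 + ε * p ≤ 1 ∧
    (p < 1 → (1 - ε) * min (p + c) 1 + ε * p < 1) := by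
  have h1 : 0 ≤ max (p - c) 0 := le_max_right _ _
  have h2 : p - c ≤ max (p - c) 0 := le_max_left _ _
  have h3 : max (p - c) 0 ≤ p := max_le (by linarith) hp0.le
  have h4 : min (p + c) 1 ≤ 1 := min_le_right _ _
  have h5 : min (p + c) 1 ≤ p + c := min_le_left _ _
  have h6 : p ≤ min (p + c) 1 := le_min (by linarith) hp1
  have h7 : 0 ≤ 1 - ε := by linarith
  refine ⟨?_, ?_, ?_, ?_, fun h => ?_⟩
  · have := mul_pos hε0 hp0
    nlinarith
  · nlinarith
  · nlinarith
  · nlinarith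
  · nlinarith

theorem compatible_mixUpper (hp0 : 0 < p) (hp1 : p ≤ 1) (hc : 0 ≤ c) (hε0 : 0 < ε)
    (hε1 : ε ≤ 1) : Compatible p c F (rankLaw F (mixUpperRank c p ε)) := by
  obtain ⟨h1, h2, h3, h4, h5⟩ := mix_slopes hp0 hp1 hc hε0 hε1
  exact compatible_rankLaw (isRank_mixUpperRank hp0 hp1 hc hε1) hp0 h1 h2 h3 h4 h5

theorem compatible_mixLower (hp0 : 0 < p) (hp1 : p ≤ 1) (hc : 0 ≤ c) (hε0 : 0 < ε)
    (hε1 : ε ≤ 1) : Compatible p c F (rankLaw F (mixLowerRank c p ε)) := by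
  obtain ⟨h1, h2, h3, h4, h5⟩ := mix_slopes hp0 hp1 hc hε0 hε1
  exact compatible_rankLaw (isRank_mixUpperRank hp0 hp1 hc hε1).reflect hp0 h1 h2 h3 h4 h5

end Compatible

/-! ### Approximating the bounds by permissible laws -/

section Approximation

variable {p c : ℝ} {F : Measure ℝ} [IsProbabilityMeasure F]

/-- `σ` is the identity for the upper bound and the negation for the lower bound, so both are
increasing limits and monotone convergence applies even if the limit mean is infinite. -/
theorem exists_lt_integral_rankLaw {R : ℕ → ℝ → ℝ} {σ : ℝ → ℝ} (hσ : Measurable σ)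
    (hσn : ∀ y, ‖σ y‖ₑ = ‖y‖ₑ) (hR : ∀ n, Measurable (R n))
    (hfin : ∀ n, ∫⁻ y, ‖y‖ₑ ∂rankLaw F (R n) ≠ ⊤) {g : ℝ → EReal}
    (hmono : ∀ᵐ τ ∂unif, Monotone fun n => ((σ (rq F (R n τ)) : ℝ) : EReal))
    (hlim : ∀ᵐ τ ∂unif, Filter.Tendsto (fun n => ((σ (rq F (R n τ)) : ℝ) : EReal)) Filter.atTop
      (nhds (g τ))) {x : ℝ} (hx : (x : EReal) < mean unif g) :
    ∃ n, x < ∫ y, σ y ∂rankLaw F (R n) := by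
  have hm : ∀ n, Measurable fun τ => rq F (R n τ) := fun n => measurable_rq_right.comp (hR n)
  have hi : ∀ n, Integrable (fun τ => σ (rq F (R n τ))) unif := by
    intro n
    refine ⟨(hσ.comp (hm n)).aestronglyMeasurable, ?_⟩
    have h1 := hfin n
    rw [rankLaw, lintegral_map (by fun_prop) (hm n)] at h1
    rw [HasFiniteIntegral]
    simp_rw [hσn]
    exact h1.lt_top
  have h := tendsto_mean_of_monotone (fun n => (hi n).aemeasurable.coe_real_ereal) hmono hlim
    (lintegral_ofReal_ne_top (hi 0).neg)
  obtain ⟨n, hn⟩ := (h.eventually_const_lt hx).exists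
  rw [mean_coe (hi n), EReal.coe_lt_coe_iff] at hn
  refine ⟨n, ?_⟩
  rwa [rankLaw, integral_map (hm n).aemeasurable hσ.aestronglyMeasurable]

/-- The weights `1 / (n + 1)`. -/
def wt (n : ℕ) : ℝ := 1 / ((n : ℝ) + 1)

theorem wt_pos (n : ℕ) : 0 < wt n := Nat.one_div_pos_of_nat

theorem wt_le_one (n : ℕ) : wt n ≤ 1 := by
  unfold wt
  rw [div_le_one (by positivity)]
  linarith [Nat.cast_nonneg (α := ℝ) n]

theorem wt_antitone : Antitone wt := fun _ _ h => Nat.one_div_le_one_div h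

theorem tendsto_mix (a b : ℝ) :
    Filter.Tendsto (fun n => (1 - wt n) * a + wt n * b) Filter.atTop (nhds a) := by
  have h : Filter.Tendsto wt Filter.atTop (nhds 0) := tendsto_one_div_add_atTop_nhds_zero_nat
  have h1 := ((h.const_sub 1).mul_const a).add (h.mul_const b)
  simpa using h1

/-- Since `upperRank` is at least `τ`, the mixed ranks increase to it as the weight of the identity
decreases, and the quantile function is left continuous, also at rank 1 where its value may be `⊤`.
-/
theorem exists_lt_integral_mixUpper (hF : Regular p F) (hc : 0 ≤ c) {x : ℝ}
    (hx : (x : EReal) < mean unif fun τ => quantile F (upperRank c p τ)) :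
    ∃ n, x < ∫ y, y ∂rankLaw F (mixUpperRank c p (wt n)) := by
  have hrank := fun n => isRank_mixUpperRank (ε := wt n) hF.pos hF.le_one hc (wt_le_one n)
  have hpos := fun n => (mix_slopes hF.pos hF.le_one hc (wt_pos n) (wt_le_one n)).1
  have hq : ∀ n, ∀ τ ∈ Ioo (0 : ℝ) 1, (rq F (mixUpperRank c p (wt n) τ) : EReal) =
      quantile F ((1 - wt n) * upperRank c p τ + wt n * τ) := by
    intro n τ hτ
    rw [← mixUpperRank_eq hF.pos hτ.1.le hτ.2.le hc, quantile_eq_rq]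
    exact ((hrank n).mem_Ioo_iff hF.pos (hpos n) τ).2 hτ
  refine exists_lt_integral_rankLaw measurable_id (fun _ => rfl)
    (fun n => (hrank n).measurable hF.pos (hpos n))
    (fun n => (hrank n).lintegral_rankLaw_ne_top hF.pos (hpos n) hF.integrable) ?_ ?_ hx
  · filter_upwards [ae_unif_mem] with τ hτ n m hnm
    simp only [id]
    rw [hq n τ hτ, hq m τ hτ]
    refine quantile_mono ?_
    nlinarith [wt_antitone hnm, (upperRank_mem hF.pos hF.le_one hc hτ).1]
  · filter_upwards [ae_unif_mem] with τ hτ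
    simp only [id]
    simp_rw [hq _ τ hτ]
    obtain ⟨h1, h2, h3⟩ := upperRank_mem hF.pos hF.le_one hc hτ
    refine tendsto_order.2 ⟨fun y hy => ?_, fun y hy => Filter.Eventually.of_forall fun n => ?_⟩
    · obtain ⟨z, hz1, hz2⟩ := EReal.lt_iff_exists_real_btwn.1 hy
      obtain ⟨v, hv, hzv⟩ := exists_lt_quantile h2 h3 hz2
      filter_upwards [(tendsto_mix (upperRank c p τ) τ).eventually_const_lt hv.2] with n hn
      exact hz1.trans (hzv.trans_le (quantile_mono hn.le))
    · refine lt_of_le_of_lt (quantile_mono ?_) hy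
      nlinarith [wt_pos n]

/-- Here the mixed ranks decrease to `lowerRank`, and right continuity of the quantile function is
needed. This is where interval support and strict monotonicity of `cdf` enter. -/
theorem exists_lt_integral_mixLower (hF : Regular p F) (hc : 0 ≤ c) {x : ℝ}
    (hx : (x : EReal) < mean unif fun τ => -quantile F (lowerRank c p τ)) :
    ∃ n, x < ∫ y, -y ∂rankLaw F (mixLowerRank c p (wt n)) := by
  have hrank : ∀ n, IsRank p _ _ (mixLowerRank c p (wt n)) := fun n =>
    (isRank_mixUpperRank (ε := wt n) hF.pos hF.le_one hc (wt_le_one n)).reflect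
  have hpos := fun n => (mix_slopes hF.pos hF.le_one hc (wt_pos n) (wt_le_one n)).1
  have hq : ∀ n, ∀ τ ∈ Ioo (0 : ℝ) 1, ((-rq F (mixLowerRank c p (wt n) τ) : ℝ) : EReal) =
      -quantile F ((1 - wt n) * lowerRank c p τ + wt n * τ) := by
    intro n τ hτ
    rw [← mixLowerRank_eq hF.pos hτ.1.le hτ.2.le hc, quantile_eq_rq, EReal.coe_neg]
    exact ((hrank n).mem_Ioo_iff hF.pos (hpos n) τ).2 hτ
  refine exists_lt_integral_rankLaw measurable_neg (fun _ => enorm_neg _)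
    (fun n => (hrank n).measurable hF.pos (hpos n))
    (fun n => (hrank n).lintegral_rankLaw_ne_top hF.pos (hpos n) hF.integrable) ?_ ?_ hx
  · filter_upwards [ae_unif_mem] with τ hτ n m hnm
    simp only
    rw [hq n τ hτ, hq m τ hτ, EReal.neg_le_neg_iff]
    refine quantile_mono ?_
    nlinarith [wt_antitone hnm, (lowerRank_mem hF.pos hF.le_one hc hτ).1]
  · filter_upwards [ae_unif_mem] with τ hτ
    simp_rw [hq _ τ hτ]
    refine (continuous_neg.tendsto _).comp ?_
    obtain ⟨h1, h2, h3⟩ := lowerRank_mem hF.pos hF.le_one hc hτ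
    refine tendsto_order.2 ⟨fun y hy => Filter.Eventually.of_forall fun n => ?_, fun y hy => ?_⟩
    · refine lt_of_lt_of_le hy (quantile_mono ?_)
      nlinarith [wt_pos n]
    · obtain ⟨z, hz1, hz2⟩ := EReal.lt_iff_exists_real_btwn.1 hy
      obtain ⟨v, hv, hzv⟩ := exists_quantile_lt h2 h3 hF.ordConnected hF.strictMonoOn hz1
      filter_upwards [(tendsto_mix (lowerRank c p τ) τ).eventually_lt_const hv.1] with n hn
      exact (lt_of_le_of_lt (quantile_mono hn.le) hzv).trans hz2

end Approximation

/-! ### Kernels of rank laws and mixtures -/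

section Kernels

variable {Ω : Type*} [MeasurableSpace Ω] (F : Kernel Ω ℝ) [IsMarkovKernel F]

/-- The kernel `w ↦ rankLaw (F w) (R w)`. -/
def rankKernel {R : Ω → ℝ → ℝ} (hR : Measurable fun z : Ω × ℝ => R z.1 z.2) : Kernel Ω ℝ where
  toFun w := rankLaw (F w) (R w)
  measurable' := by
    have hf : Measurable fun z : Ω × ℝ => rq (F z.1) (R z.1 z.2) :=
      (measurable_rq F).comp (measurable_fst.prodMk hR)
    refine Measure.measurable_of_measurable_coe _ fun s hs => ?_
    have h : ∀ w, rankLaw (F w) (R w) s =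
        unif (Prod.mk w ⁻¹' ((fun z : Ω × ℝ => rq (F z.1) (R z.1 z.2)) ⁻¹' s)) := fun w =>
      Measure.map_apply (hf.comp measurable_prodMk_left) hs
    simp_rw [h]
    exact measurable_measure_prodMk_left (hf hs)

theorem rankKernel_apply {R : Ω → ℝ → ℝ} (hR : Measurable fun z : Ω × ℝ => R z.1 z.2) (w : Ω) :
    rankKernel F hR w = rankLaw (F w) (R w) := rfl

instance {R : Ω → ℝ → ℝ} (hR : Measurable fun z : Ω × ℝ => R z.1 z.2) :
    IsMarkovKernel (rankKernel F hR) :=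
  ⟨fun w => by
    rw [rankKernel_apply]
    exact isProbabilityMeasure_rankLaw (hR.comp measurable_prodMk_left)⟩

/-- The kernel `w ↦ t G w + (1 - t) G' w`. -/
def mixKernel (G G' : Kernel Ω ℝ) (t : ℝ) : Kernel Ω ℝ where
  toFun w := ENNReal.ofReal t • G w + ENNReal.ofReal (1 - t) • G' w
  measurable' := by
    refine Measure.measurable_of_measurable_coe _ fun s hs => ?_
    simp only [Measure.add_apply, Measure.smul_apply, smul_eq_mul]
    exact ((Kernel.measurable_coe G hs).const_mul _).add ((Kernel.measurable_coe G' hs).const_mul _)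

theorem mixKernel_apply (G G' : Kernel Ω ℝ) (t : ℝ) (w : Ω) :
    mixKernel G G' t w = ENNReal.ofReal t • G w + ENNReal.ofReal (1 - t) • G' w := rfl

theorem isMarkovKernel_mixKernel (G G' : Kernel Ω ℝ) [IsMarkovKernel G] [IsMarkovKernel G'] {t : ℝ}
    (ht0 : 0 ≤ t) (ht1 : t ≤ 1) : IsMarkovKernel (mixKernel G G' t) := by
  refine ⟨fun w => ⟨?_⟩⟩
  rw [mixKernel_apply]
  simp only [Measure.add_apply, Measure.smul_apply, smul_eq_mul, measure_univ, mul_one]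
  rw [← ENNReal.ofReal_add ht0 (by linarith)]
  simp

end Kernels

/-! ### A safe kernel with integrable first moment -/

section Concentrated

/-- The ball of radius `k` around `0` on the line. -/
abbrev cell (k : ℕ) : Set ℝ := {y | ‖y‖ ≤ k}

theorem measurableSet_cell (k : ℕ) : MeasurableSet (cell k) :=
  measurableSet_le measurable_norm measurable_const

theorem exists_cell_pos (F : Measure ℝ) [IsProbabilityMeasure F] : ∃ k : ℕ, 0 < F (cell k) := by
  by_contra! h
  have hU : (⋃ k : ℕ, cell k) = univ := by
    refine eq_univ_of_forall fun y => mem_iUnion.2 ?_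
    obtain ⟨k, hk⟩ := exists_nat_ge ‖y‖
    exact ⟨k, hk⟩
  have h0 : F univ = 0 := by
    rw [← hU]
    exact measure_iUnion_null fun k => nonpos_iff_eq_zero.1 (h k)
  simp at h0

open Classical in
/-- The least `k` such that `F` charges the ball of radius `k`. -/
def cellIndex (F : Measure ℝ) [IsProbabilityMeasure F] : ℕ := Nat.find (exists_cell_pos F)

theorem cell_pos (F : Measure ℝ) [IsProbabilityMeasure F] : 0 < F (cell (cellIndex F)) := by
  classical exact Nat.find_spec (exists_cell_pos F)

theorem measure_cell_eq_zero (F : Measure ℝ) [IsProbabilityMeasure F] {m : ℕ}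
    (h : m < cellIndex F) : F (cell m) = 0 := by
  classical
  have := Nat.find_min (exists_cell_pos F) h
  simpa using this

/-- The weight `p / (p + c (1 - p) / 2)`. -/
def tilt (p c : ℝ) : ℝ := p / (p + c * (1 - p) / 2)

/-- The mixture of `F` and its restriction to the smallest charged ball. -/
def concentrated (p c : ℝ) (F : Measure ℝ) [IsProbabilityMeasure F] : Measure ℝ :=
  ENNReal.ofReal (tilt p c) • F +
    ENNReal.ofReal (1 - tilt p c) • ProbabilityTheory.cond F (cell (cellIndex F))

variable {p c : ℝ}

theorem tilt_mem (hp0 : 0 ≤ p) (hp1 : p ≤ 1) (hc : 0 < c) : 0 ≤ tilt p c ∧ tilt p c ≤ 1 := by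
  have h1 : 0 ≤ c * (1 - p) / 2 := by
    have := mul_nonneg hc.le (sub_nonneg.2 hp1)
    linarith
  exact ⟨div_nonneg hp0 (by linarith), div_le_one_of_le₀ (by linarith) (by linarith)⟩

/-- The denominator of `tilt` is the density bound `b` of `Compatible`: for `0 < c ≤ 1` it is at
most `p + c` and, if `p < 1`, below 1. -/
theorem tilt_mul (hp0 : 0 < p) (hp1 : p ≤ 1) (hc : 0 < c) :
    (p + c * (1 - p) / 2) * tilt p c = p := by
  have h1 : 0 ≤ c * (1 - p) / 2 := by
    have := mul_nonneg hc.le (sub_nonneg.2 hp1)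
    linarith
  exact mul_div_cancel₀ _ (by linarith)

/-- The denominator is at least `c / 2`. Thus the weight of `F` is of order `p`, matching the fact
that `p` times the first absolute moment of `F` is integrable over `w`. -/
theorem tilt_le (hp0 : 0 < p) (hp1 : p ≤ 1) (hc : 0 < c) (hc1 : c ≤ 1) :
    tilt p c ≤ 2 / c * p := by
  have h1 := tilt_mul hp0 hp1 hc
  have h2 := (tilt_mem hp0.le hp1 hc).1
  rw [div_mul_eq_mul_div, le_div_iff₀ hc]
  have h3 : c / 2 ≤ p + c * (1 - p) / 2 := by nlinarith
  linarith [mul_le_mul_of_nonneg_right h3 h2]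

variable {F : Measure ℝ} [IsProbabilityMeasure F]

theorem isProbabilityMeasure_concentrated (hp0 : 0 ≤ p) (hp1 : p ≤ 1) (hc : 0 < c) :
    IsProbabilityMeasure (concentrated p c F) := by
  have := cond_isProbabilityMeasure (cell_pos F).ne'
  obtain ⟨h0, h1⟩ := tilt_mem hp0 hp1 hc
  refine ⟨?_⟩
  unfold concentrated
  simp only [Measure.add_apply, Measure.smul_apply, smul_eq_mul, measure_univ, mul_one]
  rw [← ENNReal.ofReal_add h0 (by linarith)]
  simp

/-- For `p ≤ c` the lower density bound `p - c` is vacuous, so mass may be added freely inside the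
null-set class of `F`. The upper bound holds because the mixture dominates `tilt p c` times `F`. -/
theorem compatible_concentrated (hp0 : 0 < p) (hp1 : p ≤ 1) (hc : 0 < c) (hc1 : c ≤ 1)
    (hpc : p ≤ c) : Compatible p c F (concentrated p c F) := by
  have := cond_isProbabilityMeasure (cell_pos F).ne'
  obtain ⟨h0, h1⟩ := tilt_mem hp0.le hp1 hc
  have hmul := tilt_mul hp0 hp1 hc
  have hprob := isProbabilityMeasure_concentrated (F := F) hp0.le hp1 hc
  have hle : ∀ A, tilt p c * F.real A ≤ (concentrated p c F).real A := by
    intro A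
    have h2 : ENNReal.ofReal (tilt p c) * F A ≤ concentrated p c F A := by
      unfold concentrated
      rw [Measure.add_apply, Measure.smul_apply, smul_eq_mul]
      exact le_self_add
    have h3 := ENNReal.toReal_mono (measure_ne_top _ _) h2
    rwa [ENNReal.toReal_mul, ENNReal.toReal_ofReal h0] at h3
  have hkey : ∀ A, p * F.real A ≤ (p + c * (1 - p) / 2) * (concentrated p c F).real A := by
    intro A
    calc p * F.real A = (p + c * (1 - p) / 2) * (tilt p c * F.real A) := by
          rw [← mul_assoc, hmul]
      _ ≤ _ := mul_le_mul_of_nonneg_left (hle A) (by nlinarith)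
  refine ⟨fun A _ => ?_, ?_, fun hlt => ⟨p + c * (1 - p) / 2, by nlinarith, fun A _ => hkey A⟩⟩
  · have hG : 0 ≤ (concentrated p c F).real A := measureReal_nonneg
    have hF : 0 ≤ F.real A := measureReal_nonneg
    have := hkey A
    have h3 : (p + c * (1 - p) / 2) ≤ 1 := by nlinarith
    have h4 : (p + c * (1 - p) / 2) ≤ p + c := by nlinarith
    rw [abs_le]
    refine ⟨by nlinarith, by nlinarith, by nlinarith⟩
  · refine Measure.AbsolutelyContinuous.mk fun A _ hA => ?_
    unfold concentrated
    rw [Measure.add_apply, Measure.smul_apply, Measure.smul_apply, hA,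
      ProbabilityTheory.cond_absolutelyContinuous hA]
    simp

theorem lintegral_concentrated_le (p c : ℝ) (F : Measure ℝ) [IsProbabilityMeasure F] :
    ∫⁻ y, ‖y‖ₑ ∂concentrated p c F ≤
      ENNReal.ofReal (tilt p c) * ∫⁻ y, ‖y‖ₑ ∂F + ENNReal.ofReal (1 - tilt p c) * cellIndex F := by
  have := cond_isProbabilityMeasure (cell_pos F).ne'
  unfold concentrated
  rw [lintegral_add_measure, lintegral_smul_measure, lintegral_smul_measure, smul_eq_mul,
    smul_eq_mul]
  gcongr
  have h : ∀ᵐ y ∂ProbabilityTheory.cond F (cell (cellIndex F)), ‖y‖ₑ ≤ cellIndex F := by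
    refine Measure.ae_smul_measure ?_ _
    filter_upwards [ae_restrict_mem (measurableSet_cell _)] with y hy
    rw [← ofReal_norm, ← ENNReal.ofReal_natCast]
    exact ENNReal.ofReal_le_ofReal hy
  refine (lintegral_mono_ae h).trans ?_
  simp

/-- When `F` does not charge a ball around `0`, all the mass lies on one side, and the bounds on
the mean are at least the radius in absolute value. -/
theorem cellIndex_le (hF : Regular p F) (hc : 0 ≤ c) :
    (cellIndex F : ENNReal) ≤
      1 + ((mean unif fun τ => quantile F (lowerRank c p τ)).toENNReal +
        (-mean unif fun τ => quantile F (upperRank c p τ)).toENNReal) := by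
  by_cases hk : cellIndex F ≤ 1
  · exact le_trans (by exact_mod_cast hk) le_self_add
  obtain ⟨m, hm⟩ : ∃ m, cellIndex F = m + 1 := ⟨cellIndex F - 1, by omega⟩
  have hm1 : 1 ≤ m := by omega
  have h0 : F (cell m) = 0 := measure_cell_eq_zero F (by omega)
  have hmpos : (0 : ℝ) < m := by exact_mod_cast hm1
  have hsub : ∀ y ∈ F.support, (m : ℝ) ≤ ‖y‖ := by
    intro y hy
    by_contra hlt
    rw [not_le] at hlt
    refine Measure.notMem_support_iff_exists.2 ⟨cell m, ?_, h0⟩ hy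
    exact Filter.mem_of_superset ((isOpen_lt continuous_norm continuous_const).mem_nhds hlt)
      fun z (hz : ‖z‖ < m) => show ‖z‖ ≤ (m : ℝ) from hz.le
  have h0s : (0 : ℝ) ∉ F.support := fun h => by
    have := hsub 0 h
    simp at this
    omega
  have hmem : ∀ τ ∈ Ioo (0 : ℝ) 1, rq F τ ∈ F.support := fun τ hτ => rq_mem_support hτ
  have hconst : ∀ a : ℝ, mean unif (fun _ => (a : EReal)) = a := by
    intro a
    rw [mean_coe (integrable_const a)]
    simp
  rw [hm]
  by_cases hside : ∀ y ∈ F.support, 0 ≤ y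
  · have h1 : ((m : ℝ) : EReal) ≤ mean unif fun τ => quantile F (lowerRank c p τ) := by
      rw [← hconst]
      refine mean_mono (Filter.Eventually.of_forall fun τ => le_sInf ?_)
      rintro _ ⟨y, ⟨hy, -⟩, rfl⟩
      have := hsub y hy
      rw [Real.norm_eq_abs, abs_of_nonneg (hside y hy)] at this
      exact EReal.coe_le_coe_iff.2 this
    have h2 := EReal.toENNReal_le_toENNReal h1
    rw [EReal.real_coe_toENNReal, ENNReal.ofReal_natCast] at h2
    push_cast
    rw [add_comm]
    gcongr
    exact h2.trans le_self_add
  · push Not at hside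
    obtain ⟨z, hz, hz0⟩ := hside
    have hall : ∀ y ∈ F.support, y ≤ -m := by
      intro y hy
      have hy0 : y < 0 := by
        by_contra hge
        exact h0s (hF.ordConnected.out hz hy ⟨hz0.le, not_lt.1 hge⟩)
      have := hsub y hy
      rw [Real.norm_eq_abs, abs_of_neg hy0] at this
      linarith
    have h1 : (mean unif fun τ => quantile F (upperRank c p τ)) ≤ ((-m : ℝ) : EReal) := by
      rw [← hconst]
      refine mean_mono ?_
      filter_upwards [ae_unif_mem] with τ hτ
      obtain ⟨-, h3, h4⟩ := upperRank_mem hF.pos hF.le_one hc hτ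
      -- The upper rank may equal 1, where the quantile need not be a support point; left continuity
      -- moves to a rank inside `(0, 1)`, whose quantile is one.
      by_contra hlt
      obtain ⟨v, hv, hlt'⟩ := exists_lt_quantile h3 h4 (not_le.1 hlt)
      have hv1 : v ∈ Ioo (0 : ℝ) 1 := ⟨hv.1, hv.2.trans_le h4⟩
      rw [quantile_eq_rq hv1, EReal.coe_lt_coe_iff] at hlt'
      exact absurd (hall _ (hmem v hv1)) (not_le.2 hlt')
    have h2 := EReal.toENNReal_le_toENNReal (EReal.neg_le_neg_iff.2 h1)
    rw [← EReal.coe_neg, neg_neg, EReal.real_coe_toENNReal, ENNReal.ofReal_natCast] at h2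
    push_cast
    rw [add_comm]
    gcongr
    exact h2.trans le_add_self

theorem measurable_cellIndex {Ω : Type*} [MeasurableSpace Ω] (F : Kernel Ω ℝ) [IsMarkovKernel F] :
    Measurable fun w => cellIndex (F w) := by
  classical
  refine measurable_find (fun w => exists_cell_pos (F w)) fun k => ?_
  exact measurableSet_lt measurable_const (Kernel.measurable_coe F (measurableSet_cell k))

/-- The kernel `w ↦ concentrated (p w) c (F w)` where `p w ≤ c`, and `F` elsewhere. -/
def safeKernel {Ω : Type*} [MeasurableSpace Ω] (F : Kernel Ω ℝ) [IsMarkovKernel F] {p : Ω → ℝ}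
    (hp : Measurable p) (c : ℝ) : Kernel Ω ℝ where
  toFun w := by classical exact if p w ≤ c then concentrated (p w) c (F w) else F w
  measurable' := by
    classical
    refine Measurable.ite (measurableSet_le hp measurable_const) ?_ F.measurable
    refine Measure.measurable_of_measurable_coe _ fun s hs => ?_
    have hcell : ∀ T : Set ℝ, MeasurableSet T →
        Measurable fun w => F w (cell (cellIndex (F w)) ∩ T) := by
      intro T hT
      have h : MeasurableSet {z : Ω × ℝ | ‖z.2‖ ≤ (cellIndex (F z.1) : ℝ) ∧ z.2 ∈ T} := by
        refine (measurableSet_le measurable_snd.norm ?_).inter (measurable_snd hT)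
        exact (measurable_from_nat (f := fun n : ℕ => (n : ℝ))).comp
          ((measurable_cellIndex F).comp measurable_fst)
      exact Kernel.measurable_kernel_prodMk_left (κ := F) h
    have htilt : Measurable fun w => tilt (p w) c := by unfold tilt; fun_prop
    have hs' : ∀ w, concentrated (p w) c (F w) s = ENNReal.ofReal (tilt (p w) c) * F w s +
        ENNReal.ofReal (1 - tilt (p w) c) *
          ((F w (cell (cellIndex (F w)) ∩ univ))⁻¹ * F w (cell (cellIndex (F w)) ∩ s)) := by
      intro w
      unfold concentrated
      rw [Measure.add_apply, Measure.smul_apply, Measure.smul_apply, inter_univ,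
        cond_apply (measurableSet_cell _), smul_eq_mul, smul_eq_mul]
    simp_rw [hs']
    exact (htilt.ennreal_ofReal.mul (Kernel.measurable_coe F hs)).add
      ((htilt.const_sub 1).ennreal_ofReal.mul ((hcell univ MeasurableSet.univ).inv.mul
        (hcell s hs)))

section Safe

variable {Ω : Type*} [MeasurableSpace Ω] (F : Kernel Ω ℝ) [IsMarkovKernel F] {p : Ω → ℝ}
  (hp : Measurable p) {c : ℝ} {w : Ω}

theorem safeKernel_of_le (h : p w ≤ c) : safeKernel F hp c w = concentrated (p w) c (F w) := by
  classical exact if_pos h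

theorem safeKernel_of_lt (h : c < p w) : safeKernel F hp c w = F w := by
  classical exact if_neg (not_le.2 h)

theorem isMarkovKernel_safeKernel (hp0 : ∀ w, 0 ≤ p w) (hp1 : ∀ w, p w ≤ 1) (hc : 0 < c) :
    IsMarkovKernel (safeKernel F hp c) := by
  refine ⟨fun w => ?_⟩
  rcases le_or_gt (p w) c with h | h
  · rw [safeKernel_of_le F hp h]
    exact isProbabilityMeasure_concentrated (hp0 w) (hp1 w) hc
  · rw [safeKernel_of_lt F hp h]
    infer_instance

theorem compatible_safeKernel (hp0 : 0 < p w) (hp1 : p w ≤ 1) (hc : 0 < c) (hc1 : c ≤ 1) :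
    Compatible (p w) c (F w) (safeKernel F hp c w) := by
  rcases le_or_gt (p w) c with h | h
  · rw [safeKernel_of_le F hp h]
    exact compatible_concentrated hp0 hp1 hc hc1 h
  · rw [safeKernel_of_lt F hp h]
    exact compatible_self hp1 hc.le

/-- Where `p > c` the kernel is `F` and `1 ≤ (2 / c) p`; where `p ≤ c`, `tilt_le` controls the `F`
part and `cellIndex_le` the ball part. -/
theorem lintegral_safeKernel_le (hF : Regular (p w) (F w)) (hc : 0 < c) (hc1 : c ≤ 1) :
    ∫⁻ y, ‖y‖ₑ ∂safeKernel F hp c w ≤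
      ENNReal.ofReal (2 / c) * (ENNReal.ofReal (p w) * ∫⁻ y, ‖y‖ₑ ∂F w) +
        (1 + ((mean unif fun τ => quantile (F w) (lowerRank c (p w) τ)).toENNReal +
        (-mean unif fun τ => quantile (F w) (upperRank c (p w) τ)).toENNReal)) := by
  have h2c : 0 ≤ 2 / c := by positivity
  rw [← mul_assoc, ← ENNReal.ofReal_mul h2c]
  rcases le_or_gt (p w) c with h | h
  · rw [safeKernel_of_le F hp h]
    refine (lintegral_concentrated_le _ _ _).trans (add_le_add ?_ ?_)
    · gcongr
      exact tilt_le hF.pos hF.le_one hc hc1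
    · refine le_trans ?_ (cellIndex_le hF hc.le)
      refine mul_le_of_le_one_left bot_le ?_
      rw [← ENNReal.ofReal_one]
      exact ENNReal.ofReal_le_ofReal (by linarith [(tilt_mem hF.pos.le hF.le_one hc).1])
  · rw [safeKernel_of_lt F hp h]
    refine le_trans ?_ le_self_add
    refine le_mul_of_one_le_left bot_le ?_
    rw [← ENNReal.ofReal_one]
    refine ENNReal.ofReal_le_ofReal ?_
    rw [div_mul_eq_mul_div, le_div_iff₀ hc]
    linarith

end Safe

end Concentrated

/-! ### Attaining every intermediate mean -/

section Attain

variable {Ω : Type*} [MeasurableSpace Ω] {μ : Measure Ω}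

/-- The safe kernel followed by rank kernels. -/
def rankSeq (S F : Kernel Ω ℝ) [IsMarkovKernel F] {R : ℕ → Ω → ℝ → ℝ}
    (hR : ∀ n, Measurable fun z : Ω × ℝ => R n z.1 z.2) : ℕ → Kernel Ω ℝ
  | 0 => S
  | n + 1 => rankKernel F (hR n)

instance (S F : Kernel Ω ℝ) [IsMarkovKernel S] [IsMarkovKernel F] {R : ℕ → Ω → ℝ → ℝ}
    (hR : ∀ n, Measurable fun z : Ω × ℝ => R n z.1 z.2) (n : ℕ) :
    IsMarkovKernel (rankSeq S F hR n) := by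
  cases n <;> (unfold rankSeq; infer_instance)

theorem exists_kernel_lt [IsProbabilityMeasure μ] (S F : Kernel Ω ℝ) [IsMarkovKernel S] [IsMarkovKernel F] {c : ℝ}
    {p : Ω → ℝ} {R : ℕ → Ω → ℝ → ℝ} (hR : ∀ n, Measurable fun z : Ω × ℝ => R n z.1 z.2)
    (hS : ∀ᵐ w ∂μ, Compatible (p w) c (F w) (S w))
    (hF : ∀ᵐ w ∂μ, ∀ n, Compatible (p w) c (F w) (rankLaw (F w) (R n w)))
    (hSfin : ∫⁻ w, ∫⁻ y, ‖y‖ₑ ∂S w ∂μ ≠ ⊤)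
    (hFfin : ∀ᵐ w ∂μ, ∀ n, ∫⁻ y, ‖y‖ₑ ∂rankLaw (F w) (R n w) ≠ ⊤) {f : ℝ → ℝ}
    (hf : Measurable f) (hfn : ∀ y, ‖f y‖ₑ = ‖y‖ₑ) {u : Ω → EReal} (hu : AEMeasurable u μ)
    (hG : ∀ᵐ w ∂μ, ∀ x : ℝ, (x : EReal) < u w → ∃ n, x < ∫ y, f y ∂rankLaw (F w) (R n w)) {T : ℝ}
    (hT : (T : EReal) < mean μ u) :
    ∃ G : Kernel Ω ℝ, IsMarkovKernel G ∧ (∀ᵐ w ∂μ, Compatible (p w) c (F w) (G w)) ∧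
      ∫⁻ w, ∫⁻ y, ‖y‖ₑ ∂G w ∂μ ≠ ⊤ ∧ T < ∫ w, ∫ y, f y ∂G w ∂μ := by
  obtain ⟨n, hn, h1, h2⟩ := exists_chooseKernel_lt (rankSeq S F hR) hf hfn hSfin (by
    have hm : Measurable fun w => ∫⁻ y, ‖y‖ₑ ∂S w := Measurable.lintegral_kernel (by fun_prop)
    filter_upwards [hFfin, ae_lt_top hm hSfin] with w h1 h2 n
    cases n with
    | zero => exact h2.ne
    | succ n => exact h1 n) hu (by
    filter_upwards [hG] with w h x hx
    obtain ⟨n, hn⟩ := h x hx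
    -- Index 0 of `rankSeq` is the safe kernel, so the rank kernels are shifted by one.
    exact ⟨n + 1, hn⟩) hT
  refine ⟨_, inferInstance, ?_, h1, h2⟩
  filter_upwards [hS, hF] with w h1 h2
  rw [chooseKernel_apply]
  cases n w with
  | zero => exact h1
  | succ n => exact h2 n

theorem integrable_integral_kernel (G : Kernel Ω ℝ) [IsMarkovKernel G]
    (h : ∫⁻ w, ∫⁻ y, ‖y‖ₑ ∂G w ∂μ ≠ ⊤) : Integrable (fun w => ∫ y, y ∂G w) μ :=
  ⟨(stronglyMeasurable_id.integral_kernel (κ := G)).aestronglyMeasurable,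
    lt_of_le_of_lt (lintegral_mono fun _ => enorm_integral_le_lintegral_enorm _) h.lt_top⟩

/-- The mean is affine in the mixing weight; the weight `(T - M') / (M - M')` solves the equation.
-/
theorem exists_mixKernel_integral_eq (G G' : Kernel Ω ℝ) [IsMarkovKernel G] [IsMarkovKernel G']
    (h : ∫⁻ w, ∫⁻ y, ‖y‖ₑ ∂G w ∂μ ≠ ⊤) (h' : ∫⁻ w, ∫⁻ y, ‖y‖ₑ ∂G' w ∂μ ≠ ⊤) {T : ℝ}
    (hT : T < ∫ w, ∫ y, y ∂G w ∂μ) (hT' : ∫ w, ∫ y, y ∂G' w ∂μ < T) :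
    ∃ t, 0 ≤ t ∧ t ≤ 1 ∧ ∫⁻ w, ∫⁻ y, ‖y‖ₑ ∂mixKernel G G' t w ∂μ ≠ ⊤ ∧
      ∫ w, ∫ y, y ∂mixKernel G G' t w ∂μ = T := by
  set M := ∫ w, ∫ y, y ∂G w ∂μ
  set M' := ∫ w, ∫ y, y ∂G' w ∂μ
  have hd : 0 < M - M' := by linarith
  have ht0 : 0 ≤ (T - M') / (M - M') := div_nonneg (by linarith) hd.le
  have ht1 : (T - M') / (M - M') ≤ 1 := (div_le_one hd).2 (by linarith)
  have hm : ∀ H : Kernel Ω ℝ, Measurable fun w => ∫⁻ y, ‖y‖ₑ ∂H w :=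
    fun H => Measurable.lintegral_kernel (κ := H) (by fun_prop)
  refine ⟨_, ht0, ht1, ?_, ?_⟩
  · simp_rw [mixKernel_apply, lintegral_add_measure, lintegral_smul_measure, smul_eq_mul]
    rw [lintegral_add_left ((hm G).const_mul _), lintegral_const_mul _ (hm G),
      lintegral_const_mul _ (hm G')]
    exact ENNReal.add_ne_top.2 ⟨ENNReal.mul_ne_top ENNReal.ofReal_ne_top h,
      ENNReal.mul_ne_top ENNReal.ofReal_ne_top h'⟩
  · set t := (T - M') / (M - M') with ht
    have hi : ∀ᵐ w ∂μ, ∫ y, y ∂mixKernel G G' t w =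
        t * ∫ y, y ∂G w + (1 - t) * ∫ y, y ∂G' w := by
      filter_upwards [ae_lt_top (hm G) h, ae_lt_top (hm G') h'] with w h1 h2
      have h3 : Integrable (fun y => y) (G w) := ⟨measurable_id.aestronglyMeasurable, h1⟩
      have h4 : Integrable (fun y => y) (G' w) := ⟨measurable_id.aestronglyMeasurable, h2⟩
      rw [mixKernel_apply, integral_add_measure (h3.smul_measure ENNReal.ofReal_ne_top)
        (h4.smul_measure ENNReal.ofReal_ne_top), integral_smul_measure, integral_smul_measure,
        ENNReal.toReal_ofReal ht0, ENNReal.toReal_ofReal (by linarith), smul_eq_mul, smul_eq_mul]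
    rw [integral_congr_ae hi, integral_add ((integrable_integral_kernel G h).const_mul _)
      ((integrable_integral_kernel G' h').const_mul _), integral_const_mul, integral_const_mul]
    change t * M + (1 - t) * M' = T
    have : t * (M - M') = T - M' := div_mul_cancel₀ _ hd.ne'
    linarith

/-- Every value strictly between the means of the two bounds is the mean of a compatible kernel. -/
theorem exists_compatible_integral_eq [IsProbabilityMeasure μ] (F : Kernel Ω ℝ) [IsMarkovKernel F] {p : Ω → ℝ}
    (hp : Measurable p) (hp0 : ∀ w, 0 ≤ p w) (hp1 : ∀ w, p w ≤ 1) {c : ℝ} (hc : 0 < c)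
    (hc1 : c ≤ 1) (hF : ∀ᵐ w ∂μ, Regular (p w) (F w))
    (hfin : ∫⁻ w, ENNReal.ofReal (p w) * ∫⁻ y, ‖y‖ₑ ∂F w ∂μ ≠ ⊤)
    (hl : HasMean μ fun w => mean unif fun τ => quantile (F w) (lowerRank c (p w) τ))
    (hu : HasMean μ fun w => mean unif fun τ => quantile (F w) (upperRank c (p w) τ)) {T : ℝ}
    (hlT : (mean μ fun w => mean unif fun τ => quantile (F w) (lowerRank c (p w) τ)) < T)
    (huT : (T : EReal) < mean μ fun w => mean unif fun τ => quantile (F w) (upperRank c (p w) τ)) :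
    ∃ G : Kernel Ω ℝ, IsMarkovKernel G ∧ (∀ᵐ w ∂μ, Compatible (p w) c (F w) (G w)) ∧
      ∫⁻ w, ∫⁻ y, ‖y‖ₑ ∂G w ∂μ ≠ ⊤ ∧ ∫ w, ∫ y, y ∂G w ∂μ = T := by
  have hlT' : ((-T : ℝ) : EReal) <
      mean μ fun w => -mean unif fun τ => quantile (F w) (lowerRank c (p w) τ) := by
    rw [mean_neg hl.2, EReal.coe_neg]
    exact EReal.neg_lt_neg_iff.2 hlT
  have := isMarkovKernel_safeKernel F hp hp0 hp1 hc
  have hSc : ∀ᵐ w ∂μ, Compatible (p w) c (F w) (safeKernel F hp c w) := by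
    filter_upwards [hF] with w hw using compatible_safeKernel F hp hw.pos hw.le_one hc hc1
  -- The three integrals in the bound are finite: the weighted moment by `hfin`, the positive part
  -- of the lower bound because its mean is below `T`, and the negative part of the upper bound
  -- because its mean is above `T`.
  have hSfin : ∫⁻ w, ∫⁻ y, ‖y‖ₑ ∂safeKernel F hp c w ∂μ ≠ ⊤ := by
    have h1 := lintegral_neg_ne_top_of_lt_mean huT
    have h2 := lintegral_neg_ne_top_of_lt_mean hlT'
    simp only [neg_neg] at h2
    refine ne_top_of_le_ne_top ?_ (lintegral_mono_ae
      (hF.mono fun w hw => lintegral_safeKernel_le F hp hw hc hc1))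
    have hm : Measurable fun w => ENNReal.ofReal (p w) * ∫⁻ y, ‖y‖ₑ ∂F w :=
      hp.ennreal_ofReal.mul (Measurable.lintegral_kernel (by fun_prop))
    rw [lintegral_add_left (hm.const_mul _), lintegral_const_mul _ hm,
      lintegral_add_left measurable_const, lintegral_add_left' hl.1.ereal_toENNReal]
    simp only [lintegral_const, measure_univ, mul_one]
    exact ENNReal.add_ne_top.2 ⟨ENNReal.mul_ne_top ENNReal.ofReal_ne_top hfin,
      ENNReal.add_ne_top.2 ⟨ENNReal.one_ne_top, ENNReal.add_ne_top.2 ⟨h2, h1⟩⟩⟩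
  have hU : ∀ n, Measurable fun z : Ω × ℝ => mixUpperRank c (p z.1) (wt n) z.2 := fun n =>
    measurable_mixUpperRank.comp ((hp.comp measurable_fst).prodMk
      (measurable_const.prodMk measurable_snd))
  have hL : ∀ n, Measurable fun z : Ω × ℝ => mixLowerRank c (p z.1) (wt n) z.2 := fun n =>
    measurable_mixLowerRank.comp ((hp.comp measurable_fst).prodMk
      (measurable_const.prodMk measurable_snd))
  obtain ⟨G, hG, hGc, hGfin, hGT⟩ := exists_kernel_lt (safeKernel F hp c) F
    (R := fun n w => mixUpperRank c (p w) (wt n)) hU hSc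
    (hF.mono fun w hw n => compatible_mixUpper hw.pos hw.le_one hc.le (wt_pos n) (wt_le_one n))
    hSfin
    (hF.mono fun w hw n => (isRank_mixUpperRank hw.pos hw.le_one hc.le
      (wt_le_one n)).lintegral_rankLaw_ne_top hw.pos
      (mix_slopes hw.pos hw.le_one hc.le (wt_pos n) (wt_le_one n)).1 hw.integrable)
    measurable_id (fun _ => rfl) hu.1
    (hF.mono fun w hw x hx => exists_lt_integral_mixUpper hw hc.le hx) huT
  obtain ⟨G', hG', hGc', hGfin', hGT'⟩ := exists_kernel_lt (safeKernel F hp c) F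
    (R := fun n w => mixLowerRank c (p w) (wt n)) hL hSc
    (hF.mono fun w hw n => compatible_mixLower hw.pos hw.le_one hc.le (wt_pos n) (wt_le_one n))
    hSfin
    (hF.mono fun w hw n => (isRank_mixUpperRank hw.pos hw.le_one hc.le
      (wt_le_one n)).reflect.lintegral_rankLaw_ne_top hw.pos
      (mix_slopes hw.pos hw.le_one hc.le (wt_pos n) (wt_le_one n)).1 hw.integrable)
    (f := fun y => -y) measurable_neg (fun _ => enorm_neg _) hl.1.neg
    (hF.mono fun w hw x hx => by
      refine exists_lt_integral_mixLower hw hc.le ?_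
      rwa [mean_neg (Or.inl (lintegral_lower_ne_top hw.pos hw.le_one hc.le hw.integrable))]) hlT'
  have hneg : ∫ w, ∫ y, y ∂G' w ∂μ < T := by
    have h1 : ∫ w, ∫ y, -y ∂G' w ∂μ = -∫ w, ∫ y, y ∂G' w ∂μ := by
      rw [← integral_neg]
      exact integral_congr_ae (Filter.Eventually.of_forall fun w => integral_neg _)
    linarith
  obtain ⟨t, ht0, ht1, h1, h2⟩ := exists_mixKernel_integral_eq G G' hGfin hGfin' hGT hneg
  refine ⟨_, isMarkovKernel_mixKernel G G' ht0 ht1, ?_, h1, h2⟩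
  filter_upwards [hGc, hGc'] with w h3 h4
  exact h3.mix h4 ht0 ht1

end Attain

/-! ### Disintegration of the outcomes on a treatment arm -/

section Disintegration

variable {K : ℕ}

/-- The kernel `w ↦ outcomeLaw D x w`. -/
def outcomeKernel (D : Measure (Observed K)) [IsFiniteMeasure D] (x : Fin 2) :
    Kernel (Fin K → ℝ) ℝ :=
  (condDistrib (fun q : Observed K => q.1) (fun q => q.2) D).comap (fun w => (x, w))
    measurable_prodMk_left

instance (D : Measure (Observed K)) [IsFiniteMeasure D] (x : Fin 2) :
    IsMarkovKernel (outcomeKernel D x) := by unfold outcomeKernel; infer_instance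

theorem outcomeKernel_apply (D : Measure (Observed K)) [IsFiniteMeasure D] (x : Fin 2)
    (w : Fin K → ℝ) : outcomeKernel D x w = outcomeLaw D x w := rfl

theorem condDistrib_congr_map {α β Ω : Type*} [MeasurableSpace α] [MeasurableSpace β]
    [MeasurableSpace Ω] [StandardBorelSpace Ω] [Nonempty Ω] {μ ν : Measure α} [IsFiniteMeasure μ]
    [IsFiniteMeasure ν] {X : α → β} {Y : α → Ω}
    (h : μ.map (fun a => (X a, Y a)) = ν.map fun a => (X a, Y a)) :
    condDistrib Y X μ = condDistrib Y X ν := by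
  rw [condDistrib, condDistrib]
  congr 1

theorem map_compProd_comap {α β γ : Type*} [MeasurableSpace α] [MeasurableSpace β]
    [MeasurableSpace γ] {M : Measure α} [IsFiniteMeasure M] {f : α → β} (hf : Measurable f)
    (κ : Kernel β γ) [IsMarkovKernel κ] :
    (M ⊗ₘ κ.comap f hf).map (fun z => (f z.1, z.2)) = M.map f ⊗ₘ κ := by
  have hm : Measurable fun z : α × γ => (f z.1, z.2) := by fun_prop
  have := Measure.isFiniteMeasure_map M f
  refine Measure.ext_of_lintegral _ fun g hg => ?_
  rw [lintegral_map hg hm, Measure.lintegral_compProd (f := fun z => g (f z.1, z.2)) (hg.comp hm), Measure.lintegral_compProd hg,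
    lintegral_map (Measurable.lintegral_kernel_prod_right' hg) hf]
  rfl

variable (P : Measure (Latent K)) [IsProbabilityMeasure P]

theorem map_cov_restrict (x : Fin 2) :
    (P.restrict {o | treat o = x}).map cov =
      (covLaw (observedLaw P)).withDensity fun w => ENNReal.ofReal (pscore (observedLaw P) x w) := by
  refine Measure.ext fun s hs => ?_
  have h := setLIntegral_preimage_condDistrib (μ := observedLaw P)
    (X := fun q : Observed K => q.2.2) (Y := fun q => q.2.1) (by fun_prop) (by fun_prop)
    (MeasurableSet.singleton x) hs
  have hm : Measurable fun w =>
      condDistrib (fun q : Observed K => q.2.1) (fun q => q.2.2) (observedLaw P) w {x} :=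
    Kernel.measurable_coe _ (MeasurableSet.singleton x)
  have hp : ∀ w, ENNReal.ofReal (pscore (observedLaw P) x w) =
      condDistrib (fun q : Observed K => q.2.1) (fun q => q.2.2) (observedLaw P) w {x} :=
    fun w => ofReal_measureReal
  simp_rw [hp]
  rw [withDensity_apply _ hs, covLaw, setLIntegral_map hs hm
    (by fun_prop), Measure.map_apply measurable_cov hs,
    Measure.restrict_apply (measurable_cov hs)]
  rw [h, observedLaw, Measure.map_apply measurable_observe]
  · rfl
  · exact (measurable_snd.comp measurable_snd hs).inter
      (measurable_fst.comp measurable_snd (MeasurableSet.singleton x))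

theorem map_cov_pot_restrict (x : Fin 2) :
    (P.restrict {o | treat o = x}).map (fun o => (cov o, pot x o)) =
      (P.restrict {o | treat o = x}).map cov ⊗ₘ outcomeKernel (observedLaw P) x := by
  have hm : Measurable fun o : Latent K => (cov o, pot x o) := by fun_prop
  have := Measure.isFiniteMeasure_map (P.restrict {o : Latent K | treat o = x}) cov
  refine Measure.ext_prod fun {s t} hs ht => ?_
  have h := setLIntegral_preimage_condDistrib (μ := observedLaw P)
    (X := fun q : Observed K => q.2) (Y := fun q => q.1) (by fun_prop) (by fun_prop)
    ht ((MeasurableSet.singleton x).prod hs)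
  have hmt : Measurable fun z : Fin 2 × (Fin K → ℝ) =>
      condDistrib (fun q : Observed K => q.1) (fun q => q.2) (observedLaw P) z t :=
    Kernel.measurable_coe _ ht
  have hms : MeasurableSet ((fun q : Observed K => q.2) ⁻¹' ({x} ×ˢ s)) :=
    measurable_snd ((MeasurableSet.singleton x).prod hs)
  have h1 := setLIntegral_map (μ := P) hms (hmt.comp measurable_snd) measurable_observe
  have h2 := Measure.map_apply (μ := P) measurable_observe (hms.inter (measurable_fst ht))
  replace h := h1.symm.trans (h.trans h2)
  rw [Measure.compProd_apply_prod hs ht, setLIntegral_map hs (Kernel.measurable_coe _ ht)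
    measurable_cov, Measure.map_apply hm (hs.prod ht), Measure.restrict_apply (hm (hs.prod ht)),
    Measure.restrict_restrict (measurable_cov hs)]
  have hset : observe ⁻¹' ((fun q : Observed K => q.2) ⁻¹' ({x} ×ˢ s)) =
      cov ⁻¹' s ∩ {o | treat o = x} := by
    ext o
    simp only [observe_eq, mem_preimage, mem_inter_iff, mem_prod, mem_singleton_iff, mem_ofPred_eq]
    exact and_comm
  have hset' : observe ⁻¹' ((fun q : Observed K => q.2) ⁻¹' ({x} ×ˢ s) ∩
      (fun q : Observed K => q.1) ⁻¹' t) =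
      (fun o => (cov o, pot x o)) ⁻¹' s ×ˢ t ∩ {o | treat o = x} := by
    ext o
    simp only [observe_eq, mem_preimage, mem_inter_iff, mem_prod, mem_singleton_iff, mem_ofPred_eq]
    constructor
    · rintro ⟨⟨h3, h4⟩, h5⟩
      rw [h3] at h5
      exact ⟨⟨h4, h5⟩, h3⟩
    · rintro ⟨⟨h4, h5⟩, h3⟩
      rw [h3]
      exact ⟨⟨rfl, h4⟩, h5⟩
  rw [hset, hset'] at h
  rw [← h]
  refine setLIntegral_congr_fun ((measurable_cov hs).inter (measurableSet_treat x)) fun o ho => ?_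
  have : (observe o).2 = (x, cov o) := by
    rw [observe_eq, ← show treat o = x from ho.2]
  change _ = outcomeKernel (observedLaw P) x (cov o) t
  rw [Function.comp_apply, this]
  rfl

end Disintegration

/-! ### The modified law -/

section Construction

variable {K : ℕ} (P : Measure (Latent K)) [IsProbabilityMeasure P] (G : Kernel (Fin K → ℝ) ℝ)

/-- The law of `(W, Y_0)` on `X = 0`. -/
def untreatedLaw : Measure ((Fin K → ℝ) × ℝ) :=
  (P.restrict {o | treat o = 0}).map fun o => (cov o, pot 0 o)

instance : IsFiniteMeasure (untreatedLaw P) := by unfold untreatedLaw; infer_instance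

/-- The law of `(W, Y_0)` on `X = 1` when the law of `Y_0` given `W = w` is `G w`. -/
def treatedLaw : Measure ((Fin K → ℝ) × ℝ) := covLaw (observedLaw P) ⊗ₘ G - untreatedLaw P

/-- The vector of latent variables of a treated unit with `((W, Y_0), Y_1) = z`. -/
def treatedUnit (z : ((Fin K → ℝ) × ℝ) × ℝ) : Latent K := (![z.1.2, z.2], 1, z.1.1)

@[fun_prop]
theorem measurable_treatedUnit : Measurable (treatedUnit : _ → Latent K) := by
  refine Measurable.prodMk (measurable_pi_iff.2 fun i => ?_) (by fun_prop)
  fin_cases i <;> simp <;> fun_prop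

/-- The law of the latent variables on `X = 1`, with `Y_0` and `Y_1` conditionally independent. -/
def treatedLatent : Measure (Latent K) :=
  (treatedLaw P G ⊗ₘ (outcomeKernel (observedLaw P) 1).comap Prod.fst measurable_fst).map
    treatedUnit

/-- The law `P`, changed on `X = 1` so that the law of `Y_0` given `W = w` is `G w`. -/
def modifiedLaw : Measure (Latent K) := P.restrict {o | treat o = 0} + treatedLatent P G

theorem ae_treatedLatent : ∀ᵐ o ∂treatedLatent P G, treat o = 1 := by
  rw [treatedLatent, ae_map_iff (by fun_prop) (measurableSet_treat 1)]
  exact Filter.Eventually.of_forall fun _ => rfl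

theorem restrict_one_modifiedLaw :
    (modifiedLaw P G).restrict {o | treat o = 1} = treatedLatent P G := by
  have h : (P.restrict {o | treat o = 0}).restrict {o | treat o = 1} = 0 := by
    rw [Measure.restrict_restrict (measurableSet_treat 1), ← compl_treat_one, inter_compl_self,
      Measure.restrict_empty]
  rw [modifiedLaw, Measure.restrict_add, h, zero_add]
  exact Measure.restrict_eq_self_of_ae_mem (ae_treatedLatent P G)

theorem restrict_zero_modifiedLaw :
    (modifiedLaw P G).restrict {o | treat o = 0} = P.restrict {o | treat o = 0} := by
  have h : (treatedLatent P G).restrict {o | treat o = 0} = 0 := by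
    rw [Measure.restrict_eq_zero, ← compl_treat_one]
    exact ae_treatedLatent P G
  rw [modifiedLaw, Measure.restrict_add, h, add_zero, Measure.restrict_restrict
    (measurableSet_treat 0), inter_self]

variable [IsMarkovKernel G]

instance : IsFiniteMeasure (treatedLaw P G) := by unfold treatedLaw; infer_instance

instance : IsFiniteMeasure (treatedLatent P G) := by unfold treatedLatent; infer_instance

instance : IsFiniteMeasure (modifiedLaw P G) := by unfold modifiedLaw; infer_instance

theorem map_cov_pot_zero_treatedLatent :
    (treatedLatent P G).map (fun o => (cov o, pot 0 o)) = treatedLaw P G := by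
  rw [treatedLatent, Measure.map_map (by fun_prop) (by fun_prop)]
  exact Measure.fst_compProd _ _

variable {P G}

/-- Makes the truncated subtraction in `treatedLaw` a genuine one. It is the part `p F ≤ G` of
`Dep`, integrated over `w`. -/
theorem untreatedLaw_le (h : ∀ᵐ w ∂covLaw (observedLaw P), ∀ A, MeasurableSet A →
    pscore (observedLaw P) 0 w * (outcomeLaw (observedLaw P) 0 w).real A ≤ (G w).real A) :
    untreatedLaw P ≤ covLaw (observedLaw P) ⊗ₘ G := by
  refine Measure.le_iff.2 fun B hB => ?_
  have := Measure.isFiniteMeasure_map (P.restrict {o : Latent K | treat o = 0}) cov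
  rw [untreatedLaw, map_cov_pot_restrict, Measure.compProd_apply hB, Measure.compProd_apply hB,
    map_cov_restrict, lintegral_withDensity_eq_lintegral_mul _
      (measurable_pscore _ 0).ennreal_ofReal (Kernel.measurable_kernel_prodMk_left hB)]
  refine lintegral_mono_ae ?_
  filter_upwards [h] with w hw
  have h1 := hw _ (measurable_prodMk_left hB : MeasurableSet (Prod.mk w ⁻¹' B))
  rw [Pi.mul_apply, outcomeKernel_apply, ← ofReal_measureReal (μ := outcomeLaw _ 0 w),
    ← ENNReal.ofReal_mul (pscore_nonneg _ _ _), ← ofReal_measureReal (μ := G w)]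
  exact ENNReal.ofReal_le_ofReal h1

theorem restrict_treat_add (P : Measure (Latent K)) :
    P.restrict {o | treat o = 0} + P.restrict {o | treat o = 1} = P := by
  rw [← compl_treat_one, add_comm, Measure.restrict_add_restrict_compl (measurableSet_treat 1)]

/-- The law of W and its part on X = 0 are unchanged, so by cancellation of finite measures the part
on X = 1 is too. -/
theorem map_fst_treatedLaw (hle : untreatedLaw P ≤ covLaw (observedLaw P) ⊗ₘ G) :
    (treatedLaw P G).map Prod.fst = (P.restrict {o | treat o = 1}).map cov := by
  have h1 : treatedLaw P G + untreatedLaw P = covLaw (observedLaw P) ⊗ₘ G :=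
    Measure.sub_add_cancel_of_le hle
  have h2 := congrArg (Measure.map Prod.fst) h1
  rw [Measure.map_add _ _ measurable_fst] at h2
  have h3 : (covLaw (observedLaw P) ⊗ₘ G).map Prod.fst = covLaw (observedLaw P) :=
    Measure.fst_compProd _ _
  have h4 : (untreatedLaw P).map Prod.fst = (P.restrict {o | treat o = 0}).map cov := by
    rw [untreatedLaw, Measure.map_map (by fun_prop) (by fun_prop)]
    rfl
  have h5 : covLaw (observedLaw P) = (P.restrict {o | treat o = 1}).map cov +
      (P.restrict {o | treat o = 0}).map cov := by
    rw [covLaw_observedLaw, ← Measure.map_add _ _ measurable_cov, add_comm, restrict_treat_add]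
  rw [h3, h4, h5] at h2
  refine Measure.ext fun s _ => ?_
  have h6 := congrArg (fun m : Measure (Fin K → ℝ) => m s) h2
  simp only [Measure.add_apply] at h6
  exact (ENNReal.add_left_inj (measure_ne_top _ _)).1 h6

theorem map_cov_pot_one_treatedLatent (hle : untreatedLaw P ≤ covLaw (observedLaw P) ⊗ₘ G) :
    (treatedLatent P G).map (fun o => (cov o, pot 1 o)) =
      (P.restrict {o | treat o = 1}).map fun o => (cov o, pot 1 o) := by
  rw [treatedLatent, Measure.map_map (by fun_prop) (by fun_prop), map_cov_pot_restrict,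
    ← map_fst_treatedLaw hle, ← map_compProd_comap measurable_fst]
  rfl

theorem map_cov_pot_zero_modifiedLaw (hle : untreatedLaw P ≤ covLaw (observedLaw P) ⊗ₘ G) :
    (modifiedLaw P G).map (fun o => (cov o, pot 0 o)) = covLaw (observedLaw P) ⊗ₘ G := by
  rw [modifiedLaw, Measure.map_add _ _ (by fun_prop), map_cov_pot_zero_treatedLatent, add_comm]
  exact Measure.sub_add_cancel_of_le hle

/-- On X = 1 only the coupling with Y_0 changes; the joint law of W and Y_1 is kept. Anything that
depends on those two alone keeps its law. -/
theorem map_treatedLatent (hle : untreatedLaw P ≤ covLaw (observedLaw P) ⊗ₘ G) {β : Type*}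
    [MeasurableSpace β] {f : Latent K → β} {g : (Fin K → ℝ) × ℝ → β} (hg : Measurable g)
    (hfg : ∀ o, treat o = 1 → f o = g (cov o, pot 1 o)) :
    (treatedLatent P G).map f = (P.restrict {o | treat o = 1}).map f := by
  have hm : Measurable fun o : Latent K => (cov o, pot 1 o) := by fun_prop
  rw [Measure.map_congr ((ae_treatedLatent P G).mono hfg), Measure.map_congr
    ((ae_restrict_mem (measurableSet_treat 1)).mono hfg)]
  have h := congrArg (Measure.map g) (map_cov_pot_one_treatedLatent hle)
  rwa [Measure.map_map hg hm, Measure.map_map hg hm] at h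

theorem map_modifiedLaw (hle : untreatedLaw P ≤ covLaw (observedLaw P) ⊗ₘ G) {β : Type*}
    [MeasurableSpace β] {f : Latent K → β} (hf : Measurable f) {g : (Fin K → ℝ) × ℝ → β}
    (hg : Measurable g) (hfg : ∀ o, treat o = 1 → f o = g (cov o, pot 1 o)) :
    (modifiedLaw P G).map f = P.map f := by
  rw [modifiedLaw, Measure.map_add _ _ hf, map_treatedLatent hle hg hfg, ← Measure.map_add _ _ hf,
    restrict_treat_add]

theorem isProbabilityMeasure_modifiedLaw (hle : untreatedLaw P ≤ covLaw (observedLaw P) ⊗ₘ G) :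
    IsProbabilityMeasure (modifiedLaw P G) := by
  have h := map_modifiedLaw hle measurable_cov measurable_fst fun _ _ => rfl
  have hm := congrArg (fun m : Measure (Fin K → ℝ) => m univ) h
  simp only [Measure.map_apply measurable_cov MeasurableSet.univ, preimage_univ,
    measure_univ] at hm
  exact ⟨hm⟩

theorem observedLaw_modifiedLaw (hle : untreatedLaw P ≤ covLaw (observedLaw P) ⊗ₘ G) :
    observedLaw (modifiedLaw P G) = observedLaw P := by
  refine map_modifiedLaw hle measurable_observe
    (g := fun z => (z.2, 1, z.1)) (by fun_prop) fun o ho => ?_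
  rw [observe_eq, ho]

theorem potLaw_one_modifiedLaw (hle : untreatedLaw P ≤ covLaw (observedLaw P) ⊗ₘ G) :
    potLaw (modifiedLaw P G) 1 = potLaw P 1 := by
  funext w
  unfold potLaw
  rw [condDistrib_congr_map (map_modifiedLaw hle (by fun_prop) measurable_id fun _ _ => rfl)]

theorem potLawGiven_one_modifiedLaw (hle : untreatedLaw P ≤ covLaw (observedLaw P) ⊗ₘ G) :
    potLawGiven (modifiedLaw P G) 1 = potLawGiven P 1 := by
  funext x' w
  unfold potLawGiven
  rw [condDistrib_congr_map (map_modifiedLaw hle (by fun_prop)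
    (g := fun z => ((1, z.1), z.2)) (by fun_prop) fun o ho => by rw [ho])]

theorem potLaw_zero_modifiedLaw (hle : untreatedLaw P ≤ covLaw (observedLaw P) ⊗ₘ G) :
    ∀ᵐ w ∂covLaw (observedLaw P), potLaw (modifiedLaw P G) 0 w = G w := by
  have h1 : covLaw (observedLaw P) = (modifiedLaw P G).map cov := by
    rw [covLaw_observedLaw, map_modifiedLaw hle measurable_cov measurable_fst fun _ _ => rfl]
  have h2 := map_cov_pot_zero_modifiedLaw hle
  rw [h1] at h2 ⊢
  exact condDistrib_ae_eq_of_measure_eq_compProd cov (by fun_prop) h2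

end Construction

/-! ### Regularity under equivalence of measures -/

section Equivalence

variable {F ν : Measure ℝ}

theorem support_eq_of_ac (h : ν ≪ F) (h' : F ≪ ν) : ν.support = F.support :=
  Subset.antisymm h.support_mono h'.support_mono

variable [IsProbabilityMeasure F] [IsProbabilityMeasure ν]

/-- Continuity becomes the absence of atoms, a statement about null sets that passes to absolutely
continuous laws. -/
theorem continuous_cdf_iff : Continuous (cdf F) ↔ ∀ y, F {y} = 0 := by
  have h : ∀ y, F {y} = ENNReal.ofReal (cdf F y - Function.leftLim (cdf F) y) := by
    intro y
    rw [← StieltjesFunction.measure_singleton, measure_cdf]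
  rw [continuous_iff_continuousAt]
  refine forall_congr' fun y => ?_
  rw [(monotone_cdf F).continuousAt_iff_leftLim_eq_rightLim, StieltjesFunction.rightLim_eq, h,
    ENNReal.ofReal_eq_zero, sub_nonpos]
  exact ⟨fun h => h.ge, fun h => le_antisymm ((monotone_cdf F).leftLim_le le_rfl) h⟩

theorem continuous_cdf_of_ac (h : ν ≪ F) (hF : Continuous (cdf F)) : Continuous (cdf ν) :=
  continuous_cdf_iff.2 fun y => h (continuous_cdf_iff.1 hF y)

/-- Strictly between two support points lies a third by connectedness, and every neighbourhood of it
has positive mass. Strict monotonicity is thus a consequence of the support being an interval. -/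
theorem strictMonoOn_cdf (h : ν.support.OrdConnected) : StrictMonoOn (cdf ν) ν.support := by
  intro x hx y hy hxy
  obtain ⟨z, hz⟩ := exists_between hxy
  have hzs : z ∈ ν.support := h.out hx hy ⟨hz.1.le, hz.2.le⟩
  have h1 := (Measure.mem_support_iff_forall z).1 hzs _ (Ioo_mem_nhds hz.1 hz.2)
  rw [cdf_eq_real, cdf_eq_real]
  have h2 : ν.real (Iic y) = ν.real (Iic x) + ν.real (Ioc x y) := by
    rw [← measureReal_union (Iic_disjoint_Ioc le_rfl) measurableSet_Ioc, Iic_union_Ioc_eq_Iic hxy.le]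
  have h3 : 0 < ν.real (Ioc x y) :=
    ENNReal.toReal_pos (h1.trans_le (measure_mono Ioo_subset_Ioc_self)).ne' (measure_ne_top _ _)
  linarith

end Equivalence

/-! ### Admissibility of the modified law -/

section Admissible

variable {K : ℕ} {P P' : Measure (Latent K)} [IsProbabilityMeasure P] [IsProbabilityMeasure P']
  {c : ℝ}

/-- The laws of `Y_0` given the treatment and the covariates are equivalent to the law of `Y_0`
given the covariates. -/
theorem potLawGiven_zero_ac (hD : observedLaw P' = observedLaw P)
    (hreg : ∀ᵐ w ∂covLaw (observedLaw P), 0 < pscore (observedLaw P) 0 w)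
    (hG : ∀ᵐ w ∂covLaw (observedLaw P),
      Compatible (pscore (observedLaw P) 0 w) c (outcomeLaw (observedLaw P) 0 w) (potLaw P' 0 w)) :
    ∀ᵐ w ∂covLaw (observedLaw P), ∀ x' : Fin 2, 0 < pscore (observedLaw P) x' w →
      potLawGiven P' 0 x' w ≪ potLaw P' 0 w ∧ potLaw P' 0 w ≪ potLawGiven P' 0 x' w := by
  have h1 := outcomeLaw_ae_eq P' 0
  have h2 := slice_real_split P'
  have h3 := potLawGiven_ae_eq_slice P' 0
  simp only [hD] at h1 h2 h3
  filter_upwards [hreg, hG, h1, h2, h3] with w hp hc h1 h2 h3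
  intro x' hx'
  rcases (by decide : ∀ t : Fin 2, t = 0 ∨ t = 1) x' with rfl | rfl
  · rw [← h1 hp]
    exact ⟨hc.ac' hp, hc.ac⟩
  · have hadd := pscore_add (observedLaw P) w
    obtain ⟨b, hb, hle⟩ := hc.lt (by linarith)
    -- The treated law of Y_0, weighted by its propensity score, is `G - p F`, which lies between
    -- `(1 - b) G` and `G`. The strict inequality `b < 1` gives the second absolute continuity.
    have hkey : ∀ A, MeasurableSet A → pscore (observedLaw P) 1 w *
        (potLawGiven P' 0 1 w).real A = (potLaw P' 0 w).real A -
          pscore (observedLaw P) 0 w * (outcomeLaw (observedLaw P) 0 w).real A :=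
      fun A hA => (h3 1 A hA).trans (h2 hp A hA)
    constructor
    · have := le_smul_of_real_le hx' zero_le_one (F := potLaw P' 0 w)
        (G := potLawGiven P' 0 1 w) fun A hA => by
          rw [hkey A hA, one_mul]
          have := mul_nonneg hp.le (measureReal_nonneg (μ := outcomeLaw (observedLaw P) 0 w) (s := A))
          linarith
      exact (Measure.absolutelyContinuous_of_le this).trans Measure.smul_absolutelyContinuous
    · have := le_smul_of_real_le (sub_pos.2 hb) hx'.le (G := potLaw P' 0 w)
        (F := potLawGiven P' 0 1 w) fun A hA => by
          rw [hkey A hA]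
          linarith [hle A hA]
      exact (Measure.absolutelyContinuous_of_le this).trans Measure.smul_absolutelyContinuous

/-- The conditions on Y_1 carry over unchanged. Those on Y_0 depend on its conditional laws through
null sets, intervals of support and `Dep`, all supplied by `Compatible`. -/
theorem admissible_of_compatible (hP : Admissible P c) (hD : observedLaw P' = observedLaw P)
    (hreg : ∀ᵐ w ∂covLaw (observedLaw P),
      Regular (pscore (observedLaw P) 0 w) (outcomeLaw (observedLaw P) 0 w) ∧
        (outcomeLaw (observedLaw P) 0 w).support = (potLaw P 0 w).support)
    (h1 : potLaw P' 1 = potLaw P 1) (h2 : potLawGiven P' 1 = potLawGiven P 1)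
    (hG : ∀ᵐ w ∂covLaw (observedLaw P),
      Compatible (pscore (observedLaw P) 0 w) c (outcomeLaw (observedLaw P) 0 w) (potLaw P' 0 w)) :
    Admissible P' c := by
  have hp := pscore_zero_pos P hP
  have hac := potLawGiven_zero_ac hD hp hG
  constructor
  · rw [ContinuousOutcomes]
    simp only [hD]
    filter_upwards [hP.continuous_outcomes, hac, hreg, hG] with w hw hac hreg hG
    intro x x' hx'
    rcases (by decide : ∀ t : Fin 2, t = 0 ∨ t = 1) x with rfl | rfl
    · obtain ⟨ha, ha'⟩ := hac x' hx'
      have ha1 := ha.trans hG.ac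
      have ha2 := (hG.ac' hreg.1.pos).trans ha'
      refine ⟨continuous_cdf_of_ac ha1 hreg.1.continuous, strictMonoOn_cdf ?_⟩
      rw [support_eq_of_ac ha1 ha2]
      exact hreg.1.ordConnected
    · rw [h2]
      exact hw 1 x' hx'
  · rw [SupportIndependence]
    simp only [hD]
    filter_upwards [hP.support_independence, hac, hreg, hG] with w hw hac hreg hG
    intro x
    obtain ⟨a, b, hab, hs, hs'⟩ := hw x
    refine ⟨a, b, hab, ?_⟩
    rcases (by decide : ∀ t : Fin 2, t = 0 ∨ t = 1) x with rfl | rfl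
    · refine ⟨?_, fun x' hx' => support_eq_of_ac (hac x' hx').1 (hac x' hx').2⟩
      rw [support_eq_of_ac hG.ac (hG.ac' hreg.1.pos), hreg.2, hs]
    · rw [h1, h2]
      exact ⟨hs, hs'⟩
  · rw [hD]
    exact hP.treated_pos
  · simp only [hD]
    exact hP.pscore_lt_one
  · have h := condCDep_iff P' (c := c)
    simp only [hD] at h
    exact (h hp).2 (hG.mono fun w hw => hw.dep)

end Admissible

/-! ### Arithmetic of the endpoints -/

section Endpoints

/-- Solves the endpoint formula for the mean of Y_0: `r + p (m - e)` is the value of E(Y_0) at which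
the ATT equals `e`. -/
theorem lt_of_sub_div_lt {m r p e : ℝ} {U : EReal} (hp : 0 < p)
    (h : (m : EReal) - (U - (r : EReal)) / (p : EReal) < e) :
    ((r + p * (m - e) : ℝ) : EReal) < U := by
  have hp' : (0 : EReal) < (p : EReal) := EReal.coe_pos.2 hp
  induction U with
  | bot =>
    rw [sub_eq_add_neg ⊥, EReal.bot_add, EReal.bot_div_of_pos_ne_top hp' (EReal.coe_ne_top _)] at h
    exact absurd h (by simp)
  | top => exact EReal.coe_lt_top _
  | coe U =>
    rw [← EReal.coe_sub, ← EReal.coe_div, ← EReal.coe_sub, EReal.coe_lt_coe_iff, sub_lt_comm,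
      lt_div_iff₀ hp] at h
    rw [EReal.coe_lt_coe_iff]
    linarith

theorem lt_of_lt_sub_div {m r p e : ℝ} {L : EReal} (hp : 0 < p)
    (h : (e : EReal) < (m : EReal) - (L - (r : EReal)) / (p : EReal)) :
    L < ((r + p * (m - e) : ℝ) : EReal) := by
  have hp' : (0 : EReal) < (p : EReal) := EReal.coe_pos.2 hp
  induction L with
  | bot => exact EReal.bot_lt_coe _
  | top =>
    rw [EReal.top_sub_coe, EReal.top_div_of_pos_ne_top hp' (EReal.coe_ne_top _)] at h
    exact absurd h (by simp)
  | coe L =>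
    rw [← EReal.coe_sub, ← EReal.coe_div, ← EReal.coe_sub, EReal.coe_lt_coe_iff, lt_sub_comm,
      div_lt_iff₀ hp] at h
    rw [EReal.coe_lt_coe_iff]
    linarith

/-- For `m = ⊥` the right endpoint is `⊥`, and for `m = ⊤` the left endpoint is `⊤` because `U ≠ ⊤`;
in neither case is there an interior point. -/
theorem eq_coe_of_mem_Ioo {m U L : EReal} {r p e : ℝ} (hp : 0 < p) (htop : m = ⊤ → U ≠ ⊤)
    (h : (e : EReal) ∈ Ioo (m - (U - (r : EReal)) / (p : EReal))
      (m - (L - (r : EReal)) / (p : EReal))) : ∃ a : ℝ, m = a := by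
  have hp' : (0 : EReal) < (p : EReal) := EReal.coe_pos.2 hp
  induction m with
  | bot =>
    have h2 := h.2
    rw [sub_eq_add_neg ⊥, EReal.bot_add] at h2
    exact absurd h2 not_lt_bot
  | coe a => exact ⟨a, rfl⟩
  | top =>
    have h1 := h.1
    have hne : (U - (r : EReal)) / (p : EReal) ≠ ⊤ := by
      induction U with
      | bot =>
        rw [sub_eq_add_neg ⊥, EReal.bot_add,
          EReal.bot_div_of_pos_ne_top hp' (EReal.coe_ne_top _)]
        exact bot_ne_top
      | top => exact absurd rfl (htop rfl)
      | coe U =>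
        rw [← EReal.coe_sub, ← EReal.coe_div]
        exact EReal.coe_ne_top _
    rw [sub_eq_add_neg, EReal.top_add_of_ne_bot (by simpa using hne)] at h1
    exact absurd h1 not_top_lt

theorem integrable_of_mean_eq_coe {α : Type*} [MeasurableSpace α] {μ : Measure α} {f : α → ℝ}
    (hf : AEMeasurable f μ) {m : ℝ} (h : mean μ (fun a => (f a : EReal)) = m) :
    Integrable f μ := by
  have hN : ∫⁻ a, ENNReal.ofReal (-f a) ∂μ ≠ ⊤ := fun h1 => by
    have h2 : ∫⁻ a, (-(f a : EReal)).toENNReal ∂μ = ⊤ := by simpa [toENNReal_neg_coe] using h1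
    rw [mean, h2, EReal.coe_ennreal_top, sub_eq_add_neg, EReal.neg_top, EReal.add_bot] at h
    exact EReal.bot_ne_coe _ h
  refine integrable_of_lintegral_ne_top hf (fun h1 => ?_) hN
  have h2 : ∫⁻ a, ((f a : EReal)).toENNReal ∂μ = ⊤ := h1
  have h3 : ∫⁻ a, (-(f a : EReal)).toENNReal ∂μ ≠ ⊤ := by simpa [toENNReal_neg_coe] using hN
  rw [mean, h2, EReal.coe_ennreal_top, sub_eq_add_neg,
    EReal.top_add_of_ne_bot (by simpa using h3)] at h
  exact EReal.coe_ne_top _ h.symm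

theorem upperRank_zero {p τ : ℝ} (hp0 : 0 < p) (hp1 : p ≤ 1) (hτ : τ ∈ Ioo (0 : ℝ) 1) :
    upperRank 0 p τ = τ := by
  have h : τ ≤ τ / p := le_div_self hτ.1.le hp0 hp1
  rw [upperRank, zero_div, zero_mul, add_zero, min_eq_left h, min_eq_left hτ.2.le]

theorem lowerRank_zero {p τ : ℝ} (hp0 : 0 < p) (hp1 : p ≤ 1) (hτ : τ ∈ Ioo (0 : ℝ) 1) :
    lowerRank 0 p τ = τ := by
  have h : 1 - τ ≤ (1 - τ) / p := le_div_self (by linarith [hτ.2]) hp0 hp1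
  have h2 : (τ - 1) / p = -((1 - τ) / p) := by rw [← neg_div, neg_sub]
  have h3 : (τ - 1) / p + 1 ≤ τ := by linarith
  rw [lowerRank, zero_div, zero_mul, sub_zero, max_eq_left h3, max_eq_left hτ.1.le]

end Endpoints

/-! ### Sharpness of the interior -/

section Sharpness

variable {K : ℕ} {P : Measure (Latent K)} [IsProbabilityMeasure P] {c : ℝ}

theorem lowerE0_zero_eq_upperE0 (hP : Admissible P c) :
    lowerE0 (observedLaw P) 0 = upperE0 (observedLaw P) 0 := by
  refine mean_congr ?_
  filter_upwards [pscore_zero_pos P hP] with w hp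
  have hp1 : pscore (observedLaw P) 0 w ≤ 1 := by
    linarith [pscore_add (observedLaw P) w, pscore_nonneg (observedLaw P) 1 w]
  refine mean_congr ?_
  filter_upwards [ae_unif_mem] with τ hτ
  rw [lowerQ, upperQ, upperRank_zero hp hp1 hτ, lowerRank_zero hp hp1 hτ]

theorem lintegral_outcomeLaw_ne_top (hY0 : IntegrableOn (pot 0) {o | treat o = 0} P) :
    ∫⁻ w, ENNReal.ofReal (pscore (observedLaw P) 0 w) * ∫⁻ y, ‖y‖ₑ ∂outcomeLaw (observedLaw P) 0 w
      ∂covLaw (observedLaw P) ≠ ⊤ := by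
  have := Measure.isFiniteMeasure_map (P.restrict {o : Latent K | treat o = 0}) cov
  have h : ∫⁻ z, ‖z.2‖ₑ ∂(P.restrict {o : Latent K | treat o = 0}).map
      (fun o => (cov o, pot 0 o)) ≠ ⊤ := by
    rw [lintegral_map (by fun_prop) (by fun_prop)]
    exact hY0.2.ne
  rw [map_cov_pot_restrict, Measure.lintegral_compProd (by fun_prop), map_cov_restrict,
    lintegral_withDensity_eq_lintegral_mul _ (measurable_pscore _ 0).ennreal_ofReal
      (Measurable.lintegral_kernel (by fun_prop))] at h
  exact h

theorem integrable_pot_zero_modifiedLaw {G : Kernel (Fin K → ℝ) ℝ} [IsMarkovKernel G]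
    (hle : untreatedLaw P ≤ covLaw (observedLaw P) ⊗ₘ G)
    (hG : ∫⁻ w, ∫⁻ y, ‖y‖ₑ ∂G w ∂covLaw (observedLaw P) ≠ ⊤) :
    Integrable (pot 0) (modifiedLaw P G) ∧
      ∫ o, pot 0 o ∂modifiedLaw P G = ∫ w, ∫ y, y ∂G w ∂covLaw (observedLaw P) := by
  have h := map_cov_pot_zero_modifiedLaw hle
  have hi : Integrable (fun z : (Fin K → ℝ) × ℝ => z.2) (covLaw (observedLaw P) ⊗ₘ G) := by
    refine ⟨by fun_prop, ?_⟩
    rw [HasFiniteIntegral, Measure.lintegral_compProd (by fun_prop)]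
    exact hG.lt_top
  have hint := Measure.integral_compProd hi
  rw [← h] at hi hint
  rw [integrable_map_measure (by fun_prop) (by fun_prop)] at hi
  rw [integral_map (by fun_prop) (by fun_prop)] at hint
  exact ⟨hi, hint⟩

theorem exists_admissible_att_eq (hc0 : 0 ≤ c) (hc1 : c ≤ 1) (hP : Admissible P c)
    (hY0 : IntegrableOn (pot 0) {o | treat o = 0} P) (h1 : P {o | treat o = 1} ≠ 0) {m e : ℝ}
    (hm : mean (latentTreated P) (fun o => (pot 1 o : EReal)) = m)
    (hlow : HasMean (covLaw (observedLaw P)) (lowerE0Given (observedLaw P) c))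
    (hup : HasMean (covLaw (observedLaw P)) (upperE0Given (observedLaw P) c))
    (hL : lowerE0 (observedLaw P) c <
      (((∫ o in {o | treat o = 0}, pot 0 o ∂P) + P.real {o | treat o = 1} * (m - e) : ℝ) : EReal))
    (hU : (((∫ o in {o | treat o = 0}, pot 0 o ∂P) + P.real {o | treat o = 1} * (m - e) : ℝ) :
      EReal) < upperE0 (observedLaw P) c) :
    ∃ (P' : Measure (Latent K)) (_ : IsProbabilityMeasure P'),
      Admissible P' c ∧ observedLaw P' = observedLaw P ∧ HasATT P' ∧ att P' = (e : EReal) := by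
  -- For `c = 0` both rank maps are the identity on `(0, 1)`, so the bounds on E(Y_0) coincide and
  -- nothing lies strictly between them.
  have hc : 0 < c := by
    refine lt_of_le_of_ne hc0 fun h => ?_
    subst h
    rw [lowerE0_zero_eq_upperE0 hP] at hL
    exact lt_asymm hL hU
  have hreg := regular_outcomeLaw P hP hY0
  obtain ⟨G, hGm, hGc, hGfin, hGT⟩ := exists_compatible_integral_eq (μ := covLaw (observedLaw P))
    (outcomeKernel (observedLaw P) 0) (measurable_pscore _ 0) (pscore_nonneg _ 0)
    (fun w => by
      linarith [pscore_add (observedLaw P) w, pscore_nonneg (observedLaw P) 1 w]) hc hc1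
    (hreg.mono fun w hw => hw.1) (lintegral_outcomeLaw_ne_top hY0) hlow hup hL hU
  have hle : untreatedLaw P ≤ covLaw (observedLaw P) ⊗ₘ G :=
    untreatedLaw_le (hGc.mono fun w hw A hA => (hw.dep A hA).1)
  have hprob := isProbabilityMeasure_modifiedLaw hle
  have hD := observedLaw_modifiedLaw hle
  refine ⟨modifiedLaw P G, hprob, ?_, hD, ?_⟩
  · refine admissible_of_compatible hP hD hreg (potLaw_one_modifiedLaw hle)
      (potLawGiven_one_modifiedLaw hle) ?_
    filter_upwards [hGc, potLaw_zero_modifiedLaw hle] with w h2 h3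
    rwa [h3]
  obtain ⟨hi0, hint0⟩ := integrable_pot_zero_modifiedLaw hle hGfin
  have hmap : ((modifiedLaw P G).restrict {o | treat o = 1}).map (pot 1) =
      (P.restrict {o | treat o = 1}).map (pot 1) := by
    rw [restrict_one_modifiedLaw]
    exact map_treatedLatent hle measurable_snd fun _ _ => rfl
  have hreal : (modifiedLaw P G).real {o | treat o = 1} = P.real {o | treat o = 1} := by
    rw [← treatProb_observedLaw, hD, treatProb_observedLaw]
  have hpos : 0 < P.real {o : Latent K | treat o = 1} := ENNReal.toReal_pos h1 (measure_ne_top _ _)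
  have h1' : modifiedLaw P G {o | treat o = 1} ≠ 0 := fun h => by
    rw [← hreal, measureReal_def, h] at hpos
    simp at hpos
  have hiP : Integrable (pot 1) (latentTreated P) :=
    integrable_of_mean_eq_coe (by fun_prop) hm
  have hmP : (∫ o in {o | treat o = 1}, pot 1 o ∂P) = m * P.real {o | treat o = 1} := by
    rw [mean_coe hiP, EReal.coe_eq_coe_iff, latentTreated, integral_cond] at hm
    rw [← hm, div_mul_cancel₀ _ hpos.ne']
  have hi1 : IntegrableOn (pot 1) {o | treat o = 1} (modifiedLaw P G) := by
    have h2 := (integrable_cond_iff h1).1 hiP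
    have h3 : Integrable id ((P.restrict {o | treat o = 1}).map (pot 1)) :=
      (integrable_map_measure (by fun_prop) (by fun_prop)).2 h2
    rw [← hmap] at h3
    exact (integrable_map_measure (by fun_prop) (by fun_prop)).1 h3
  have hint1 : (∫ o in {o | treat o = 1}, pot 1 o ∂modifiedLaw P G) =
      m * P.real {o | treat o = 1} := by
    have h2 := congrArg (fun ν : Measure ℝ => ∫ y, y ∂ν) hmap
    rw [integral_map (by fun_prop) (by fun_prop), integral_map (by fun_prop) (by fun_prop)] at h2
    rw [h2, hmP]
  -- The untreated part is unchanged and the total mean of Y_0 is the prescribed value, so the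
  -- treated part is the remainder.
  have hint2 : (∫ o in {o | treat o = 1}, pot 0 o ∂modifiedLaw P G) =
      P.real {o | treat o = 1} * (m - e) := by
    have h2 := integral_add_compl (measurableSet_treat 1) hi0
    rw [compl_treat_one, restrict_zero_modifiedLaw, hint0, hGT] at h2
    linarith
  have hi : Integrable (fun o => pot 1 o - pot 0 o) (latentTreated (modifiedLaw P G)) :=
    (integrable_cond_iff h1').2 (hi1.sub hi0.integrableOn)
  refine ⟨hasMean_coe hi, ?_⟩
  rw [att, mean_coe hi, latentTreated, integral_cond, integral_sub hi1 hi0.integrableOn, hint1,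
    hint2, hreal, EReal.coe_eq_coe_iff, div_eq_iff hpos.ne']
  ring

end Sharpness

end

end ATTBounds

/-! ### The bounds on the ATT and their sharpness -/

theorem mainTheorem6 (K : ℕ) (c : ℝ) (hc0 : 0 ≤ c) (hc1 : c ≤ 1)
    (P : Measure (Latent K)) [IsProbabilityMeasure P] (hP : Admissible P c)
    -- The means in the bounds exist; those of `E(Y | X = 1)` and `E(Y_0)` may be infinite.
    (hY1 : HasMean (givenTreat (observedLaw P) 1) (fun q => (q.1 : EReal)))
    (hY0 : Integrable (fun q : Observed K => q.1) (givenTreat (observedLaw P) 0))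
    (hlow : HasMean (covLaw (observedLaw P)) (lowerE0Given (observedLaw P) c))
    (hup : HasMean (covLaw (observedLaw P)) (upperE0Given (observedLaw P) c))
    -- No `∞ - ∞` occurs in the two endpoints.
    (htop : meanGiven (observedLaw P) 1 = ⊤ → upperE0 (observedLaw P) c ≠ ⊤)
    (hbot : meanGiven (observedLaw P) 1 = ⊥ → lowerE0 (observedLaw P) c ≠ ⊥) :
    -- The ATT lies between the bounds.
    (HasATT P →
      att P ∈ Icc (attOf (observedLaw P) (upperE0 (observedLaw P) c))
        (attOf (observedLaw P) (lowerE0 (observedLaw P) c))) ∧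
    -- Every interior point is the ATT of an admissible law with the same law of `(Y, X, W)`.
    (∀ e : ℝ,
      (e : EReal) ∈ Ioo (attOf (observedLaw P) (upperE0 (observedLaw P) c))
        (attOf (observedLaw P) (lowerE0 (observedLaw P) c)) →
      ∃ (P' : Measure (Latent K)) (_ : IsProbabilityMeasure P'),
        Admissible P' c ∧ observedLaw P' = observedLaw P ∧
          HasATT P' ∧ att P' = (e : EReal)) := by
  have hp : 0 < P.real {o : Latent K | treat o = 1} := by
    rw [← treatProb_observedLaw]
    exact hP.treated_pos
  have h1 : P {o | treat o = 1} ≠ 0 := fun h => by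
    rw [measureReal_def, h] at hp
    simp at hp
  have h0 := measure_treat_zero_ne_zero P (pscore_zero_pos P hP)
  have hY0' := integrableOn_pot P h0 hY0
  have hmean : meanGiven (observedLaw P) 1 = mean (latentTreated P) fun o => (pot 1 o : EReal) :=
    meanGiven_observedLaw P 1
  rw [hmean] at htop hbot
  have hY1' : HasMean (latentTreated P) fun o => (pot 1 o : EReal) := by
    have hae : ∀ᵐ o ∂latentTreated P, (observe o).1 = pot 1 o := ae_cond_observe_eq P 1
    obtain ⟨-, h⟩ := hY1
    rw [givenTreat_observedLaw, lintegral_map (by fun_prop) measurable_observe,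
      lintegral_map (by fun_prop) measurable_observe] at h
    refine ⟨by fun_prop, h.imp (fun h => ?_) fun h => ?_⟩
    · refine ne_of_eq_of_ne (lintegral_congr_ae ?_) h
      filter_upwards [hae] with o ho
      simp only [ho]
    · refine ne_of_eq_of_ne (lintegral_congr_ae ?_) h
      filter_upwards [hae] with o ho
      simp only [ho]
  refine ⟨att_mem_Icc hc0 hP hY0' h1 h0 hY1' hlow hup htop hbot, fun e he => ?_⟩
  rw [attOf_observedLaw P h0 hY0', attOf_observedLaw P h0 hY0'] at he
  -- A nonempty open interval forces a finite treated mean of Y_1, so the construction only deals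
  -- with a real `m`.
  obtain ⟨m, hm⟩ := eq_coe_of_mem_Ioo hp htop he
  rw [hm] at he
  exact exists_admissible_att_eq hc0 hc1 hP hY0' h1 hm hlow hup (lt_of_lt_sub_div hp he.2)
    (lt_of_sub_div_lt hp he.1)
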